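/- A *brace* means a skew left brace: a set $B$ with two (not necessarily abelian) group structures $(B,+)$ and $(B,\cdot)$ such that $a\cdot(b+c)=a\cdot b-a+a\cdot c$ for all $a,b,c\in B$; the two groups have the same identity element $0$. Put $\lambda_a(b)=-a+ab$ and $\operatorname{Soc}(B)=\operatorname{Ker}\lambda\cap Z(B,+)$. An *ideal* of $B$ is a subset which is a normal subgroup of both $(B,+)$ and $(B,\cdot)$ and is invariant under every $\lambda_b$, $b\in B$; ideals can be factored out. A brace $B$ is *almost polycyclic* if it has a finite chain of ideals $\{0\}=I_0\le I_1\le\dots\le I_n=B$ such that, for each $0\le i<n$, either $I_{i+1}/I_i$ is finite, or $(I_{i+1}/I_i,+)$ is finitely generated and $I_{i+1}/I_i\le\operatorname{Soc}(B/I_i)$. It is *supersoluble* if it has a finite chain of ideals $\{0\}=I_0\le I_1\le\dots\le I_n=B$ such that, for each $0\le i<n$, either $(I_{i+1}/I_i,+)$ is infinite cyclic and $I_{i+1}/I_i\le\operatorname{Soc}(B/I_i)$, or $I_{i+1}/I_i$ has prime order. A *$b$-word* in symbols $x_1,\dots,x_m$ is a formal expression built from the empty word and the $x_i$ by the operations $w_1+w_2$,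 $w_1\cdot w_2$, $-w$, $w^{-1}$. A *finite presentation* of $B$ consists of a number $m\ge 0$, finitely many $b$-words $\rho_1,\dots,\rho_k$ in $x_1,\dots,x_m$, and a surjective homomorphism $\theta\colon F\to B$ from the free brace $F$ on $x_1,\dots,x_m$ whose kernel is the ideal of $F$ generated by the elements that $\rho_1,\dots,\rho_k$ represent. The data $(m;\rho_1,\dots,\rho_k)$ are a finite object that can be given to an algorithm as input. **Theorem 3.46.** There is a single algorithm (a partial recursive function) which, given as input the data $(m;\rho_1,\dots,\rho_k)$ of any finite presentation of any almost polycyclic brace $B$, halts and correctly answers whether or not $B$ is supersoluble. -/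

import Mathlib

universe u v

/-- A skew left brace: a set with two group structures `(B, +)` (not necessarily abelian) and
`(B, *)` such that `a * (b + c) = a * b - a + a * c`. -/
class SkewBrace (B : Type u) extends AddGroup B, Group B where
  mul_add_eq : ∀ a b c : B, a * (b + c) = a * b - a + a * c

namespace SkewBrace

variable {B : Type u} [SkewBrace B]

/-- The two identity elements coincide. -/
theorem one_eq_zero : (1 : B) = 0 := by
  have h := mul_add_eq (1 : B) 0 0
  simp only [one_mul, add_zero, zero_sub] at h
  have h2 : -(1 : B) = 0 := h.symm
  simpa using h2

/-- `λ_a(b) = -a + a * b`. -/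
def lam (a b : B) : B := -a + a * b

theorem mul_eq (a b : B) : a * b = a + lam a b := by simp [lam]

theorem mul_zero' (a : B) : a * 0 = a := by rw [← one_eq_zero, mul_one]

theorem lam_mul (a b c : B) : lam (a * b) c = lam a (lam b c) := by
  have h : a * (b * c) = a * b - a + a * lam b c := by rw [mul_eq b c, mul_add_eq]
  rw [lam, lam, mul_assoc, h]
  simp [sub_eq_add_neg, add_assoc]

theorem lam_one (b : B) : lam 1 b = b := by simp [lam, one_eq_zero]

theorem add_eq (a i : B) : a + i = a * lam a⁻¹ i := by
  rw [mul_eq, ← lam_mul, mul_inv_cancel, lam_one]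

/-- The socle `Soc(B) = Ker λ ∩ Z(B, +)`. -/
def socle (B : Type u) [SkewBrace B] : Set B :=
  {a | (∀ b, lam a b = b) ∧ ∀ b, a + b = b + a}

end SkewBrace

open SkewBrace in
/-- An ideal of a skew brace: a subgroup of `(B, +)` and of `(B, *)` which is invariant under all
`λ_b`, normal in `(B, +)` and normal in `(B, *)`. -/
structure BraceIdeal (B : Type u) [SkewBrace B] extends AddSubgroup B where
  one_mem' : (1 : B) ∈ carrier
  mul_mem' : ∀ {a b : B}, a ∈ carrier → b ∈ carrier → a * b ∈ carrier
  inv_mem' : ∀ {a : B}, a ∈ carrier → a⁻¹ ∈ carrier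
  lam_mem' : ∀ (b : B) {a : B}, a ∈ carrier → lam b a ∈ carrier
  add_conj_mem' : ∀ (b : B) {a : B}, a ∈ carrier → b + a - b ∈ carrier
  mul_conj_mem' : ∀ (b : B) {a : B}, a ∈ carrier → b * a * b⁻¹ ∈ carrier

namespace BraceIdeal

open SkewBrace

variable {B : Type u} [SkewBrace B]

instance : Membership B (BraceIdeal B) := ⟨fun I a => a ∈ I.carrier⟩

/-- The ideal generated by a subset `S`: the smallest ideal containing `S`. -/
def span (S : Set B) : BraceIdeal B where
  carrier := {a | ∀ I : BraceIdeal B, S ⊆ I.carrier → a ∈ I.carrier}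
  zero_mem' _ _ := AddSubgroup.zero_mem _
  add_mem' ha hb I h := I.add_mem' (ha I h) (hb I h)
  neg_mem' ha I h := I.neg_mem' (ha I h)
  one_mem' I _ := I.one_mem'
  mul_mem' ha hb I h := I.mul_mem' (ha I h) (hb I h)
  inv_mem' ha I h := I.inv_mem' (ha I h)
  lam_mem' b _ ha I h := I.lam_mem' b (ha I h)
  add_conj_mem' b _ ha I h := I.add_conj_mem' b (ha I h)
  mul_conj_mem' b _ ha I h := I.mul_conj_mem' b (ha I h)

instance (I : BraceIdeal B) : I.toAddSubgroup.Normal :=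
  ⟨fun _ ha b => by
    have h := I.add_conj_mem' b ha
    rwa [sub_eq_add_neg] at h⟩

/-- The underlying set of the quotient brace `B / I`. -/
def Quot (I : BraceIdeal B) : Type u := B ⧸ I.toAddSubgroup

instance (I : BraceIdeal B) : AddGroup I.Quot :=
  inferInstanceAs (AddGroup (B ⧸ I.toAddSubgroup))

/-- The canonical projection `B → B / I`, as an additive homomorphism. -/
def proj (I : BraceIdeal B) : B →+ I.Quot := QuotientAddGroup.mk' I.toAddSubgroup

theorem proj_surjective (I : BraceIdeal B) : Function.Surjective I.proj :=
  QuotientAddGroup.mk'_surjective _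

theorem proj_eq (I : BraceIdeal B) {a b : B} : I.proj a = I.proj b ↔ -a + b ∈ I.carrier :=
  QuotientAddGroup.eq

/-- Additive and multiplicative cosets of an ideal coincide. -/
theorem proj_eq_iff_mul (I : BraceIdeal B) {a b : B} :
    I.proj a = I.proj b ↔ a⁻¹ * b ∈ I.carrier := by
  rw [proj_eq]
  constructor
  · intro h
    have h2 := I.lam_mem' a⁻¹ h
    have h3 : a⁻¹ * b = lam a⁻¹ (-a + b) := by
      have := add_eq a (-a + b)
      rw [add_neg_cancel_left] at this
      rw [eq_comm, ← mul_right_inj a, ← this, mul_inv_cancel_left]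
    rwa [h3]
  · intro h
    have h2 := I.lam_mem' a h
    simpa [lam] using h2

theorem proj_mul_congr (I : BraceIdeal B) {a a' b b' : B} (ha : I.proj a = I.proj a')
    (hb : I.proj b = I.proj b') : I.proj (a * b) = I.proj (a' * b') := by
  rw [proj_eq_iff_mul] at *
  have h1 : b⁻¹ * (a⁻¹ * a') * b ∈ I.carrier := by
    simpa using I.mul_conj_mem' b⁻¹ ha
  have h2 := I.mul_mem' h1 hb
  have h3 : (a * b)⁻¹ * (a' * b') = b⁻¹ * (a⁻¹ * a') * b * (b⁻¹ * b') := by group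
  rwa [h3]

theorem proj_inv_congr (I : BraceIdeal B) {a a' : B} (ha : I.proj a = I.proj a') :
    I.proj a⁻¹ = I.proj a'⁻¹ := by
  rw [proj_eq_iff_mul] at *
  have h1 := I.inv_mem' (I.mul_conj_mem' a ha)
  have h3 : a⁻¹⁻¹ * a'⁻¹ = (a * (a⁻¹ * a') * a⁻¹)⁻¹ := by group
  rwa [h3]

instance (I : BraceIdeal B) : Mul I.Quot :=
  ⟨Quotient.map₂ (· * ·) fun _ _ ha _ _ hb =>
    Quotient.exact (I.proj_mul_congr (Quotient.sound ha) (Quotient.sound hb))⟩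

instance (I : BraceIdeal B) : Inv I.Quot :=
  ⟨Quotient.map (·⁻¹) fun _ _ ha => Quotient.exact (I.proj_inv_congr (Quotient.sound ha))⟩

instance (I : BraceIdeal B) : One I.Quot := ⟨I.proj 1⟩

theorem proj_mul (I : BraceIdeal B) (a b : B) : I.proj (a * b) = I.proj a * I.proj b := rfl

theorem proj_inv (I : BraceIdeal B) (a : B) : I.proj a⁻¹ = (I.proj a)⁻¹ := rfl

theorem proj_one (I : BraceIdeal B) : I.proj (1 : B) = 1 := rfl

/-- The quotient brace `B / I`. -/
instance (I : BraceIdeal B) : SkewBrace I.Quot where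
  toAddGroup := inferInstance
  toGroup := Group.ofLeftAxioms
    (fun x y z => by
      obtain ⟨a, rfl⟩ := I.proj_surjective x
      obtain ⟨b, rfl⟩ := I.proj_surjective y
      obtain ⟨c, rfl⟩ := I.proj_surjective z
      simp only [← proj_mul, mul_assoc])
    (fun x => by
      obtain ⟨a, rfl⟩ := I.proj_surjective x
      simp only [← proj_mul, ← proj_one, one_mul])
    (fun x => by
      obtain ⟨a, rfl⟩ := I.proj_surjective x
      simp only [← proj_mul, ← proj_inv, ← proj_one, inv_mul_cancel])
  mul_add_eq x y z := by
    obtain ⟨a, rfl⟩ := I.proj_surjective x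
    obtain ⟨b, rfl⟩ := I.proj_surjective y
    obtain ⟨c, rfl⟩ := I.proj_surjective z
    have h := congrArg I.proj (mul_add_eq a b c)
    rw [map_add, map_sub] at h
    simp only [proj_mul, map_add] at h
    exact h

/-- The factor `J / I`, as a subgroup of `(B / I, +)` (it is used for ideals `I ≤ J`). -/
def factor (I J : BraceIdeal B) : AddSubgroup I.Quot := J.toAddSubgroup.map I.proj

end BraceIdeal

section Classes

variable (B : Type u) [SkewBrace B]

/-- `B` is supersoluble: there is a finite chain of ideals `{0} = I 0 ≤ I 1 ≤ ... ≤ I n = B` of `B`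
such that each factor `I (i+1) / I i` either is additively infinite cyclic and contained in
`Soc(B / I i)`, or has prime order. -/
def SkewBrace.IsSupersoluble : Prop :=
  ∃ (n : ℕ) (I : ℕ → BraceIdeal B),
    (I 0).carrier = {0} ∧ (I n).carrier = Set.univ ∧
    ∀ i < n, (I i).carrier ⊆ (I (i + 1)).carrier ∧
      ((IsAddCyclic ((I i).factor (I (i + 1))) ∧ Infinite ((I i).factor (I (i + 1))) ∧
          ((I i).factor (I (i + 1)) : Set (I i).Quot) ⊆ SkewBrace.socle (I i).Quot) ∨
        (Nat.card ((I i).factor (I (i + 1)))).Prime)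

/-- `B` is almost polycyclic: there is a finite chain of ideals
`{0} = I 0 ≤ I 1 ≤ ... ≤ I n = B` of `B` such that each factor `I (i+1) / I i` either is finite, or
is finitely generated and contained in `Soc(B / I i)`. -/
def SkewBrace.IsAlmostPolycyclic : Prop :=
  ∃ (n : ℕ) (I : ℕ → BraceIdeal B),
    (I 0).carrier = {0} ∧ (I n).carrier = Set.univ ∧
    ∀ i < n, (I i).carrier ⊆ (I (i + 1)).carrier ∧
      (Finite ((I i).factor (I (i + 1))) ∨
        (((I i).factor (I (i + 1))).FG ∧
          ((I i).factor (I (i + 1)) : Set (I i).Quot) ⊆ SkewBrace.socle (I i).Quot))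

end Classes

/-- A homomorphism of skew braces. -/
structure BraceHom (A : Type u) (B : Type v) [SkewBrace A] [SkewBrace B] where
  toFun : A → B
  map_add' : ∀ a b, toFun (a + b) = toFun a + toFun b
  map_mul' : ∀ a b, toFun (a * b) = toFun a * toFun b

/-- `b`-words in the symbols `X`. -/
inductive BWord (X : Type u) : Type u
  | empty : BWord X
  | of : X → BWord X
  | add : BWord X → BWord X → BWord X
  | mul : BWord X → BWord X → BWord X
  | neg : BWord X → BWord X
  | inv : BWord X → BWord X

namespace BWord

/-- Renaming the symbols of a `b`-word. -/
def map {X : Type u} {Y : Type v} (f : X → Y) : BWord X → BWord Y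
  | empty => empty
  | of x => of (f x)
  | add w₁ w₂ => add (map f w₁) (map f w₂)
  | mul w₁ w₂ => mul (map f w₁) (map f w₂)
  | neg w => neg (map f w)
  | inv w => inv (map f w)

/-- The value of a `b`-word in a skew brace. -/
def eval {X : Type u} {B : Type v} [SkewBrace B] (b : X → B) : BWord X → B
  | empty => 0
  | of x => b x
  | add w₁ w₂ => eval b w₁ + eval b w₂
  | mul w₁ w₂ => eval b w₁ * eval b w₂
  | neg w => -eval b w
  | inv w => (eval b w)⁻¹

/-- The smallest congruence on `b`-words whose quotient is a skew brace, the empty word being the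
common identity element. -/
inductive Rel {X : Type u} : BWord X → BWord X → Prop
  | refl (a) : Rel a a
  | symm {a b} : Rel a b → Rel b a
  | trans {a b c} : Rel a b → Rel b c → Rel a c
  | add_congr {a a' b b'} : Rel a a' → Rel b b' → Rel (add a b) (add a' b')
  | mul_congr {a a' b b'} : Rel a a' → Rel b b' → Rel (mul a b) (mul a' b')
  | neg_congr {a a'} : Rel a a' → Rel (neg a) (neg a')
  | inv_congr {a a'} : Rel a a' → Rel (inv a) (inv a')
  | add_assoc (a b c) : Rel (add (add a b) c) (add a (add b c))
  | zero_add (a) : Rel (add empty a) a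
  | neg_add_cancel (a) : Rel (add (neg a) a) empty
  | mul_assoc (a b c) : Rel (mul (mul a b) c) (mul a (mul b c))
  | one_mul (a) : Rel (mul empty a) a
  | inv_mul_cancel (a) : Rel (mul (inv a) a) empty
  | brace (a b c) : Rel (mul a (add b c)) (add (add (mul a b) (neg a)) (mul a c))

instance setoid (X : Type u) : Setoid (BWord X) := ⟨Rel, Rel.refl, Rel.symm, Rel.trans⟩

/-- A Gödel numbering of the `b`-words in the symbols `x_0, x_1, ...`. -/
def code : BWord ℕ → ℕ
  | empty => 0
  | of i => 5 * i + 1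
  | add w₁ w₂ => 5 * Nat.pair (code w₁) (code w₂) + 2
  | mul w₁ w₂ => 5 * Nat.pair (code w₁) (code w₂) + 3
  | neg w => 5 * code w + 4
  | inv w => 5 * code w + 5

/-- The inverse of the Gödel numbering. -/
def ofCode : ℕ → BWord ℕ
  | 0 => empty
  | n + 1 =>
    have h : n / 5 < n + 1 := Nat.lt_succ_of_le (Nat.div_le_self _ _)
    have _h1 : (n / 5).unpair.1 < n + 1 := (Nat.unpair_left_le _).trans_lt h
    have _h2 : (n / 5).unpair.2 < n + 1 := (Nat.unpair_right_le _).trans_lt h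
    match n % 5 with
    | 0 => of (n / 5)
    | 1 => add (ofCode (n / 5).unpair.1) (ofCode (n / 5).unpair.2)
    | 2 => mul (ofCode (n / 5).unpair.1) (ofCode (n / 5).unpair.2)
    | 3 => neg (ofCode (n / 5))
    | _ => inv (ofCode (n / 5))

theorem ofCode_code (w : BWord ℕ) : ofCode (code w) = w := by
  have key : ∀ m r : ℕ, r < 5 → (5 * m + r) / 5 = m ∧ (5 * m + r) % 5 = r := by
    intro m r hr; omega
  induction w with
  | empty => simp [code, ofCode]
  | of i => rw [code, ofCode]; simp
  | add a b iha ihb =>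
    obtain ⟨h1, h2⟩ := key (Nat.pair (code a) (code b)) 1 (by omega)
    rw [code, ofCode]; simp [h1, h2, iha, ihb]
  | mul a b iha ihb =>
    obtain ⟨h1, h2⟩ := key (Nat.pair (code a) (code b)) 2 (by omega)
    rw [code, ofCode]; simp [h1, h2, iha, ihb]
  | neg a iha =>
    obtain ⟨h1, h2⟩ := key (code a) 3 (by omega)
    rw [code, ofCode]; simp [h1, h2, iha]
  | inv a iha =>
    obtain ⟨h1, h2⟩ := key (code a) 4 (by omega)
    rw [code, ofCode]; simp [h1, h2, iha]

theorem code_ofCode (n : ℕ) : code (ofCode n) = n := by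
  induction n using Nat.strong_induction_on with
  | _ n ih =>
    cases n with
    | zero => simp [code, ofCode]
    | succ n =>
      have h : n / 5 < n + 1 := Nat.lt_succ_of_le (Nat.div_le_self _ _)
      have i0 := ih _ h
      have i1 := ih _ ((Nat.unpair_left_le (n / 5)).trans_lt h)
      have i2 := ih _ ((Nat.unpair_right_le (n / 5)).trans_lt h)
      have hm := Nat.mod_lt n (show 5 > 0 by omega)
      have hd := Nat.div_add_mod n 5
      rw [ofCode]
      generalize n % 5 = r at *
      interval_cases r <;> simp [code, i0, i1, i2] <;> omega

instance : Denumerable (BWord ℕ) :=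
  Denumerable.mk' ⟨code, ofCode, ofCode_code, code_ofCode⟩

end BWord

/-- The free skew brace on `X`. -/
def FreeBrace (X : Type u) : Type u := Quotient (BWord.setoid X)

namespace FreeBrace

variable {X : Type u}

/-- The element of the free skew brace represented by a `b`-word. -/
def mk (w : BWord X) : FreeBrace X := Quotient.mk _ w

instance : Add (FreeBrace X) := ⟨Quotient.map₂ .add fun _ _ h _ _ h' => .add_congr h h'⟩
instance : Mul (FreeBrace X) := ⟨Quotient.map₂ .mul fun _ _ h _ _ h' => .mul_congr h h'⟩
instance : Neg (FreeBrace X) := ⟨Quotient.map .neg fun _ _ h => .neg_congr h⟩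
instance : Inv (FreeBrace X) := ⟨Quotient.map .inv fun _ _ h => .inv_congr h⟩
instance : Zero (FreeBrace X) := ⟨mk .empty⟩
instance : One (FreeBrace X) := ⟨mk .empty⟩

instance : SkewBrace (FreeBrace X) where
  toAddGroup := AddGroup.ofLeftAxioms
    (by rintro ⟨a⟩ ⟨b⟩ ⟨c⟩; exact Quotient.sound (.add_assoc a b c))
    (by rintro ⟨a⟩; exact Quotient.sound (.zero_add a))
    (by rintro ⟨a⟩; exact Quotient.sound (.neg_add_cancel a))
  toGroup := Group.ofLeftAxioms
    (by rintro ⟨a⟩ ⟨b⟩ ⟨c⟩; exact Quotient.sound (.mul_assoc a b c))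
    (by rintro ⟨a⟩; exact Quotient.sound (.one_mul a))
    (by rintro ⟨a⟩; exact Quotient.sound (.inv_mul_cancel a))
  mul_add_eq := by
    rintro ⟨a⟩ ⟨b⟩ ⟨c⟩
    exact Quotient.sound (.brace a b c)

theorem eval_eq_of_rel {B : Type v} [SkewBrace B] (b : X → B) {w w' : BWord X}
    (h : BWord.Rel w w') : w.eval b = w'.eval b := by
  induction h with
  | refl => rfl
  | symm _ ih => exact ih.symm
  | trans _ _ ih ih' => exact ih.trans ih'
  | add_congr _ _ ih ih' => simp only [BWord.eval, ih, ih']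
  | mul_congr _ _ ih ih' => simp only [BWord.eval, ih, ih']
  | neg_congr _ ih => simp only [BWord.eval, ih]
  | inv_congr _ ih => simp only [BWord.eval, ih]
  | add_assoc => simp only [BWord.eval, _root_.add_assoc]
  | zero_add => simp only [BWord.eval, _root_.zero_add]
  | neg_add_cancel => simp only [BWord.eval, _root_.neg_add_cancel]
  | mul_assoc => simp only [BWord.eval, _root_.mul_assoc]
  | one_mul => simp only [BWord.eval, ← SkewBrace.one_eq_zero, _root_.one_mul]
  | inv_mul_cancel => simp only [BWord.eval, ← SkewBrace.one_eq_zero, _root_.inv_mul_cancel]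
  | brace => simp only [BWord.eval, SkewBrace.mul_add_eq, sub_eq_add_neg]

/-- The homomorphism out of the free skew brace given by a map on the generators. -/
def lift {B : Type v} [SkewBrace B] (b : X → B) : BraceHom (FreeBrace X) B where
  toFun := Quotient.lift (BWord.eval b) fun _ _ h => eval_eq_of_rel b h
  map_add' := by rintro ⟨a⟩ ⟨b⟩; rfl
  map_mul' := by rintro ⟨a⟩ ⟨b⟩; rfl

end FreeBrace

/-- A finite presentation: `n` generators `x_0, ..., x_{n-1}` and finitely many relators, which are
`b`-words in these generators. -/
structure FiniteBracePresentation where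
  n : ℕ
  relators : List (BWord (Fin n))

namespace FiniteBracePresentation

/-- The finite presentation as an input of an algorithm: the number of generators and the list of
relators. -/
def code (P : FiniteBracePresentation) : ℕ × List (BWord ℕ) :=
  (P.n, P.relators.map (BWord.map Fin.val))

/-- `θ` makes `P` a presentation of `B`: `θ` is a surjective homomorphism from the free skew brace
on the generators of `P` onto `B`, and its kernel is the ideal generated by the relators of `P`. -/
def IsPresentation (P : FiniteBracePresentation) {B : Type u} [SkewBrace B]
    (θ : BraceHom (FreeBrace (Fin P.n)) B) : Prop :=
  Function.Surjective θ.toFun ∧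
    {x | θ.toFun x = 0} = (BraceIdeal.span {x | ∃ w ∈ P.relators, x = FreeBrace.mk w}).carrier

end FiniteBracePresentation

/-!
Supersolubility and non-supersolubility are both semidecidable for the braces in question, and
running the two searches in parallel decides.

A supersoluble brace has a finite sequence of elements generating a chain of ideals with cyclic
factors. That a given sequence does so amounts to finitely many equations between `b`-words, and an
equation holds in a finitely presented brace if and only if it has a finite derivation.

An almost polycyclic brace `B` that is not supersoluble has a finite nonzero quotient without ideals
of prime order; such quotients can be enumerated as operation tables satisfying the relators. To
find one, take an ideal `J` maximal among those with `B / J` not supersoluble. If `B / J` were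
infinite, its socle would contain a torsion-free ideal `A ≠ 0`. Proper quotients of `B / J` being
supersoluble, for every prime `p` the action of `B` on `A / pA` has a filtration on whose factors
the operators commute and satisfy `g ^ p = g`. Hence the action on a rationally irreducible part of
`A` is commutative, and the eigenvalues of its operators are algebraic integers `α` with `α ^ p - α`
nilpotent modulo `p` for every prime `p`. Such an `α` is rational: otherwise almost every prime
would split completely in `ℚ(α)`, leading to more ideals of bounded norm than there are. So `A`
contains `w ≠ 0` which every operator maps to `w` or `-w`; since the quotient of `B / J` by `⟨w⟩` is
supersoluble, so is `B / J`, a contradiction.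
-/

/-! ### Algebraic integers fixed by the Frobenius automorphisms -/

section FrobeniusFixed

open NumberField

theorem natCard_eq_of_forall_pow_eq_self {k : Type*} [Field k] {p : ℕ} [Fact p.Prime] [CharP k p]
    (h : ∀ x : k, x ^ p = x) : Nat.card k = p := by
  have htop : (⊥ : Subfield k) = ⊤ :=
    eq_top_iff.2 fun x _ => (Subfield.mem_bot_iff_pow_eq_self k p).2 (h x)
  have hcard := Subfield.card_bot k p
  rw [htop] at hcard
  exact (Nat.card_congr Subfield.topEquiv.toEquiv).symm.trans hcard

variable {K : Type*} [Field K] [NumberField K]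

theorem exists_int_mul_mem_adjoin (a : 𝓞 K) (ha : Algebra.adjoin ℚ {(a : K)} = ⊤) :
    ∃ D : ℤ, D ≠ 0 ∧ ∀ x : 𝓞 K, (D : 𝓞 K) * x ∈ Algebra.adjoin ℤ {a} := by
  let b := PowerBasis.ofAdjoinEqTop (Algebra.IsIntegral.isIntegral (R := ℚ) (a : K)) ha
  have hb : IsIntegral ℤ b.gen := by
    simpa only [b, PowerBasis.ofAdjoinEqTop_gen] using a.isIntegral_coe
  obtain ⟨D, hD⟩ : ∃ D : ℤ, (D : ℚ) = Algebra.discr ℚ b.basis :=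
    IsIntegrallyClosed.isIntegral_iff.1 (Algebra.discr_isIntegral ℚ fun i => by
      rw [b.basis_eq_pow]
      exact hb.pow _)
  refine ⟨D, fun h0 => ?_, fun x => ?_⟩
  · exact Algebra.discr_not_zero_of_basis ℚ b.basis (by rw [← hD, h0, Int.cast_zero])
  · have hmem : (D : K) * x ∈ Algebra.adjoin ℤ {(a : K)} := by
      have h := Algebra.discr_mul_isIntegral_mem_adjoin (K := ℚ) hb x.isIntegral_coe
      rwa [← hD, Algebra.smul_def, PowerBasis.ofAdjoinEqTop_gen, map_intCast] at h
    have hmap : Algebra.adjoin ℤ {(a : K)} =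
        (Algebra.adjoin ℤ {a}).map (IsScalarTower.toAlgHom ℤ (𝓞 K) K) := by
      rw [AlgHom.map_adjoin, Set.image_singleton]
      rfl
    rw [hmap] at hmem
    obtain ⟨y, hy, hyx⟩ := hmem
    have : y = (D : 𝓞 K) * x := RingOfIntegers.coe_injective (by simpa using hyx)
    rwa [← this]

theorem pow_eq_self_of_mem_adjoin_int {k : Type*} [CommRing k] {p : ℕ} [Fact p.Prime] [CharP k p]
    {a x : k} (ha : a ^ p = a) (hx : x ∈ Algebra.adjoin ℤ {a}) : x ^ p = x := by
  induction hx using Algebra.adjoin_induction with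
  | mem x hx => rwa [Set.mem_singleton_iff.1 hx]
  | algebraMap r => exact map_intCast (frobenius k p) r
  | add x y _ _ hx hy => rw [add_pow_char, hx, hy]
  | mul x y _ _ hx hy => rw [mul_pow, hx, hy]

theorem absNorm_eq_of_pow_sub_mem (a : 𝓞 K) {D : ℤ}
    (hD : ∀ x : 𝓞 K, (D : 𝓞 K) * x ∈ Algebra.adjoin ℤ {a}) {p : ℕ} (hp : p.Prime)
    (hpD : ¬ (p : ℤ) ∣ D) (P : Ideal (𝓞 K)) [P.IsMaximal] (hpP : (p : 𝓞 K) ∈ P)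
    (haP : a ^ p - a ∈ P) : Ideal.absNorm P = p := by
  have : Fact p.Prime := ⟨hp⟩
  let : Field (𝓞 K ⧸ P) := Ideal.Quotient.field P
  let π := Ideal.Quotient.mk P
  have hpk : (p : 𝓞 K ⧸ P) = 0 := by
    rw [← map_natCast π]
    exact Ideal.Quotient.eq_zero_iff_mem.2 hpP
  have : CharP (𝓞 K ⧸ P) p := (CharP.charP_iff_prime_eq_zero hp).2 hpk
  have hD0 : π D ≠ 0 := by
    rwa [map_intCast, Ne, CharP.intCast_eq_zero_iff _ p]
  have hπa : π a ^ p = π a := by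
    rw [← map_pow]
    exact Ideal.Quotient.eq.2 haP
  rw [Ideal.absNorm_apply, Submodule.cardQuot_apply]
  refine natCard_eq_of_forall_pow_eq_self fun y => ?_
  obtain ⟨x, rfl⟩ := Ideal.Quotient.mk_surjective y
  have hDx : π (D * x) ∈ Algebra.adjoin ℤ {π a} := by
    have h := Subalgebra.mem_map (f := Ideal.Quotient.mkₐ ℤ P).2 ⟨_, hD x, rfl⟩
    rwa [AlgHom.map_adjoin, Set.image_singleton] at h
  have h := pow_eq_self_of_mem_adjoin_int hπa hDx
  have hDp : π D ^ p = π D := by rw [map_intCast]; exact map_intCast (frobenius _ p) D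
  rw [map_mul, mul_pow, hDp] at h
  exact mul_left_cancel₀ hD0 h

theorem inertiaDeg_eq_one_of_absNorm_eq {p : ℕ} (hp : p.Prime) (P : Ideal (𝓞 K)) [P.IsPrime]
    [P.LiesOver (Ideal.span {(p : ℤ)})] (hP : Ideal.absNorm P = p) : P.inertiaDeg ℤ = 1 := by
  have h := Ideal.natAbs_pow_inertiaDeg (p : ℤ) P
  rw [hP, Int.natAbs_natCast] at h
  exact Nat.pow_right_injective hp.two_le (h.trans (pow_one p).symm)

theorem exists_two_primes_of_forall_absNorm_eq (hd : Module.finrank ℚ K ≠ 1) {p : ℕ}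
    (hp : p.Prime) (hdisc : ¬ (p : ℤ) ∣ discr K)
    (h : ∀ P : Ideal (𝓞 K), P.IsMaximal → (p : 𝓞 K) ∈ P → Ideal.absNorm P = p) :
    ∃ P Q : Ideal (𝓞 K), Prime P ∧ Prime Q ∧ P ≠ Q ∧ Ideal.absNorm P = p ∧
      Ideal.absNorm Q = p := by
  have hpz : Prime (p : ℤ) := Nat.prime_iff_prime_int.mp hp
  have hunram := (not_dvd_discr_iff_isUnramifiedIn K (𝓞 K) hpz).1 hdisc
  have hprime : (Ideal.span {(p : ℤ)}).IsPrime := by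
    rwa [Ideal.span_singleton_prime hpz.ne_zero]
  have hmax : (Ideal.span {(p : ℤ)}).IsMaximal :=
    hprime.isMaximal (by simpa using hp.ne_zero)
  let := Fintype.ofFinite ((Ideal.span {(p : ℤ)}).primesOver (𝓞 K))
  have hnorm (q : (Ideal.span {(p : ℤ)}).primesOver (𝓞 K)) : Ideal.absNorm q.1 = p := by
    obtain ⟨q, _, hover⟩ := q
    refine h q (.of_liesOver_isMaximal q (Ideal.span {(p : ℤ)})) ?_
    have hmem := Ideal.mem_span_singleton_self (p : ℤ)
    rw [hover.over, Ideal.mem_comap] at hmem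
    simpa using hmem
  have hdeg (q : (Ideal.span {(p : ℤ)}).primesOver (𝓞 K)) :
      q.1.ramificationIdx ℤ * q.1.inertiaDeg ℤ = 1 := by
    have := q.2.1
    have := q.2.2
    rw [hunram.ramificationIdx_eq_one (𝔓 := q.1) q.2.2,
      inertiaDeg_eq_one_of_absNorm_eq hp q.1 (hnorm q)]
  have hsum := Ideal.sum_ramification_inertia_eq_finrank (Ideal.span {(p : ℤ)}) (𝓞 K)
  rw [Finset.sum_congr rfl fun q _ => hdeg q, Finset.sum_const, smul_eq_mul, mul_one,
    RingOfIntegers.rank] at hsum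
  have hpos : 0 < Module.finrank ℚ K := Module.finrank_pos
  obtain ⟨P, -, Q, -, hPQ⟩ := Finset.one_lt_card.1 (by omega : 1 < Finset.univ.card)
  have hprime (q : (Ideal.span {(p : ℤ)}).primesOver (𝓞 K)) : Prime q.1 :=
    Ideal.prime_of_isPrime (by rintro h0; simpa [h0, hp.ne_zero.symm] using hnorm q) q.2.1
  exact ⟨P.1, Q.1, hprime P, hprime Q, fun h => hPQ (Subtype.ext h), hnorm P, hnorm Q⟩

/-- The multiset obtained from the prime factors of `m`, with multiplicity, by applying `f`. -/
def primeFactorsMap {α : Type*} (f : ℕ → α) (m : ℕ) : Multiset α :=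
  (m.primeFactorsList : Multiset ℕ).map f

theorem exists_of_mem_primeFactorsMap {α : Type*} {f : ℕ → α} {m : ℕ} {a : α}
    (h : a ∈ primeFactorsMap f m) : ∃ p : ℕ, p.Prime ∧ p ∣ m ∧ f p = a := by
  obtain ⟨p, hp, rfl⟩ := Multiset.mem_map.1 h
  exact ⟨p, Nat.prime_of_mem_primeFactorsList hp, Nat.dvd_of_mem_primeFactorsList hp, rfl⟩

theorem prod_map_primeFactorsMap {α : Type*} {f : ℕ → α} {N : α → ℕ} {m : ℕ} (hm : m ≠ 0)
    (hN : ∀ p : ℕ, p.Prime → p ∣ m → N (f p) = p) :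
    ((primeFactorsMap f m).map N).prod = m := by
  have hid : (m.primeFactorsList : Multiset ℕ).map (N ∘ f) = m.primeFactorsList := by
    conv_rhs => rw [← Multiset.map_id (m.primeFactorsList : Multiset ℕ)]
    exact Multiset.map_congr rfl fun p hp =>
      hN p (Nat.prime_of_mem_primeFactorsList hp) (Nat.dvd_of_mem_primeFactorsList hp)
  rw [primeFactorsMap, Multiset.map_map, hid, Multiset.prod_coe, Nat.prod_primeFactorsList hm]

theorem filter_primeFactorsMap_add {α : Type*} [DecidableEq α] {f g : ℕ → α} {N : α → ℕ}
    {m n : ℕ} (hf : ∀ p : ℕ, p.Prime → p ∣ m → N (f p) = p)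
    (hg : ∀ p : ℕ, p.Prime → p ∣ n → N (g p) = p)
    (hfg : ∀ p : ℕ, p.Prime → p ∣ n → f p ≠ g p) :
    (primeFactorsMap f m + primeFactorsMap g n).filter (fun a => f (N a) = a) =
      primeFactorsMap f m := by
  rw [Multiset.filter_add, Multiset.filter_eq_self.2, Multiset.filter_eq_nil.2, add_zero]
  · intro a ha
    obtain ⟨p, hp, hpn, rfl⟩ := exists_of_mem_primeFactorsMap ha
    rw [hg p hp hpn]
    exact hfg p hp hpn
  · intro a ha
    obtain ⟨p, hp, hpm, rfl⟩ := exists_of_mem_primeFactorsMap ha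
    rw [hf p hp hpm]

section TwoPrimes

variable {M : ℕ} {P Q : ℕ → Ideal (𝓞 K)}

theorem not_dvd_of_coprime {m p : ℕ} (hm : m.Coprime M) (hp : p.Prime) (hpm : p ∣ m) : ¬ p ∣ M :=
  fun hpM => Nat.not_coprime_of_dvd_of_dvd hp.one_lt hpm hpM hm

theorem absNorm_prod_primeFactorsMap_add
    (hP : ∀ p : ℕ, p.Prime → ¬ p ∣ M → Ideal.absNorm (P p) = p)
    (hQ : ∀ p : ℕ, p.Prime → ¬ p ∣ M → Ideal.absNorm (Q p) = p) {m n : ℕ} (hm : m ≠ 0)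
    (hn : n ≠ 0) (hmM : m.Coprime M) (hnM : n.Coprime M) :
    Ideal.absNorm (primeFactorsMap P m + primeFactorsMap Q n).prod = m * n := by
  rw [map_multiset_prod, Multiset.map_add, Multiset.prod_add,
    prod_map_primeFactorsMap hm fun p hp hpm => hP p hp (not_dvd_of_coprime hmM hp hpm),
    prod_map_primeFactorsMap hn fun p hp hpn => hQ p hp (not_dvd_of_coprime hnM hp hpn)]

theorem eq_and_eq_of_primeFactorsMap_add_eq {α : Type*} {f g : ℕ → α} {N : α → ℕ}
    (hf : ∀ p : ℕ, p.Prime → ¬ p ∣ M → N (f p) = p)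
    (hg : ∀ p : ℕ, p.Prime → ¬ p ∣ M → N (g p) = p)
    (hfg : ∀ p : ℕ, p.Prime → ¬ p ∣ M → f p ≠ g p) {m n m' n' : ℕ} (hm : m ≠ 0) (hn : n ≠ 0)
    (hm' : m' ≠ 0) (hn' : n' ≠ 0) (hmM : m.Coprime M) (hnM : n.Coprime M) (hmM' : m'.Coprime M)
    (hnM' : n'.Coprime M)
    (h : primeFactorsMap f m + primeFactorsMap g n = primeFactorsMap f m' + primeFactorsMap g n') :
    m = m' ∧ n = n' := by
  classical
  have hf' {m : ℕ} (hm : m.Coprime M) p (hp : p.Prime) (hpm : p ∣ m) :=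
    hf p hp (not_dvd_of_coprime hm hp hpm)
  have hg' {m : ℕ} (hm : m.Coprime M) p (hp : p.Prime) (hpm : p ∣ m) :=
    hg p hp (not_dvd_of_coprime hm hp hpm)
  have hfilter {m n : ℕ} (hm : m.Coprime M) (hn : n.Coprime M) :=
    filter_primeFactorsMap_add (hf' hm) (hg' hn)
      fun p hp hpn => hfg p hp (not_dvd_of_coprime hn hp hpn)
  have hmm : m = m' := by
    rw [← prod_map_primeFactorsMap hm (hf' hmM), ← hfilter hmM hnM, h, hfilter hmM' hnM',
      prod_map_primeFactorsMap hm' (hf' hmM')]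
  subst hmm
  refine ⟨rfl, ?_⟩
  rw [← prod_map_primeFactorsMap hn (hg' hnM), add_left_cancel h,
    prod_map_primeFactorsMap hn' (hg' hnM')]

theorem injOn_prod_primeFactorsMap_add
    (hP : ∀ p : ℕ, p.Prime → ¬ p ∣ M → Prime (P p) ∧ Ideal.absNorm (P p) = p)
    (hQ : ∀ p : ℕ, p.Prime → ¬ p ∣ M → Prime (Q p) ∧ Ideal.absNorm (Q p) = p)
    (hPQ : ∀ p : ℕ, p.Prime → ¬ p ∣ M → P p ≠ Q p) :
    Set.InjOn (fun t : ℕ × ℕ => (primeFactorsMap P t.1 + primeFactorsMap Q t.2).prod)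
      {t | t.1 ≠ 0 ∧ t.2 ≠ 0 ∧ t.1.Coprime M ∧ t.2.Coprime M} := by
  have hprime {m n : ℕ} (hm : m.Coprime M) (hn : n.Coprime M) :
      ∀ I ∈ primeFactorsMap P m + primeFactorsMap Q n, Prime I := fun I hI => by
    rcases Multiset.mem_add.1 hI with hI | hI <;>
      obtain ⟨p, hp, hpd, rfl⟩ := exists_of_mem_primeFactorsMap hI
    exacts [(hP p hp (not_dvd_of_coprime hm hp hpd)).1, (hQ p hp (not_dvd_of_coprime hn hp hpd)).1]
  rintro ⟨m, n⟩ ⟨hm, hn, hmM, hnM⟩ ⟨m', n'⟩ ⟨hm', hn', hmM', hnM'⟩ h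
  refine Prod.ext_iff.2 (eq_and_eq_of_primeFactorsMap_add_eq (fun p hp h => (hP p hp h).2)
    (fun p hp h => (hQ p hp h).2) hPQ hm hn hm' hn' hmM hnM hmM' hnM' ?_)
  rw [← UniqueFactorizationMonoid.normalizedFactors_prod_of_prime (hprime hmM hnM),
    ← UniqueFactorizationMonoid.normalizedFactors_prod_of_prime (hprime hmM' hnM')]
  exact congrArg _ h

theorem card_le_card_ideals
    (hP : ∀ p : ℕ, p.Prime → ¬ p ∣ M → Prime (P p) ∧ Ideal.absNorm (P p) = p)
    (hQ : ∀ p : ℕ, p.Prime → ¬ p ∣ M → Prime (Q p) ∧ Ideal.absNorm (Q p) = p)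
    (hPQ : ∀ p : ℕ, p.Prime → ¬ p ∣ M → P p ≠ Q p) {x : ℝ} {F : Finset (ℕ × ℕ)}
    (hF : ∀ t ∈ F, t.1 ≠ 0 ∧ t.2 ≠ 0 ∧ t.1.Coprime M ∧ t.2.Coprime M)
    (hx : ∀ t ∈ F, ((t.1 * t.2 : ℕ) : ℝ) ≤ x) :
    F.card ≤ Nat.card {I : Ideal (𝓞 K) // (Ideal.absNorm I : ℝ) ≤ x} := by
  have : Finite {I : Ideal (𝓞 K) // (Ideal.absNorm I : ℝ) ≤ x} :=
    (Ideal.finite_setOfPred_absNorm_le (S := 𝓞 K) ⌊x⌋₊).subset fun _ hI => Nat.le_floor hI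
  have hnorm (t : F) :
      Ideal.absNorm (primeFactorsMap P t.1.1 + primeFactorsMap Q t.1.2).prod = t.1.1 * t.1.2 :=
    have ⟨hm, hn, hmM, hnM⟩ := hF t.1 t.2
    absNorm_prod_primeFactorsMap_add (fun p hp h => (hP p hp h).2) (fun p hp h => (hQ p hp h).2)
      hm hn hmM hnM
  let f (t : F) : {I : Ideal (𝓞 K) // (Ideal.absNorm I : ℝ) ≤ x} :=
    ⟨(primeFactorsMap P t.1.1 + primeFactorsMap Q t.1.2).prod, by
      rw [hnorm]; exact hx t.1 t.2⟩
  have hf : Function.Injective f := fun t u h => Subtype.ext <|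
    injOn_prod_primeFactorsMap_add hP hQ hPQ (hF t.1 t.2) (hF u.1 u.2) (congrArg Subtype.val h)
  simpa using Nat.card_le_card_of_injective f hf

theorem sum_le_card_ideals (hM : M ≠ 0)
    (hP : ∀ p : ℕ, p.Prime → ¬ p ∣ M → Prime (P p) ∧ Ideal.absNorm (P p) = p)
    (hQ : ∀ p : ℕ, p.Prime → ¬ p ∣ M → Prime (Q p) ∧ Ideal.absNorm (Q p) = p)
    (hPQ : ∀ p : ℕ, p.Prime → ¬ p ∣ M → P p ≠ Q p) (L : ℕ) {s : ℝ} (hs : 0 < s) :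
    ∑ i ∈ Finset.range L, (s / ((i * M + 1) * M) - 1) ≤
      Nat.card {I : Ideal (𝓞 K) // (Ideal.absNorm I : ℝ) ≤ s} := by
  let F := (Finset.range L).sigma fun i => Finset.range ⌊s / ((i * M + 1) * M)⌋₊
  let e : (Σ _ : ℕ, ℕ) → ℕ × ℕ := fun t => (t.1 * M + 1, t.2 * M + 1)
  have he : Function.Injective e := by
    rintro ⟨i, j⟩ ⟨i', j'⟩ h
    simpa [e, hM] using h
  have hcoprime (i : ℕ) : (i * M + 1).Coprime M := by simp
  have hbound : ∀ t ∈ F, (((e t).1 * (e t).2 : ℕ) : ℝ) ≤ s := by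
    rintro ⟨i, j⟩ hij
    have hj := (Finset.mem_sigma.1 hij).2
    have hj' : ((j + 1 : ℕ) : ℝ) ≤ s / ((i * M + 1) * M) :=
      (Nat.le_floor_iff (by positivity)).1 (Finset.mem_range.1 hj)
    calc (((i * M + 1) * (j * M + 1) : ℕ) : ℝ) ≤ (((j + 1) * ((i * M + 1) * M) : ℕ) : ℝ) := by
          have hM1 : 1 ≤ M := Nat.one_le_iff_ne_zero.2 hM
          rw [mul_left_comm (j + 1)]
          exact_mod_cast Nat.mul_le_mul_left _ (by nlinarith)
      _ ≤ s := by
          rw [le_div_iff₀ (by positivity)] at hj'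
          exact_mod_cast hj'
  have hcard := card_le_card_ideals hP hQ hPQ (F := F.image e) (x := s)
    (Finset.forall_mem_image.2 fun t _ =>
      ⟨Nat.succ_ne_zero _, Nat.succ_ne_zero _, hcoprime _, hcoprime _⟩)
    (Finset.forall_mem_image.2 hbound)
  rw [Finset.card_image_of_injective _ he, Finset.card_sigma] at hcard
  calc ∑ i ∈ Finset.range L, (s / ((i * M + 1) * M) - 1)
      ≤ ∑ i ∈ Finset.range L, ((Finset.range ⌊s / ((i * M + 1) * M)⌋₊).card : ℝ) :=
        Finset.sum_le_sum fun i _ => by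
          rw [Finset.card_range]
          exact (Nat.sub_one_lt_floor _).le
    _ ≤ _ := by exact_mod_cast hcard

end TwoPrimes

theorem sum_le_of_tendsto_div_atTop {f : ℝ → ℝ} {c : ℝ}
    (hf : Filter.Tendsto (fun s => f s / s) Filter.atTop (nhds c)) {a : ℕ → ℝ} {L : ℕ}
    (h : ∀ s > 0, ∑ i ∈ Finset.range L, (s * a i - 1) ≤ f s) :
    ∑ i ∈ Finset.range L, a i ≤ c := by
  have hlim : Filter.Tendsto (fun s : ℝ => ∑ i ∈ Finset.range L, a i - L / s) Filter.atTop
      (nhds (∑ i ∈ Finset.range L, a i)) := by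
    simpa using ((tendsto_const_nhds (x := (L : ℝ))).div_atTop Filter.tendsto_id).const_sub
      (∑ i ∈ Finset.range L, a i)
  refine le_of_tendsto_of_tendsto hlim hf ?_
  filter_upwards [Filter.eventually_gt_atTop 0] with s hs
  have hs' := h s hs
  rw [Finset.sum_sub_distrib, ← Finset.mul_sum, Finset.sum_const, Finset.card_range,
    nsmul_one] at hs'
  rwa [le_div_iff₀ hs, sub_mul, div_mul_cancel₀ _ hs.ne', mul_comm]

theorem not_summable_inv_mul_add_one {M : ℕ} (hM : M ≠ 0) :
    ¬ Summable fun i : ℕ => ((i * M + 1) * M : ℝ)⁻¹ := by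
  intro h
  refine mt (summable_nat_add_iff 1).1 Real.not_summable_one_div_natCast ?_
  refine (h.mul_left (M * M : ℝ)).of_nonneg_of_le (fun i => by positivity) fun i => ?_
  have hM1 : (1 : ℝ) ≤ M := by exact_mod_cast Nat.one_le_iff_ne_zero.2 hM
  have hM0 : (0 : ℝ) < M := by positivity
  rw [← div_eq_mul_inv, div_le_div_iff₀ (by positivity) (by positivity)]
  push_cast
  nlinarith [mul_nonneg hM0.le (sub_nonneg.2 hM1)]

variable (K) in
/-- Two primes of norm `p` would give about `∑ s / m`, over `m` coprime to `M`, ideals of norm at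
most `s`, whereas the number of these ideals is linear in `s`. -/
theorem not_forall_exists_two_primes {M : ℕ} (hM : M ≠ 0) :
    ¬ ∀ p : ℕ, p.Prime → ¬ p ∣ M → ∃ P Q : Ideal (𝓞 K), Prime P ∧ Prime Q ∧ P ≠ Q ∧
      Ideal.absNorm P = p ∧ Ideal.absNorm Q = p := by
  intro h
  choose! P Q hP hQ hPQ hPn hQn using h
  refine not_summable_inv_mul_add_one hM (summable_of_sum_range_le (fun i => by positivity)
    fun L => sum_le_of_tendsto_div_atTop (Ideal.tendsto_norm_le_div_atTop K) fun s hs => ?_)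
  simp only [← div_eq_mul_inv]
  exact sum_le_card_ideals hM (fun p hp hpM => ⟨hP p hp hpM, hPn p hp hpM⟩)
    (fun p hp hpM => ⟨hQ p hp hpM, hQn p hp hpM⟩) hPQ L hs

theorem finrank_eq_one_of_pow_sub_mem (a : 𝓞 K) (ha : Algebra.adjoin ℚ {(a : K)} = ⊤)
    (h : ∀ p : ℕ, p.Prime → ∀ P : Ideal (𝓞 K), P.IsMaximal → (p : 𝓞 K) ∈ P → a ^ p - a ∈ P) :
    Module.finrank ℚ K = 1 := by
  by_contra hd
  obtain ⟨D, hD0, hD⟩ := exists_int_mul_mem_adjoin a ha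
  have hM : (D * discr K).natAbs ≠ 0 :=
    Int.natAbs_ne_zero.2 (mul_ne_zero hD0 (discr_ne_zero K))
  refine not_forall_exists_two_primes K hM fun p hp hpM => ?_
  rw [← Int.natCast_dvd] at hpM
  exact exists_two_primes_of_forall_absNorm_eq hd hp (fun hdvd => hpM (hdvd.mul_left D))
    fun P hP hpP => absNorm_eq_of_pow_sub_mem a hD hp (fun hdvd => hpM (hdvd.mul_right _)) P hpP
      (h p hp P hP hpP)

theorem exists_int_eq_of_isIntegral_pow_sub_div {L : Type*} [Field L] [CharZero L] {α : L}
    (hα : IsIntegral ℤ α)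
    (h : ∀ p : ℕ, p.Prime → ∃ k : ℕ, IsIntegral ℤ ((α ^ p - α) ^ k / p)) :
    ∃ m : ℤ, α = m := by
  have hαQ : IsIntegral ℚ α := hα.tower_top
  let K := IntermediateField.adjoin ℚ {α}
  have : FiniteDimensional ℚ K := IntermediateField.adjoin.finiteDimensional hαQ
  have : NumberField K := ⟨⟩
  have hinj : Function.Injective (algebraMap K L) := (algebraMap K L).injective
  let g : K := IntermediateField.AdjoinSimple.gen ℚ α
  let a : 𝓞 K := ⟨g, (isIntegral_algebraMap_iff hinj).1 hα⟩
  have hgen : Algebra.adjoin ℚ {(a : K)} = ⊤ :=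
    (IntermediateField.adjoin.powerBasis hαQ).adjoin_gen_eq_top
  have hone : Module.finrank ℚ K = 1 := by
    refine finrank_eq_one_of_pow_sub_mem a hgen fun p hp P hPm hpP => ?_
    obtain ⟨k, hk⟩ := h p hp
    have hk' : IsIntegral ℤ ((g ^ p - g) ^ k / p) :=
      (isIntegral_algebraMap_iff hinj).1 (by simpa [g] using hk)
    let b : 𝓞 K := ⟨_, hk'⟩
    have hb : (a ^ p - a) ^ k = p * b := by
      have hp0 : (p : K) ≠ 0 := by exact_mod_cast hp.ne_zero
      exact RingOfIntegers.coe_injective (mul_div_cancel₀ _ hp0).symm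
    exact hPm.isPrime.mem_of_pow_mem k (hb ▸ P.mul_mem_right _ hpP)
  obtain ⟨q, rfl⟩ := IntermediateField.mem_bot.1
    (IntermediateField.finrank_adjoin_simple_eq_one_iff.1 hone)
  obtain ⟨m, rfl⟩ := IsIntegrallyClosed.isIntegral_iff.1
    ((isIntegral_algebraMap_iff (algebraMap ℚ L).injective).1 hα)
  exact ⟨m, by simp⟩

end FrobeniusFixed

/-! ### Integral representations with Frobenius-fixed filtrations -/

section Eigenvalue

open Module TensorProduct

theorem isIntegral_of_baseChangeHom_apply_eq_smul {R K M : Type*} [CommRing R] [Field K]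
    [Algebra R K] [AddCommGroup M] [Module R M] [Module.Finite R M] {f : End R M} {μ : K}
    {v : K ⊗[R] M} (hv : v ≠ 0) (h : End.baseChangeHom R K M f v = μ • v) : IsIntegral R μ := by
  obtain ⟨q, hq, hqf⟩ := Algebra.IsIntegral.isIntegral (R := R) f
  have hqf' : Polynomial.aeval f q = 0 := hqf
  refine ⟨q, hq, (smul_eq_zero.1 ?_).resolve_right hv⟩
  rw [← Polynomial.eval_map, ← End.aeval_apply_of_mem_apply_eq_smul h,
    Polynomial.aeval_map_algebraMap, Polynomial.aeval_algHom_apply, hqf', map_zero,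
    LinearMap.zero_apply]

theorem hasEigenvalue_of_baseChangeHom {R A M : Type*} [CommRing R] [CommRing A]
    [Algebra R A] [Module.Flat R A] [AddCommGroup M] [Module R M] {f : End R M} {μ : R}
    (h : (End.baseChangeHom R A M f).HasEigenvalue (algebraMap R A μ)) : f.HasEigenvalue μ := by
  rw [End.hasEigenvalue_iff, End.eigenspace_def, Ne, LinearMap.ker_eq_bot] at h ⊢
  contrapose! h
  have hmap : End.baseChangeHom R A M f - algebraMap R A μ • 1 =
      End.baseChangeHom R A M (f - μ • 1) := by
    rw [map_sub, map_smul, map_one, algebraMap_smul]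
  rw [hmap]
  exact Module.Flat.lTensor_preserves_injective_linearMap _ h

theorem exists_eq_smul_of_forall_exists {R M N : Type*} [CommRing R] [AddCommGroup M]
    [Module R M] [Module.Projective R M] [AddCommGroup N] [Module R N] {a : R} {g : M →ₗ[R] N}
    (h : ∀ x, ∃ y, g x = a • y) : ∃ u : M →ₗ[R] N, g = a • u := by
  obtain ⟨u, hu⟩ := Module.projective_lifting_property (LinearMap.lsmul R N a).rangeRestrict
    (g.codRestrict _ fun x => (h x).imp fun _ hy => hy.symm) (LinearMap.surjective_rangeRestrict _)
  exact ⟨u, LinearMap.ext fun x => congrArg Subtype.val (LinearMap.congr_fun hu x).symm⟩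

theorem isUnit_of_forall_exists_eq_smul {R M : Type*} [CommRing R] [AddCommGroup M] [Module R M]
    [Module.Free R M] [Nontrivial M] {a : R} (h : ∀ x : M, ∃ y, x = a • y) : IsUnit a := by
  have := Module.nontrivial R M
  let b := Module.Free.chooseBasis R M
  obtain ⟨i⟩ := b.index_nonempty
  obtain ⟨y, hy⟩ := h (b i)
  have hone : a * b.repr y i = 1 := by
    simpa using (congrArg (fun x => b.repr x i) hy).symm
  exact IsUnit.of_mul_eq_one _ hone

theorem isUnit_of_hasEigenvalue {R M : Type*} [CommRing R] [IsDomain R] [IsPrincipalIdealRing R]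
    [AddCommGroup M] [Module R M] [Module.Finite R M] [Module.IsTorsionFree R M] {f : End R M}
    (hf : IsUnit f) {a : R} (ha : f.HasEigenvalue a) : IsUnit a := by
  obtain ⟨f, rfl⟩ := hf
  have := Submodule.nontrivial_iff_ne_bot.2 (End.hasEigenvalue_iff.1 ha)
  refine isUnit_of_forall_exists_eq_smul (M := f.1.eigenspace a) fun ⟨x, hx⟩ => ?_
  have hinv : f.1 (f⁻¹.1 x) = x := by rw [← End.mul_apply, f.mul_inv, End.one_apply]
  have hsmul : x = a • f⁻¹.1 x := by
    rw [← map_smul, ← End.mem_eigenspace_iff.1 hx, ← End.mul_apply, f.inv_mul, End.one_apply]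
  exact ⟨⟨f⁻¹.1 x, End.mem_eigenspace_iff.2 (hinv.trans hsmul)⟩, Subtype.ext hsmul⟩

theorem exists_int_hasEigenvalue {M : Type*} [AddCommGroup M] [Module.Free ℤ M]
    [Module.Finite ℤ M] [Nontrivial M] {f : End ℤ M}
    (h : ∀ p : ℕ, p.Prime → ∃ (k : ℕ) (u : End ℤ M), (f ^ p - f) ^ k = (p : ℤ) • u) :
    ∃ a : ℤ, f.HasEigenvalue a := by
  let Φ := End.baseChangeHom ℤ ℂ M
  obtain ⟨α, hα⟩ := End.exists_eigenvalue (Φ f)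
  obtain ⟨v, hv⟩ := hα.exists_hasEigenvector
  obtain ⟨a, rfl⟩ : ∃ a : ℤ, α = a := by
    refine exists_int_eq_of_isIntegral_pow_sub_div
      (isIntegral_of_baseChangeHom_apply_eq_smul hv.2 hv.apply_eq_smul) fun p hp => ?_
    obtain ⟨k, u, hu⟩ := h p hp
    refine ⟨k, isIntegral_of_baseChangeHom_apply_eq_smul hv.2 (f := u) ?_⟩
    have hp0 : (p : ℂ) ≠ 0 := by exact_mod_cast hp.ne_zero
    have hpu : (p : ℂ) • Φ u v = (α ^ p - α) ^ k • v := by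
      have haeval := End.aeval_apply_of_hasEigenvector (p := (.X ^ p - .X) ^ k) hv
      simp only [map_pow, map_sub, Polynomial.aeval_X, Polynomial.eval_pow, Polynomial.eval_sub,
        Polynomial.eval_X] at haeval
      rw [← haeval, ← map_pow, ← map_sub, ← map_pow, hu, map_smul, LinearMap.smul_apply,
        natCast_zsmul, Nat.cast_smul_eq_nsmul]
    rw [div_eq_inv_mul, mul_smul, ← hpu, inv_smul_smul₀ hp0]
  exact ⟨a, hasEigenvalue_of_baseChangeHom (A := ℂ) (by simpa using hα)⟩

end Eigenvalue

section IntegralRepresentation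

open Module
open scoped Pointwise

theorem exists_ne_zero_forall_smul_eq_zero {M : Type*} [AddCommGroup M] [Module.Finite ℤ M]
    (h : Module.IsTorsion ℤ M) : ∃ k : ℤ, k ≠ 0 ∧ ∀ x : M, k • x = 0 := by
  obtain ⟨k, hk, hk0⟩ := Submodule.annihilator_top_inter_nonZeroDivisors h
  exact ⟨k, nonZeroDivisors.ne_zero hk0, fun x => Submodule.mem_annihilator.1 hk x trivial⟩

variable {M G : Type*} [AddCommGroup M]

theorem mem_comap_mkQ_torsion {U : Submodule ℤ M} {x : M} :
    x ∈ (Submodule.torsion ℤ (M ⧸ U)).comap U.mkQ ↔ ∃ k : ℤ, k ≠ 0 ∧ k • x ∈ U := by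
  have hsmul : ∀ k : ℤ, k • U.mkQ x = 0 ↔ k • x ∈ U := fun k => by
    rw [← map_smul, Submodule.mkQ_apply, Submodule.Quotient.mk_eq_zero]
  simp only [← hsmul, Submodule.mem_comap, Submodule.mem_torsion_iff, Submonoid.smul_def,
    Subtype.exists, mem_nonZeroDivisors_iff_ne_zero, exists_prop]

section Monoid

variable [Monoid G] {ρ : Representation ℤ G M}

/-- The subrepresentation of all elements with a nonzero integer multiple in `W`. -/
def saturation (W : Subrepresentation ρ) : Subrepresentation ρ where
  toSubmodule := (Submodule.torsion ℤ (M ⧸ W.toSubmodule)).comap W.toSubmodule.mkQ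
  apply_mem_toSubmodule g x hx := by
    obtain ⟨k, hk, hkx⟩ := mem_comap_mkQ_torsion.1 hx
    exact mem_comap_mkQ_torsion.2 ⟨k, hk, map_smul (ρ g) k x ▸ W.apply_mem_toSubmodule g hkx⟩

theorem mem_saturation {W : Subrepresentation ρ} {x : M} :
    x ∈ saturation W ↔ ∃ k : ℤ, k ≠ 0 ∧ k • x ∈ W :=
  mem_comap_mkQ_torsion

theorem le_saturation (W : Subrepresentation ρ) : W ≤ saturation W :=
  fun x hx => mem_saturation.2 ⟨1, one_ne_zero, by rwa [one_smul]⟩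

theorem saturation_mono {W W' : Subrepresentation ρ} (h : W ≤ W') :
    saturation W ≤ saturation W' := fun _ hx =>
  let ⟨k, hk, hkx⟩ := mem_saturation.1 hx
  mem_saturation.2 ⟨k, hk, h hkx⟩

theorem saturation_saturation (W : Subrepresentation ρ) :
    saturation (saturation W) = saturation W := by
  refine le_antisymm (fun x hx => ?_) (le_saturation _)
  obtain ⟨k, hk, hkx⟩ := mem_saturation.1 hx
  obtain ⟨l, hl, hlx⟩ := mem_saturation.1 hkx
  exact mem_saturation.2 ⟨l * k, mul_ne_zero hl hk, by rwa [mul_smul]⟩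

theorem le_saturation_of_finrank_le [Module.Finite ℤ M] {W W' : Subrepresentation ρ} (hle : W ≤ W')
    (h : finrank ℤ W'.toSubmodule ≤ finrank ℤ W.toSubmodule) : W' ≤ saturation W := by
  intro x hx
  let U := W.toSubmodule.comap W'.toSubmodule.subtype
  have hU : finrank ℤ U = finrank ℤ W.toSubmodule :=
    (Submodule.comapSubtypeEquivOfLe hle).finrank_eq
  have hquot : finrank ℤ (W'.toSubmodule ⧸ U) = 0 := by
    have := Submodule.finrank_quotient_add_finrank U
    lia
  obtain ⟨k, hk, hkx⟩ := finrank_eq_zero_iff.1 hquot (U.mkQ ⟨x, hx⟩)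
  rw [← map_smul, Submodule.mkQ_apply, Submodule.Quotient.mk_eq_zero] at hkx
  exact mem_saturation.2 ⟨k, hk, hkx⟩

theorem exists_ne_zero_forall_smul_mem [Module.Finite ℤ M] {W : Subrepresentation ρ}
    (h : saturation W = ⊤) : ∃ k : ℤ, k ≠ 0 ∧ ∀ x, k • x ∈ W := by
  have htors : Module.IsTorsion ℤ (M ⧸ W.toSubmodule) := fun y => by
    obtain ⟨x, rfl⟩ := W.toSubmodule.mkQ_surjective y
    exact (h ▸ trivial : x ∈ saturation W)
  obtain ⟨k, hk, hkW⟩ := exists_ne_zero_forall_smul_eq_zero htors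
  refine ⟨k, hk, fun x => (Submodule.Quotient.mk_eq_zero W.toSubmodule).1 ?_⟩
  exact hkW (W.toSubmodule.mkQ x)

/-- An integral representation whose rationalization has no proper nonzero subrepresentation. -/
def IsRationallyIrreducible (ρ : Representation ℤ G M) : Prop :=
  ∀ W : Subrepresentation ρ, W ≠ ⊥ → saturation W = ⊤

theorem exists_isRationallyIrreducible [Module.Finite ℤ M] [Nontrivial M]
    (ρ : Representation ℤ G M) : ∃ W : Subrepresentation ρ, W ≠ ⊥ ∧ saturation W = W ∧
      IsRationallyIrreducible W.toRepresentation := by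
  have htop : (⊤ : Subrepresentation ρ) ∈ {W | W ≠ ⊥ ∧ saturation W = W} :=
    ⟨fun h => top_ne_bot (congrArg Subrepresentation.toSubmodule h),
      le_antisymm le_top (le_saturation _)⟩
  obtain ⟨W, ⟨hne, hsat⟩, hmin⟩ := exists_minimalFor_of_wellFoundedLT
    (· ∈ {W : Subrepresentation ρ | W ≠ ⊥ ∧ saturation W = W})
    (fun W => finrank ℤ W.toSubmodule) ⟨_, htop⟩
  refine ⟨W, hne, hsat, fun U hU => ?_⟩
  let U' : Subrepresentation ρ :=
    { toSubmodule := U.toSubmodule.map W.toSubmodule.subtype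
      apply_mem_toSubmodule := by
        rintro g _ ⟨x, hx, rfl⟩
        exact ⟨_, U.apply_mem_toSubmodule g hx, rfl⟩ }
  have hU'W : saturation U' ≤ W := by
    rw [← hsat]
    refine saturation_mono ?_
    rintro _ ⟨x, -, rfl⟩
    exact x.2
  have hU' : U' ≠ ⊥ := fun h => hU <| Subrepresentation.toSubmodule_injective <|
    Submodule.map_injective_of_injective W.toSubmodule.subtype_injective <|
      (congrArg Subrepresentation.toSubmodule h).trans (Submodule.map_bot _).symm
  have hWU' : W ≤ saturation U' := by
    rw [← saturation_saturation]
    exact le_saturation_of_finrank_le hU'W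
      (hmin ⟨ne_bot_of_le_ne_bot hU' (le_saturation _), saturation_saturation _⟩
        (Submodule.finrank_mono hU'W))
  refine eq_top_iff.2 fun x _ => ?_
  obtain ⟨k, hk, y, hy, hyx⟩ := mem_saturation.1 (hWU' x.2)
  exact mem_saturation.2 ⟨k, hk, (Subtype.ext hyx : y = k • x) ▸ hy⟩

/-- There is a chain of submodules from `U` to `⊤` on whose factors `G` acts through commuting
operators `g` with `g ^ p = g`. -/
inductive HasFrobeniusFiltration (ρ : Representation ℤ G M) (p : ℕ) : Submodule ℤ M → Prop
  | top : HasFrobeniusFiltration ρ p ⊤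
  | step {U V : Submodule ℤ M} (hle : U ≤ V)
      (hcomm : ∀ x ∈ V, ∀ g g', ρ g (ρ g' x) - ρ g' (ρ g x) ∈ U)
      (hpow : ∀ x ∈ V, ∀ g, (ρ g ^ p) x - ρ g x ∈ U)
      (hV : HasFrobeniusFiltration ρ p V) : HasFrobeniusFiltration ρ p U

namespace HasFrobeniusFiltration

variable {p : ℕ} {U : Submodule ℤ M}

theorem toRepresentation (h : HasFrobeniusFiltration ρ p U) (W : Subrepresentation ρ) :
    HasFrobeniusFiltration W.toRepresentation p (U.comap W.toSubmodule.subtype) := by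
  induction h with
  | top => exact .top
  | step hle hcomm hpow _ ih =>
    refine .step (Submodule.comap_mono hle) (fun x hx g g' => hcomm x hx g g')
      (fun x hx g => ?_) ih
    rw [← map_pow]
    have := hpow x hx g
    rw [← map_pow] at this
    exact this

theorem exists_pow_sub_pow_apply_mem (h : HasFrobeniusFiltration ρ p U) (g : G) :
    ∃ k : ℕ, ∀ x, ((ρ g ^ p - ρ g) ^ k) x ∈ U := by
  induction h with
  | top => exact ⟨0, fun _ => trivial⟩
  | step _ _ hpow _ ih =>
    obtain ⟨k, hk⟩ := ih
    exact ⟨k + 1, fun x => by rw [pow_succ']; exact hpow _ (hk x) g⟩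

end HasFrobeniusFiltration

end Monoid

section Group

variable [Group G] {ρ : Representation ℤ G M}

variable (ρ) in
/-- The subrepresentation generated by all `g g' x - g' g x`; it vanishes exactly when `G` acts
through commuting operators. -/
def commutatorSubrepresentation : Subrepresentation ρ where
  toSubmodule := Submodule.span ℤ {y | ∃ g g' x, y = ρ g (ρ g' x) - ρ g' (ρ g x)}
  apply_mem_toSubmodule g y hy := by
    induction hy using Submodule.span_induction with
    | mem y hy =>
      obtain ⟨a, b, x, rfl⟩ := hy
      refine Submodule.subset_span ⟨g * a * g⁻¹, g * b * g⁻¹, ρ g x, ?_⟩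
      have hconj : ∀ a b : G, g * a * g⁻¹ * (g * b * g⁻¹ * g) = g * (a * b) := by
        intros; group
      simp only [map_sub, ← Module.End.mul_apply, ← map_mul, hconj]
    | zero => simp only [map_zero, Submodule.zero_mem]
    | add x y _ _ hx hy => exact map_add (ρ g) x y ▸ Submodule.add_mem _ hx hy
    | smul c x _ hx => exact map_smul (ρ g) c x ▸ Submodule.smul_mem _ c hx

theorem sub_mem_commutatorSubrepresentation (g g' : G) (x : M) :
    ρ g (ρ g' x) - ρ g' (ρ g x) ∈ commutatorSubrepresentation ρ :=
  Submodule.subset_span ⟨g, g', x, rfl⟩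

theorem HasFrobeniusFiltration.eq_top {p : ℕ} {U : Submodule ℤ M}
    (h : HasFrobeniusFiltration ρ p U) (hpU : ∀ x : M, (p : ℤ) • x ∈ U) {N : ℤ}
    (hpN : IsCoprime N p) (hN : ∀ x, N • x ∈ commutatorSubrepresentation ρ) : U = ⊤ := by
  induction h with
  | top => rfl
  | step hle hcomm _ _ ih =>
    obtain rfl := ih fun x => hle (hpU x)
    have hcommU : (commutatorSubrepresentation ρ).toSubmodule ≤ _ := Submodule.span_le.2 <| by
      rintro _ ⟨g, g', x, rfl⟩
      exact hcomm x trivial g g'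
    obtain ⟨a, b, hab⟩ := hpN
    refine eq_top_iff.2 fun x _ => ?_
    have hx : x = a • N • x + b • (p : ℤ) • x := by
      rw [smul_smul, smul_smul, ← add_smul, hab, one_smul]
    rw [hx]
    exact add_mem (Submodule.smul_mem _ a (hcommU (hN x))) (Submodule.smul_mem _ b (hpU x))

theorem exists_prime_isCoprime {N : ℤ} (hN : N ≠ 0) : ∃ p : ℕ, p.Prime ∧ IsCoprime N p := by
  obtain ⟨p, hpN, hp⟩ := Nat.exists_infinite_primes (N.natAbs + 1)
  refine ⟨p, hp, Int.isCoprime_iff_gcd_eq_one.2 ?_⟩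
  exact Nat.coprime_comm.1 ((Nat.Prime.coprime_iff_not_dvd hp).2 fun hd =>
    (Nat.le_of_dvd (Int.natAbs_pos.2 hN) hd).not_gt hpN)

variable [Module.Finite ℤ M] [Module.IsTorsionFree ℤ M] [Nontrivial M]

theorem IsRationallyIrreducible.apply_apply_comm (hρ : IsRationallyIrreducible ρ)
    (h : ∀ p : ℕ, p.Prime → HasFrobeniusFiltration ρ p ((p : ℤ) • ⊤)) (g g' : G) (x : M) :
    ρ g (ρ g' x) = ρ g' (ρ g x) := by
  suffices hC : commutatorSubrepresentation ρ = ⊥ from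
    sub_eq_zero.1 (hC ▸ sub_mem_commutatorSubrepresentation g g' x :
      ρ g (ρ g' x) - ρ g' (ρ g x) ∈ (⊥ : Subrepresentation ρ))
  by_contra hC
  obtain ⟨N, hN0, hN⟩ := exists_ne_zero_forall_smul_mem (hρ _ hC)
  obtain ⟨p, hp, hpN⟩ := exists_prime_isCoprime hN0
  have htop := (h p hp).eq_top (fun x => Submodule.smul_mem_pointwise_smul _ _ _ trivial) hpN hN
  have hunit : IsUnit (p : ℤ) := isUnit_of_forall_exists_eq_smul (M := M) fun x => by
    obtain ⟨y, -, hy⟩ := (Submodule.mem_smul_pointwise_iff_exists x (p : ℤ) ⊤).1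
      (htop.symm ▸ Submodule.mem_top)
    exact ⟨y, hy.symm⟩
  exact (Nat.prime_iff_prime_int.1 hp).not_isUnit hunit

theorem HasFrobeniusFiltration.exists_eigenvalue
    (h : ∀ p : ℕ, p.Prime → HasFrobeniusFiltration ρ p ((p : ℤ) • ⊤)) (g : G) :
    ∃ a : ℤ, IsUnit a ∧ End.HasEigenvalue (ρ g) a := by
  obtain ⟨a, ha⟩ := exists_int_hasEigenvalue (f := ρ g) fun p hp => by
    obtain ⟨k, hk⟩ := (h p hp).exists_pow_sub_pow_apply_mem g
    refine ⟨k, exists_eq_smul_of_forall_exists fun x => ?_⟩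
    obtain ⟨y, -, hy⟩ := (Submodule.mem_smul_pointwise_iff_exists _ _ _).1 (hk x)
    exact ⟨y, hy.symm⟩
  exact ⟨a, isUnit_of_hasEigenvalue ((Group.isUnit g).map ρ) ha, ha⟩

theorem IsRationallyIrreducible.apply_eq_or_eq_neg (hρ : IsRationallyIrreducible ρ)
    (h : ∀ p : ℕ, p.Prime → HasFrobeniusFiltration ρ p ((p : ℤ) • ⊤)) (g : G) (x : M) :
    ρ g x = x ∨ ρ g x = -x := by
  obtain ⟨a, ha, hga⟩ := HasFrobeniusFiltration.exists_eigenvalue h g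
  let E : Subrepresentation ρ :=
    { toSubmodule := End.eigenspace (ρ g) a
      apply_mem_toSubmodule := fun g' y hy => by
        rw [End.mem_eigenspace_iff] at hy ⊢
        rw [hρ.apply_apply_comm h, hy, map_smul] }
  have hE : saturation E = ⊤ := hρ E fun h => hga (congrArg Subrepresentation.toSubmodule h)
  obtain ⟨k, hk, hkx⟩ := mem_saturation.1 (hE ▸ trivial : x ∈ saturation E)
  have hgx : ρ g x = a • x := by
    refine smul_right_injective M hk ?_
    change k • ρ g x = k • a • x
    rw [← map_smul, smul_comm k a]
    exact End.mem_eigenspace_iff.1 hkx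
  rcases Int.isUnit_iff.1 ha with rfl | rfl
  · exact .inl (by simpa using hgx)
  · exact .inr (by simpa using hgx)

theorem exists_common_eigenvector (ρ : Representation ℤ G M)
    (h : ∀ p : ℕ, p.Prime → HasFrobeniusFiltration ρ p ((p : ℤ) • ⊤)) :
    ∃ v : M, v ≠ 0 ∧ ∀ g, ρ g v = v ∨ ρ g v = -v := by
  obtain ⟨W, hW, hsat, hirr⟩ := exists_isRationallyIrreducible ρ
  have : Nontrivial W.toSubmodule := Submodule.nontrivial_iff_ne_bot.2 fun h =>
    hW (Subrepresentation.toSubmodule_injective h)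
  obtain ⟨v, hv⟩ := exists_ne (0 : W.toSubmodule)
  refine ⟨v, fun h => hv (Subtype.ext h), fun g => ?_⟩
  have hWp : ∀ p : ℕ, p.Prime →
      HasFrobeniusFiltration W.toRepresentation p ((p : ℤ) • ⊤) := fun p hp => by
    have hcomap : ((p : ℤ) • ⊤ : Submodule ℤ M).comap W.toSubmodule.subtype = (p : ℤ) • ⊤ := by
      ext x
      simp only [Submodule.mem_comap, Submodule.mem_smul_pointwise_iff_exists, Submodule.mem_top,
        true_and, Submodule.subtype_apply]
      refine ⟨fun ⟨y, hy⟩ => ⟨⟨y, ?_⟩, Subtype.ext hy⟩, fun ⟨y, hy⟩ => ⟨y, congrArg Subtype.val hy⟩⟩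
      have hp0 : (p : ℤ) ≠ 0 := by exact_mod_cast hp.ne_zero
      exact hsat ▸ mem_saturation.2 ⟨p, hp0, hy ▸ x.2⟩
    exact hcomap ▸ (h p hp).toRepresentation W
  exact (hirr.apply_eq_or_eq_neg hWp g v).imp (congrArg Subtype.val) (congrArg Subtype.val)

end Group

end IntegralRepresentation

/-! ### Skew braces, their homomorphisms and ideals -/

namespace SkewBrace

variable {B : Type u} [SkewBrace B]

theorem lam_add (a b c : B) : lam a (b + c) = lam a b + lam a c := by
  simp only [lam, mul_add_eq, sub_eq_add_neg, add_assoc]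

theorem lam_zero_right (a : B) : lam a 0 = 0 := by simp [lam, mul_zero']

theorem lam_zero_left (b : B) : lam 0 b = b := by rw [← one_eq_zero, lam_one]

/-- The additive endomorphism `λ_a`. -/
def lamHom (a : B) : B →+ B where
  toFun := lam a
  map_zero' := lam_zero_right a
  map_add' := lam_add a

theorem lam_neg (a b : B) : lam a (-b) = -lam a b := (lamHom a).map_neg b

theorem lam_zsmul (a : B) (k : ℤ) (b : B) : lam a (k • b) = k • lam a b := (lamHom a).map_zsmul k b

theorem lam_nsmul (a : B) (k : ℕ) (b : B) : lam a (k • b) = k • lam a b := (lamHom a).map_nsmul k b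

theorem lam_inv_lam (a b : B) : lam a⁻¹ (lam a b) = b := by
  rw [← lam_mul, inv_mul_cancel, lam_one]

theorem lam_lam_inv (a b : B) : lam a (lam a⁻¹ b) = b := by
  rw [← lam_mul, mul_inv_cancel, lam_one]

theorem inv_eq_neg_lam (a : B) : a⁻¹ = -lam a⁻¹ a := by
  have h : a⁻¹ + lam a⁻¹ a = 0 := by rw [← mul_eq, inv_mul_cancel, one_eq_zero]
  exact eq_neg_of_add_eq_zero_left h

theorem lam_inv_self (a : B) : lam a a⁻¹ = -a := by
  rw [inv_eq_neg_lam, lam_neg, lam_lam_inv]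

theorem mul_mul_inv_eq (b a : B) :
    b * a * b⁻¹ = b + lam b a - b + lam b (-b⁻¹ + lam a b⁻¹) := by
  rw [lam_add, lam_neg, lam_inv_self, mul_assoc, mul_eq b, mul_eq a, lam_add, ← lam_mul]
  simp [sub_eq_add_neg, add_assoc]

theorem mul_eq_add_of_mem_socle {a : B} (ha : a ∈ socle B) (b : B) : a * b = a + b := by
  rw [mul_eq, ha.1]

theorem lam_eq_conj_of_mem_socle {a : B} (ha : a ∈ socle B) (b : B) : lam b a = b * a * b⁻¹ := by
  rw [mul_assoc, mul_eq_add_of_mem_socle ha, ha.2, mul_add_eq, mul_inv_cancel, one_eq_zero,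
    zero_sub, lam]

theorem zero_mem_socle : (0 : B) ∈ socle B := ⟨lam_zero_left, fun b => by rw [zero_add, add_zero]⟩

theorem add_mem_socle {a b : B} (ha : a ∈ socle B) (hb : b ∈ socle B) : a + b ∈ socle B := by
  refine ⟨fun c => ?_, fun c => ?_⟩
  · rw [← mul_eq_add_of_mem_socle ha, lam_mul, hb.1, ha.1]
  · rw [add_assoc, hb.2, ← add_assoc, ha.2, add_assoc]

theorem neg_mem_socle {a : B} (ha : a ∈ socle B) : -a ∈ socle B := by
  have hlam : ∀ c, lam a⁻¹ c = c := fun c => by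
    nth_rw 1 [← ha.1 c]
    exact lam_inv_lam a c
  have hneg : -a = a⁻¹ := by rw [inv_eq_neg_lam, hlam]
  refine ⟨fun c => ?_, fun c => ?_⟩
  · rw [hneg, hlam]
  · rw [neg_add_eq_iff_eq_add, ← add_assoc, ha.2, add_neg_cancel_right]

theorem lam_mem_socle (b : B) {a : B} (ha : a ∈ socle B) : lam b a ∈ socle B := by
  refine ⟨fun c => ?_, fun c => ?_⟩
  · rw [lam_eq_conj_of_mem_socle ha, lam_mul, lam_mul, ha.1, lam_lam_inv]
  · have h := congrArg (lam b) (ha.2 (lam b⁻¹ c))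
    rwa [lam_add, lam_add, lam_lam_inv] at h

end SkewBrace

namespace BraceHom

open SkewBrace

variable {A : Type u} {B : Type v} [SkewBrace A] [SkewBrace B] (f : BraceHom A B)

/-- The underlying additive homomorphism. -/
def toAdd : A →+ B := AddMonoidHom.mk' f.toFun f.map_add'

theorem map_zero : f.toFun 0 = 0 := f.toAdd.map_zero

theorem map_one : f.toFun 1 = 1 := by rw [one_eq_zero, one_eq_zero, f.map_zero]

/-- The underlying multiplicative homomorphism. -/
def toMul : A →* B := MonoidHom.mk' f.toFun f.map_mul'

theorem map_neg (a : A) : f.toFun (-a) = -f.toFun a := f.toAdd.map_neg a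

theorem map_sub (a b : A) : f.toFun (a - b) = f.toFun a - f.toFun b := f.toAdd.map_sub a b

theorem map_zsmul (k : ℤ) (a : A) : f.toFun (k • a) = k • f.toFun a := f.toAdd.map_zsmul k a

theorem map_nsmul (k : ℕ) (a : A) : f.toFun (k • a) = k • f.toFun a := f.toAdd.map_nsmul k a

theorem map_inv (a : A) : f.toFun a⁻¹ = (f.toFun a)⁻¹ := f.toMul.map_inv a

theorem map_lam (a b : A) : f.toFun (lam a b) = lam (f.toFun a) (f.toFun b) := by
  simp only [lam, f.map_add', f.map_neg, f.map_mul']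

theorem map_eval {X : Type*} (b : X → A) (w : BWord X) :
    f.toFun (w.eval b) = w.eval (fun x => f.toFun (b x)) := by
  induction w with
  | empty => exact f.map_zero
  | of x => rfl
  | add w₁ w₂ h₁ h₂ => simp only [BWord.eval, f.map_add', h₁, h₂]
  | mul w₁ w₂ h₁ h₂ => simp only [BWord.eval, f.map_mul', h₁, h₂]
  | neg w h => simp only [BWord.eval, f.map_neg, h]
  | inv w h => simp only [BWord.eval, f.map_inv, h]

end BraceHom

namespace BraceIdeal

open SkewBrace

variable {A : Type v} [SkewBrace A] {B : Type u} [SkewBrace B]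

instance : LE (BraceIdeal B) := ⟨fun I J => ∀ ⦃x⦄, x ∈ I → x ∈ J⟩

theorem mem_carrier {I : BraceIdeal B} {x : B} : x ∈ I.carrier ↔ x ∈ I := Iff.rfl

@[ext]
theorem ext {I J : BraceIdeal B} (h : ∀ x, x ∈ I ↔ x ∈ J) : I = J := by
  have h' : I.toAddSubgroup = J.toAddSubgroup := AddSubgroup.ext h
  cases I
  cases J
  simp only at h'
  subst h'
  rfl

theorem le_antisymm {I J : BraceIdeal B} (h : I ≤ J) (h' : J ≤ I) : I = J :=
  ext fun _ => ⟨@h _, @h' _⟩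

theorem zero_mem (I : BraceIdeal B) : (0 : B) ∈ I := I.toAddSubgroup.zero_mem

theorem add_mem (I : BraceIdeal B) {x y : B} (hx : x ∈ I) (hy : y ∈ I) : x + y ∈ I :=
  I.toAddSubgroup.add_mem hx hy

theorem neg_mem (I : BraceIdeal B) {x : B} (hx : x ∈ I) : -x ∈ I := I.toAddSubgroup.neg_mem hx

theorem nsmul_mem (I : BraceIdeal B) {x : B} (hx : x ∈ I) (k : ℕ) : k • x ∈ I :=
  I.toAddSubgroup.nsmul_mem hx k

theorem zsmul_mem (I : BraceIdeal B) {x : B} (hx : x ∈ I) (k : ℤ) : k • x ∈ I :=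
  I.toAddSubgroup.zsmul_mem hx k

/-- An additive subgroup which is normal, `λ`-invariant, and whose elements act trivially modulo
it, as an ideal. -/
def ofAdd (T : AddSubgroup B) (hlam : ∀ b, ∀ t ∈ T, lam b t ∈ T)
    (hconj : ∀ b, ∀ t ∈ T, b + t - b ∈ T) (hstar : ∀ b, ∀ t ∈ T, -b + lam t b ∈ T) :
    BraceIdeal B where
  toAddSubgroup := T
  one_mem' := by rw [one_eq_zero]; exact T.zero_mem
  mul_mem' {a b} ha hb := by rw [mul_eq]; exact T.add_mem ha (hlam a b hb)
  inv_mem' {a} ha := by rw [inv_eq_neg_lam]; exact T.neg_mem (hlam _ _ ha)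
  lam_mem' b a ha := hlam b a ha
  add_conj_mem' b a ha := hconj b a ha
  mul_conj_mem' b a ha := by
    rw [mul_mul_inv_eq]
    exact T.add_mem (hconj _ _ (hlam _ _ ha)) (hlam _ _ (hstar _ _ ha))

/-- A `λ`-invariant additive subgroup of the socle, as an ideal. -/
def ofSocle (T : AddSubgroup B) (hT : ∀ t ∈ T, t ∈ SkewBrace.socle B)
    (hlam : ∀ b, ∀ t ∈ T, lam b t ∈ T) : BraceIdeal B :=
  ofAdd T hlam (fun b t ht => by rw [← (hT t ht).2, add_sub_cancel_right]; exact ht)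
    (fun b t ht => by rw [(hT t ht).1, neg_add_cancel]; exact T.zero_mem)

/-- The zero ideal. -/
def zero (B : Type u) [SkewBrace B] : BraceIdeal B :=
  ofSocle ⊥ (by rintro _ rfl; exact zero_mem_socle)
    (by rintro b _ rfl; exact AddSubgroup.mem_bot.2 (lam_zero_right b))

theorem mem_zero {x : B} : x ∈ zero B ↔ x = 0 := Iff.rfl

/-- The socle, as an ideal. -/
def socle (B : Type u) [SkewBrace B] : BraceIdeal B :=
  ofSocle
    { carrier := SkewBrace.socle B
      zero_mem' := zero_mem_socle
      add_mem' := add_mem_socle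
      neg_mem' := neg_mem_socle }
    (fun _ ha => ha) (fun b _ ha => lam_mem_socle b ha)

/-- The multiples of a socle element which spans a `λ`-invariant subgroup, as an ideal. -/
def zmultiples {c : B} (hc : c ∈ SkewBrace.socle B)
    (hlam : ∀ b, lam b c ∈ AddSubgroup.zmultiples c) : BraceIdeal B :=
  ofSocle (AddSubgroup.zmultiples c)
    (by rintro _ ⟨k, rfl⟩; exact (socle B).zsmul_mem hc k)
    (by
      rintro b _ ⟨k, rfl⟩
      rw [lam_zsmul]
      exact AddSubgroup.zsmul_mem _ (hlam b) k)

/-- The preimage of an ideal. -/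
def comap (f : BraceHom A B) (K : BraceIdeal B) : BraceIdeal A where
  toAddSubgroup := K.toAddSubgroup.comap f.toAdd
  one_mem' := by
    change f.toFun 1 ∈ K.carrier
    rw [f.map_one]; exact K.one_mem'
  mul_mem' {a b} ha hb := by
    change f.toFun _ ∈ K.carrier
    rw [f.map_mul']; exact K.mul_mem' ha hb
  inv_mem' {a} ha := by
    change f.toFun _ ∈ K.carrier
    rw [f.map_inv]; exact K.inv_mem' ha
  lam_mem' b a ha := by
    change f.toFun _ ∈ K.carrier
    rw [f.map_lam]; exact K.lam_mem' _ ha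
  add_conj_mem' b a ha := by
    change f.toFun _ ∈ K.carrier
    rw [f.map_sub, f.map_add']; exact K.add_conj_mem' _ ha
  mul_conj_mem' b a ha := by
    change f.toFun _ ∈ K.carrier
    rw [f.map_mul', f.map_mul', f.map_inv]; exact K.mul_conj_mem' _ ha

/-- The image of an ideal under a surjective homomorphism. -/
def map (f : BraceHom A B) (hf : Function.Surjective f.toFun) (K : BraceIdeal A) :
    BraceIdeal B where
  toAddSubgroup := K.toAddSubgroup.map f.toAdd
  one_mem' := ⟨1, K.one_mem', f.map_one⟩
  mul_mem' := by
    rintro _ _ ⟨a, ha, rfl⟩ ⟨b, hb, rfl⟩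
    exact ⟨a * b, K.mul_mem' ha hb, f.map_mul' a b⟩
  inv_mem' := by
    rintro _ ⟨a, ha, rfl⟩
    exact ⟨a⁻¹, K.inv_mem' ha, f.map_inv a⟩
  lam_mem' := by
    rintro b _ ⟨a, ha, rfl⟩
    obtain ⟨b, rfl⟩ := hf b
    exact ⟨lam b a, K.lam_mem' b ha, f.map_lam b a⟩
  add_conj_mem' := by
    rintro b _ ⟨a, ha, rfl⟩
    obtain ⟨b, rfl⟩ := hf b
    exact ⟨b + a - b, K.add_conj_mem' b ha, by
      change f.toFun _ = f.toFun _ + f.toFun _ - f.toFun _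
      rw [f.map_sub, f.map_add']⟩
  mul_conj_mem' := by
    rintro b _ ⟨a, ha, rfl⟩
    obtain ⟨b, rfl⟩ := hf b
    exact ⟨b * a * b⁻¹, K.mul_conj_mem' b ha, by
      change f.toFun _ = f.toFun _ * f.toFun _ * (f.toFun _)⁻¹
      rw [f.map_mul', f.map_mul', f.map_inv]⟩

/-- The projection onto the quotient brace. -/
def projHom (I : BraceIdeal B) : BraceHom B I.Quot where
  toFun := I.proj
  map_add' := I.proj.map_add
  map_mul' := I.proj_mul

theorem proj_lam (I : BraceIdeal B) (a b : B) : I.proj (lam a b) = lam (I.proj a) (I.proj b) :=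
  I.projHom.map_lam a b

theorem proj_eq_zero (I : BraceIdeal B) {x : B} : I.proj x = 0 ↔ x ∈ I := by
  rw [eq_comm, ← map_zero I.proj, proj_eq, neg_zero, zero_add]
  rfl

theorem proj_mem_socle_iff (I : BraceIdeal B) {x : B} :
    I.proj x ∈ SkewBrace.socle I.Quot ↔ ∀ b, -b + lam x b ∈ I ∧ x + b - x - b ∈ I := by
  have key : ∀ b, (-b + lam x b ∈ I ↔ lam (I.proj x) (I.proj b) = I.proj b) ∧
      (x + b - x - b ∈ I ↔ I.proj x + I.proj b = I.proj b + I.proj x) := fun b => by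
    constructor
    · rw [← proj_eq_zero, map_add, map_neg, proj_lam, neg_add_eq_zero, eq_comm]
    · rw [← proj_eq_zero, map_sub, map_sub, map_add, sub_eq_zero, sub_eq_iff_eq_add]
  simp only [fun b => (key b).1, fun b => (key b).2]
  rw [forall_and]
  exact and_congr I.proj_surjective.forall I.proj_surjective.forall

theorem star_mem (I : BraceIdeal B) {t : B} (ht : t ∈ I) (b : B) : -b + lam t b ∈ I := by
  rw [← proj_eq_zero, map_add, map_neg, proj_lam, I.proj_eq_zero.2 ht, lam_zero_left,
    neg_add_cancel]

theorem mem_factor {J J' : BraceIdeal B} {x : J.Quot} :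
    x ∈ J.factor J' ↔ ∃ y ∈ J', J.proj y = x := Iff.rfl

theorem le_comap_projHom (J : BraceIdeal B) (K : BraceIdeal J.Quot) : J ≤ comap J.projHom K :=
  fun _ hx => show J.proj _ ∈ K from (J.proj_eq_zero.2 hx).symm ▸ K.zero_mem

/-- The kernel of a homomorphism. -/
def ker (f : BraceHom A B) : BraceIdeal A := comap f (zero B)

theorem mem_ker {f : BraceHom A B} {x : A} : x ∈ ker f ↔ f.toFun x = 0 := Iff.rfl

theorem span_le {S : Set B} {I : BraceIdeal B} (h : ∀ x ∈ S, x ∈ I) : span S ≤ I :=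
  fun _ hx => hx I h

theorem subset_span {S : Set B} {x : B} (hx : x ∈ S) : x ∈ span S := fun _ h => h hx

end BraceIdeal

/-! ### Supersolubility of quotients -/

namespace BraceIdeal

open SkewBrace Relation

variable {B : Type u} [SkewBrace B]

theorem proj_eq_proj_of_le {J J' : BraceIdeal B} (hle : J ≤ J') {x y : B}
    (h : J.proj x = J.proj y) : J'.proj x = J'.proj y :=
  J'.proj_eq.2 (hle (J.proj_eq.1 h))

theorem mem_of_proj_eq_of_le {J J' : BraceIdeal B} (hle : J ≤ J') {x y : B} (hy : y ∈ J')
    (h : J.proj x = J.proj y) : x ∈ J' := by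
  rw [← proj_eq_zero, proj_eq_proj_of_le hle h, proj_eq_zero]
  exact hy

/-- A factor `J' / J` which is cyclic, and either lies in the socle of `B / J` or has order
dividing a prime. Unlike the factors in the definition of supersolubility, these survive the
passage to quotients of `B`. -/
def CyclicStep (J J' : BraceIdeal B) : Prop :=
  J ≤ J' ∧ ∃ c ∈ J', (∀ x ∈ J', ∃ k : ℤ, J.proj x = k • J.proj c) ∧
    (J.proj c ∈ SkewBrace.socle J.Quot ∨ ∃ p : ℕ, p.Prime ∧ p • J.proj c = 0)

/-- Supersolubility of the quotient `B / J`, expressed by ideals of `B`. -/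
inductive QuotSupersoluble : BraceIdeal B → Prop
  | top {J} (h : ∀ x, x ∈ J) : QuotSupersoluble J
  | step {J J'} (h : CyclicStep J J') (h' : QuotSupersoluble J') : QuotSupersoluble J

/-- The condition on consecutive ideals in the definition of supersolubility. -/
def SupersolubleStep (J J' : BraceIdeal B) : Prop :=
  J.carrier ⊆ J'.carrier ∧
    ((IsAddCyclic (J.factor J') ∧ Infinite (J.factor J') ∧
      (J.factor J' : Set J.Quot) ⊆ SkewBrace.socle J.Quot) ∨ (Nat.card (J.factor J')).Prime)

theorem SupersolubleStep.cyclicStep {J J' : BraceIdeal B} (h : SupersolubleStep J J') :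
    CyclicStep J J' := by
  obtain ⟨hle, h⟩ := h
  have hcyc : IsAddCyclic (J.factor J') := by
    rcases h with h | h
    · exact h.1
    · have : Fact (Nat.card (J.factor J')).Prime := ⟨h⟩
      exact isAddCyclic_of_prime_card rfl
  obtain ⟨⟨g, hg⟩, hgen⟩ := hcyc.exists_generator
  obtain ⟨c, hc, rfl⟩ := mem_factor.1 hg
  refine ⟨hle, c, hc, fun x hx => ?_, ?_⟩
  · obtain ⟨k, hk⟩ := AddSubgroup.mem_zmultiples_iff.1 (hgen ⟨J.proj x, mem_factor.2 ⟨x, hx, rfl⟩⟩)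
    exact ⟨k, (congrArg Subtype.val hk).symm⟩
  · rcases h with h | h
    · exact Or.inl (h.2.2 hg)
    · refine Or.inr ⟨_, h, ?_⟩
      exact congrArg Subtype.val (card_nsmul_eq_zero' (x := (⟨J.proj c, hg⟩ : J.factor J')))

section Refinement

variable {J J' : BraceIdeal B} {c : B}

theorem factor_eq_zmultiples (hc : c ∈ J') (hgen : ∀ x ∈ J', ∃ k : ℤ, J.proj x = k • J.proj c) :
    J.factor J' = AddSubgroup.zmultiples (J.proj c) := by
  ext x
  rw [mem_factor, AddSubgroup.mem_zmultiples_iff]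
  constructor
  · rintro ⟨y, hy, rfl⟩
    obtain ⟨k, hk⟩ := hgen y hy
    exact ⟨k, hk.symm⟩
  · rintro ⟨k, rfl⟩
    exact ⟨k • c, J'.zsmul_mem hc k, map_zsmul _ _ _⟩

theorem eq_or_supersolubleStep_of_prime (hle : J ≤ J') (hc : c ∈ J')
    (hgen : ∀ x ∈ J', ∃ k : ℤ, J.proj x = k • J.proj c) {p : ℕ} (hp : p.Prime)
    (h : p • J.proj c = 0) : J = J' ∨ SupersolubleStep J J' := by
  rcases (Nat.dvd_prime hp).1 (addOrderOf_dvd_of_nsmul_eq_zero h) with hone | hprime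
  · rw [AddMonoid.addOrderOf_eq_one_iff] at hone
    refine Or.inl (le_antisymm hle fun x hx => ?_)
    obtain ⟨k, hk⟩ := hgen x hx
    rw [← J.proj_eq_zero, hk, hone, smul_zero]
  · refine Or.inr ⟨hle, Or.inr ?_⟩
    rwa [factor_eq_zmultiples hc hgen, Nat.card_zmultiples, hprime]

/-- The ideal `ℤ d c + J`, for an element `c` which modulo `J` lies in the socle and spans a
`λ`-invariant subgroup. -/
def multiplesModulo (hsoc : J.proj c ∈ SkewBrace.socle J.Quot)
    (hlam : ∀ b, lam b (J.proj c) ∈ AddSubgroup.zmultiples (J.proj c)) (d : ℕ) : BraceIdeal B :=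
  comap J.projHom (zmultiples (c := d • J.proj c) ((socle J.Quot).nsmul_mem hsoc d) fun b => by
    obtain ⟨k, hk⟩ := AddSubgroup.mem_zmultiples_iff.1 (hlam b)
    rw [lam_nsmul, ← hk, ← natCast_zsmul, ← natCast_zsmul, zsmul_comm]
    exact AddSubgroup.zsmul_mem_zmultiples _ k)

section MultiplesModulo

variable {hsoc : J.proj c ∈ SkewBrace.socle J.Quot}
  {hlam : ∀ b, lam b (J.proj c) ∈ AddSubgroup.zmultiples (J.proj c)}

theorem mem_multiplesModulo {d : ℕ} {x : B} :
    x ∈ multiplesModulo hsoc hlam d ↔ ∃ k : ℤ, J.proj x = J.proj (k • d • c) := by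
  simp only [map_zsmul, map_nsmul, eq_comm (a := J.proj x)]
  exact AddSubgroup.mem_zmultiples_iff

theorem nsmul_mem_multiplesModulo (d : ℕ) : d • c ∈ multiplesModulo hsoc hlam d :=
  mem_multiplesModulo.2 ⟨1, by rw [one_smul]⟩

theorem multiplesModulo_eq_or_supersolubleStep {p : ℕ} (hp : p.Prime) (d : ℕ) :
    multiplesModulo hsoc hlam (p * d) = multiplesModulo hsoc hlam d ∨
      SupersolubleStep (multiplesModulo hsoc hlam (p * d)) (multiplesModulo hsoc hlam d) := by
  refine eq_or_supersolubleStep_of_prime (c := d • c) (fun x hx => ?_)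
    (nsmul_mem_multiplesModulo d) (fun x hx => ?_) hp ?_
  · obtain ⟨k, hk⟩ := mem_multiplesModulo.1 hx
    refine mem_multiplesModulo.2 ⟨k * p, hk.trans ?_⟩
    rw [mul_nsmul', ← natCast_zsmul (d • c) p, smul_smul]
  · obtain ⟨k, hk⟩ := mem_multiplesModulo.1 hx
    exact ⟨k, (proj_eq_proj_of_le (le_comap_projHom J _) hk).trans (map_zsmul _ _ _)⟩
  · rw [← map_nsmul, ← mul_nsmul', proj_eq_zero]
    exact nsmul_mem_multiplesModulo _

theorem multiplesModulo_reflTransGen (m : ℕ) (hm : m ≠ 0) :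
    ReflTransGen SupersolubleStep (multiplesModulo hsoc hlam m) (multiplesModulo hsoc hlam 1) := by
  induction m using induction_on_primes with
  | zero => exact absurd rfl hm
  | one => exact .refl
  | prime_mul p d hp ih =>
    rcases multiplesModulo_eq_or_supersolubleStep (hsoc := hsoc) (hlam := hlam) hp d with h | h
    · rw [h]
      exact ih (right_ne_zero_of_mul hm)
    · exact (ih (right_ne_zero_of_mul hm)).head h

end MultiplesModulo

theorem reflTransGen_of_isOfFinAddOrder (hle : J ≤ J') (hc : c ∈ J')
    (hgen : ∀ x ∈ J', ∃ k : ℤ, J.proj x = k • J.proj c)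
    (hsoc : J.proj c ∈ SkewBrace.socle J.Quot) (hfin : IsOfFinAddOrder (J.proj c)) :
    ReflTransGen SupersolubleStep J J' := by
  obtain ⟨m, hm, hmc⟩ := isOfFinAddOrder_iff_nsmul_eq_zero.1 hfin
  have hlam : ∀ b, lam b (J.proj c) ∈ AddSubgroup.zmultiples (J.proj c) := by
    intro b
    obtain ⟨b, rfl⟩ := J.proj_surjective b
    obtain ⟨k, hk⟩ := hgen _ (J'.lam_mem' b hc)
    rw [← proj_lam, hk]
    exact AddSubgroup.zsmul_mem_zmultiples _ _
  have hbot : multiplesModulo hsoc hlam m = J := by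
    ext x
    simp only [mem_multiplesModulo, map_zsmul, map_nsmul, hmc, smul_zero, exists_const,
      proj_eq_zero]
  have htop : multiplesModulo hsoc hlam 1 = J' := by
    ext x
    rw [mem_multiplesModulo, one_nsmul]
    constructor
    · rintro ⟨k, hk⟩
      exact mem_of_proj_eq_of_le hle (J'.zsmul_mem hc k) hk
    · intro hx
      obtain ⟨k, hk⟩ := hgen x hx
      exact ⟨k, hk.trans (map_zsmul _ _ _).symm⟩
  simpa only [hbot, htop] using
    multiplesModulo_reflTransGen (hsoc := hsoc) (hlam := hlam) m hm.ne'

theorem CyclicStep.reflTransGen (h : CyclicStep J J') : ReflTransGen SupersolubleStep J J' := by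
  obtain ⟨hle, c, hc, hgen, hsoc | ⟨p, hp, hpc⟩⟩ := h
  · by_cases hfin : IsOfFinAddOrder (J.proj c)
    · exact reflTransGen_of_isOfFinAddOrder hle hc hgen hsoc hfin
    · refine ReflTransGen.single ⟨hle, Or.inl ?_⟩
      rw [factor_eq_zmultiples hc hgen]
      refine ⟨inferInstance, (infinite_zmultiples.2 hfin).to_subtype, ?_⟩
      rintro _ ⟨k, rfl⟩
      exact (socle J.Quot).zsmul_mem hsoc k
  · rcases eq_or_supersolubleStep_of_prime hle hc hgen hp hpc with h | h
    · rw [h]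
    · exact ReflTransGen.single h

end Refinement

theorem exists_chain_of_reflTransGen {α : Type*} {r : α → α → Prop} {a b : α}
    (h : ReflTransGen r a b) :
    ∃ (n : ℕ) (I : ℕ → α), I 0 = a ∧ I n = b ∧ ∀ i < n, r (I i) (I (i + 1)) := by
  induction h using ReflTransGen.head_induction_on with
  | refl => exact ⟨0, fun _ => b, rfl, rfl, fun i hi => absurd hi (Nat.not_lt_zero i)⟩
  | @head x y h _ ih =>
    obtain ⟨n, I, rfl, hn, hI⟩ := ih
    refine ⟨n + 1, fun i => Nat.casesOn i x I, rfl, hn, fun i hi => ?_⟩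
    cases i with
    | zero => exact h
    | succ i => exact hI i (Nat.lt_of_succ_lt_succ hi)

theorem QuotSupersoluble.reflTransGen {J : BraceIdeal B} (h : QuotSupersoluble J) :
    ∃ J', (∀ x, x ∈ J') ∧ ReflTransGen SupersolubleStep J J' := by
  induction h with
  | @top J h => exact ⟨J, h, .refl⟩
  | step h _ ih =>
    obtain ⟨K, hK, hr⟩ := ih
    exact ⟨K, hK, h.reflTransGen.trans hr⟩

theorem quotSupersoluble_of_chain {n : ℕ} {I : ℕ → BraceIdeal B} (hn : ∀ x, x ∈ I n)
    (h : ∀ i < n, SupersolubleStep (I i) (I (i + 1))) : QuotSupersoluble (I 0) := by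
  induction n generalizing I with
  | zero => exact .top hn
  | succ n ih =>
    exact .step (h 0 n.succ_pos).cyclicStep
      (ih (I := fun i => I (i + 1)) hn fun i hi => h (i + 1) (Nat.succ_lt_succ hi))

variable (B) in
theorem isSupersoluble_iff_quotSupersoluble_zero :
    IsSupersoluble B ↔ QuotSupersoluble (zero B) := by
  constructor
  · rintro ⟨n, I, h0, hn, h⟩
    have hzero : I 0 = zero B := ext fun x => by rw [← mem_carrier, h0]; rfl
    exact hzero ▸ quotSupersoluble_of_chain (fun x => Set.eq_univ_iff_forall.1 hn x) h
  · intro h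
    obtain ⟨J, hJ, hr⟩ := h.reflTransGen
    obtain ⟨n, I, h0, hn, hI⟩ := exists_chain_of_reflTransGen hr
    exact ⟨n, I, by rw [h0]; rfl, by rw [hn]; exact Set.eq_univ_of_forall hJ, hI⟩

end BraceIdeal

/-! ### Almost polycyclic braces -/

section FinitelyGenerated

variable {G Q : Type*} [AddGroup G] [AddGroup Q]

theorem addSubgroup_fg_map {H : AddSubgroup G} (hH : H.FG) (f : G →+ Q) : (H.map f).FG := by
  classical
  obtain ⟨S, rfl⟩ := hH
  exact ⟨S.image f, by rw [Finset.coe_image, AddMonoidHom.map_closure]⟩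

theorem addSubgroup_fg_of_finite {H : AddSubgroup G} (hH : (H : Set G).Finite) : H.FG :=
  ⟨hH.toFinset, by rw [Set.Finite.coe_toFinset, AddSubgroup.closure_eq]⟩

theorem addSubgroup_fg_of_fg_map_of_fg_inf_ker (f : G →+ Q) {H : AddSubgroup G}
    (hmap : (H.map f).FG) (hker : (H ⊓ f.ker).FG) : H.FG := by
  classical
  obtain ⟨T, hT⟩ := hmap
  obtain ⟨S, hSH, hS⟩ := Finset.subset_set_image_iff.1
    (show (T : Set Q) ⊆ f '' H from fun t ht => hT.le (AddSubgroup.subset_closure ht))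
  have hPH : AddSubgroup.closure (S : Set G) ≤ H := (AddSubgroup.closure_le H).2 hSH
  have hPmap : (AddSubgroup.closure (S : Set G)).map f = H.map f := by
    rw [AddMonoidHom.map_closure, ← Finset.coe_image, hS, hT]
  suffices H = AddSubgroup.closure (S : Set G) ⊔ (H ⊓ f.ker) by
    rw [this]
    exact AddSubgroup.FG.sup ⟨S, rfl⟩ hker
  refine le_antisymm (fun x hx => ?_) (sup_le hPH inf_le_left)
  obtain ⟨y, hy, hyx⟩ : f x ∈ (AddSubgroup.closure (S : Set G)).map f :=
    hPmap ▸ AddSubgroup.mem_map_of_mem f hx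
  have hker : -y + x ∈ f.ker := by rw [AddMonoidHom.mem_ker, map_add, map_neg, hyx, neg_add_cancel]
  simpa only [add_neg_cancel_left] using
    add_mem (AddSubgroup.mem_sup_left hy) (AddSubgroup.mem_sup_right (T := H ⊓ f.ker)
      (AddSubgroup.mem_inf.2 ⟨add_mem (neg_mem (hPH hy)) hx, hker⟩))

/-- The commutative group structure on a subgroup with commuting elements. -/
abbrev addCommGroupOfComm (F : AddSubgroup Q) (hcomm : ∀ x ∈ F, ∀ y ∈ F, x + y = y + x) :
    AddCommGroup F :=
  { (inferInstance : AddGroup F) with add_comm := fun x y => Subtype.ext (hcomm x x.2 y y.2) }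

theorem moduleFinite_int_of_fg {F : AddSubgroup Q} (hF : F.FG)
    (hcomm : ∀ x ∈ F, ∀ y ∈ F, x + y = y + x) :
    let := addCommGroupOfComm F hcomm
    Module.Finite ℤ F := by
  intro
  rw [Module.Finite.iff_addGroup_fg]
  exact (AddGroup.fg_iff_addSubgroup_fg F).2 hF

theorem addSubgroup_fg_of_le_of_comm {F H : AddSubgroup Q} (hF : F.FG)
    (hcomm : ∀ x ∈ F, ∀ y ∈ F, x + y = y + x) (hH : H ≤ F) : H.FG := by
  let := addCommGroupOfComm F hcomm
  have : Module.Finite ℤ F := moduleFinite_int_of_fg hF hcomm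
  have hfg : (AddSubgroup.toIntSubmodule (H.addSubgroupOf F)).FG := IsNoetherian.noetherian _
  rw [Submodule.fg_iff_addSubgroup_fg] at hfg
  have hmap := addSubgroup_fg_map hfg F.subtype
  rwa [AddSubgroup.toIntSubmodule_toAddSubgroup, AddSubgroup.addSubgroupOf_map_subtype,
    inf_eq_left.2 hH] at hmap

theorem wellFoundedGT_addSubgroup_of_forall_fg (h : ∀ H : AddSubgroup G, H.FG) :
    WellFoundedGT (AddSubgroup G) := by
  rw [wellFoundedGT_iff_monotone_chain_condition]
  intro a
  obtain ⟨S, hS⟩ := h (⨆ n, a n)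
  have hmem : ∀ x ∈ S, ∃ n, x ∈ a n := fun x hx =>
    (AddSubgroup.mem_iSup_of_directed a.monotone.directed_le).1
      (hS.le (AddSubgroup.subset_closure hx))
  choose! f hf using hmem
  refine ⟨S.sup f, fun m hm => le_antisymm (a.monotone hm) ((le_iSup a m).trans ?_)⟩
  rw [← hS, AddSubgroup.closure_le]
  exact fun x hx => a.monotone (Finset.le_sup hx) (hf x hx)

theorem finite_addSubgroup_of_torsion {F : AddSubgroup Q} (hF : F.FG)
    (hcomm : ∀ x ∈ F, ∀ y ∈ F, x + y = y + x) (htors : ∀ x ∈ F, IsOfFinAddOrder x) :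
    Finite F := by
  let := addCommGroupOfComm F hcomm
  have : Module.Finite ℤ F := moduleFinite_int_of_fg hF hcomm
  refine Module.finite_of_fg_torsion F ?_
  rintro ⟨x, hx⟩
  obtain ⟨k, hk, hkx⟩ := isOfFinAddOrder_iff_nsmul_eq_zero.1 (htors x hx)
  refine ⟨⟨(k : ℤ), mem_nonZeroDivisors_of_ne_zero (Int.natCast_ne_zero.2 hk.ne')⟩,
    Subtype.ext ?_⟩
  exact (natCast_zsmul x k).trans hkx

end FinitelyGenerated

section AlmostPolycyclic

open SkewBrace BraceIdeal

variable {B : Type u} [SkewBrace B] {D : Type v} [SkewBrace D]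

theorem BraceIdeal.finite_factor_iff {N X : BraceIdeal B} :
    Finite (N.factor X) ↔ ∃ s : Set B, s.Finite ∧ ∀ x ∈ X, ∃ y ∈ s, -y + x ∈ N := by
  constructor
  · intro hfin
    let g := Function.surjInv N.proj_surjective
    exact ⟨g '' (N.factor X : Set N.Quot), (Set.toFinite _).image g, fun x hx =>
      ⟨g (N.proj x), ⟨_, ⟨x, hx, rfl⟩, rfl⟩, N.proj_eq.1 (Function.surjInv_eq _ _)⟩⟩
  · rintro ⟨s, hs, h⟩
    refine ((hs.image N.proj).subset ?_).to_subtype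
    rintro _ ⟨x, hx, rfl⟩
    obtain ⟨y, hy, hyx⟩ := h x hx
    exact ⟨y, hy, N.proj_eq.2 hyx⟩

theorem BraceIdeal.finite_of_finite_factor {N X : BraceIdeal B} (hN : N.carrier.Finite)
    (h : Finite (N.factor X)) : X.carrier.Finite := by
  obtain ⟨s, hs, hsX⟩ := finite_factor_iff.1 h
  refine ((hs.prod hN).image fun t => t.1 + t.2).subset fun x hx => ?_
  obtain ⟨y, hy, hyx⟩ := hsX x hx
  exact ⟨(y, -y + x), ⟨hy, hyx⟩, add_neg_cancel_left y x⟩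

theorem BraceIdeal.finite_factor_map {N X : BraceIdeal B} (h : Finite (N.factor X))
    (f : BraceHom B D) (hf : Function.Surjective f.toFun) :
    Finite ((N.map f hf).factor (X.map f hf)) := by
  obtain ⟨s, hs, hsX⟩ := finite_factor_iff.1 h
  refine finite_factor_iff.2 ⟨f.toFun '' s, hs.image _, ?_⟩
  rintro _ ⟨x, hx, rfl⟩
  obtain ⟨y, hy, hyx⟩ := hsX x hx
  refine ⟨_, ⟨y, hy, rfl⟩, -y + x, hyx, ?_⟩
  exact (f.map_add' _ _).trans (congrArg (· + f.toFun x) (f.map_neg y))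

theorem BraceIdeal.factor_map_subset_socle {N X : BraceIdeal B}
    (h : (N.factor X : Set N.Quot) ⊆ SkewBrace.socle N.Quot)
    (f : BraceHom B D) (hf : Function.Surjective f.toFun) :
    ((N.map f hf).factor (X.map f hf) : Set (N.map f hf).Quot) ⊆ SkewBrace.socle _ := by
  rintro _ ⟨_, ⟨x, hx, rfl⟩, rfl⟩
  refine (proj_mem_socle_iff _).2 fun b => ?_
  obtain ⟨b, rfl⟩ := hf b
  obtain ⟨hlam, hcomm⟩ := (proj_mem_socle_iff N).1 (h ⟨x, hx, rfl⟩) b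
  refine ⟨⟨_, hlam, ?_⟩, ⟨_, hcomm, ?_⟩⟩
  · exact (f.map_add' _ _).trans (by rw [f.map_neg, f.map_lam]; rfl)
  · exact (f.map_sub _ _).trans (by rw [f.map_sub, f.map_add']; rfl)

theorem SkewBrace.IsAlmostPolycyclic.forall_fg (hB : IsAlmostPolycyclic B) (H : AddSubgroup B) :
    H.FG := by
  obtain ⟨n, I, h0, hn, h⟩ := hB
  suffices ∀ i ≤ n, ∀ H : AddSubgroup B, H ≤ (I i).toAddSubgroup → H.FG from
    this n le_rfl H fun x _ => Set.eq_univ_iff_forall.1 hn x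
  intro i hi
  induction i with
  | zero =>
    exact fun H hH => addSubgroup_fg_of_finite ((Set.finite_singleton 0).subset (h0 ▸ hH))
  | succ i ih =>
    intro H hH
    have hmap : H.map (I i).proj ≤ (I i).factor (I (i + 1)) := AddSubgroup.map_mono hH
    refine addSubgroup_fg_of_fg_map_of_fg_inf_ker (I i).proj ?_
      (ih (Nat.le_of_succ_le hi) _ fun x hx => (I i).proj_eq_zero.1 hx.2)
    rcases (h i hi).2 with hfin | ⟨hfg, hsoc⟩
    · exact addSubgroup_fg_of_finite ((Set.toFinite _).subset hmap)
    · exact addSubgroup_fg_of_le_of_comm hfg (fun x hx y _ => (hsoc hx).2 y) hmap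

theorem SkewBrace.IsAlmostPolycyclic.of_surjective (hB : IsAlmostPolycyclic B)
    (f : BraceHom B D) (hf : Function.Surjective f.toFun) : IsAlmostPolycyclic D := by
  have hfg := hB.forall_fg
  obtain ⟨n, I, h0, hn, h⟩ := hB
  refine ⟨n, fun i => (I i).map f hf, ?_, ?_, fun i hi => ⟨Set.image_mono (h i hi).1, ?_⟩⟩
  · exact (congrArg (f.toFun '' ·) h0).trans (by rw [Set.image_singleton, f.map_zero])
  · exact (congrArg (f.toFun '' ·) hn).trans (by rw [Set.image_univ, hf.range_eq])
  · exact (h i hi).2.imp (fun hfin => finite_factor_map hfin f hf) fun hsoc =>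
      ⟨addSubgroup_fg_map (addSubgroup_fg_map (hfg _) f.toAdd) _,
        factor_map_subset_socle hsoc.2 f hf⟩

end AlmostPolycyclic

section SocleElements

open SkewBrace BraceIdeal

variable {D : Type u} [SkewBrace D]

theorem iterate_card_perm_eq_self {N : AddSubgroup D} [Finite N] {f : D → D}
    (hf : Function.Injective f) (h : ∀ b, -b + f b ∈ N) (b : D) :
    f^[Nat.card (Equiv.Perm N)] b = b := by
  set C := {y | -b + y ∈ N}
  have hmaps : Set.MapsTo f C C := fun y hy => by
    have := N.add_mem hy (h y)
    rwa [add_assoc, add_neg_cancel_left] at this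
  let e : C ≃ N :=
    { toFun := fun y => ⟨-b + y, y.2⟩
      invFun := fun n => ⟨b + n, show -b + (b + n) ∈ N by rw [neg_add_cancel_left]; exact n.2⟩
      left_inv := fun y => Subtype.ext (add_neg_cancel_left _ _)
      right_inv := fun n => Subtype.ext (neg_add_cancel_left _ _) }
  have : Finite C := Finite.of_equiv N e.symm
  let σ : Equiv.Perm C := .ofBijective (hmaps.restrict f C C)
    (Finite.injective_iff_bijective.1 (hmaps.restrict_inj.2 hf.injOn))
  have hσ : σ ^ Nat.card (Equiv.Perm N) = 1 := by
    rw [← Nat.card_congr e.permCongr, pow_card_eq_one']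
  have hb : -b + b ∈ N := by rw [neg_add_cancel]; exact N.zero_mem
  have hiter := congrArg (fun τ : Equiv.Perm C => ((τ ⟨b, hb⟩ : C) : D)) hσ
  rw [Equiv.Perm.coe_pow] at hiter
  exact (hmaps.coe_iterate_restrict ⟨b, hb⟩ _).symm.trans hiter

theorem lam_pow (x : D) (k : ℕ) (b : D) : lam (x ^ k) b = (lam x)^[k] b := by
  induction k with
  | zero => rw [pow_zero, lam_one]; rfl
  | succ k ih => rw [pow_succ', lam_mul, ih, Function.iterate_succ_apply']

theorem iterate_addConj (x : D) (k : ℕ) (b : D) :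
    (fun b => x + b - x)^[k] b = k • x + b - k • x := by
  induction k with
  | zero => simp only [Function.iterate_zero, id_eq, zero_nsmul, zero_add, sub_zero]
  | succ k ih =>
    rw [Function.iterate_succ_apply', ih, succ_nsmul']
    simp only [sub_eq_add_neg, neg_add_rev, add_assoc]

theorem pow_eq_nsmul_of_lam {z : D} (hz : ∀ b, lam z b = b) (k : ℕ) : z ^ k = k • z := by
  induction k with
  | zero => rw [pow_zero, zero_nsmul, one_eq_zero]
  | succ k ih => rw [pow_succ', ih, mul_eq, hz, succ_nsmul']

variable {N X : BraceIdeal D}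

theorem exists_pow_lam_eq_self (hN : N.carrier.Finite) {x : D} (hx : ∀ b, -b + lam x b ∈ N) :
    ∃ k, 0 < k ∧ ∀ b, lam (x ^ k) b = b := by
  have : Finite N.toAddSubgroup := hN
  refine ⟨Nat.card (Equiv.Perm N.toAddSubgroup), Nat.card_pos, fun b => (lam_pow x _ b).trans ?_⟩
  exact iterate_card_perm_eq_self (N := N.toAddSubgroup)
    (fun a b h => by rw [← lam_inv_lam x a, h, lam_inv_lam]) hx b

theorem exists_nsmul_add_comm (hN : N.carrier.Finite) {x : D} (hx : ∀ b, x + b - x - b ∈ N) :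
    ∃ k, 0 < k ∧ ∀ b, k • x + b = b + k • x := by
  have : Finite N.toAddSubgroup := hN
  refine ⟨Nat.card (Equiv.Perm N.toAddSubgroup), Nat.card_pos, fun b =>
    sub_eq_iff_eq_add.1 ((iterate_addConj x _ b).symm.trans ?_)⟩
  refine iterate_card_perm_eq_self (N := N.toAddSubgroup)
    (fun a b h => add_left_cancel (sub_left_injective h)) (fun b => ?_) b
  have := N.add_conj_mem' (-b) (hx b)
  rwa [sub_neg_eq_add, add_assoc, sub_add_cancel] at this

theorem exists_nsmul_proj_mem_socle (hN : N.carrier.Finite) {x : D}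
    (hx : N.proj x ∈ SkewBrace.socle N.Quot) :
    ∃ v ∈ SkewBrace.socle D, ∃ k, 0 < k ∧ N.proj v = k • N.proj x := by
  obtain ⟨k, hk, hlam⟩ := exists_pow_lam_eq_self hN fun b => (N.proj_mem_socle_iff.1 hx b).1
  have hproj : N.proj (x ^ k) = k • N.proj x := by
    rw [← pow_eq_nsmul_of_lam hx.1]
    exact _root_.map_pow N.projHom.toMul x k
  obtain ⟨l, hl, hcomm⟩ := exists_nsmul_add_comm hN (x := x ^ k) fun b =>
    (N.proj_mem_socle_iff.1 (hproj ▸ (BraceIdeal.socle N.Quot).nsmul_mem hx k) b).2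
  refine ⟨l • x ^ k, ⟨fun b => ?_, hcomm⟩, k * l, Nat.mul_pos hk hl, ?_⟩
  · rw [← pow_eq_nsmul_of_lam hlam, lam_pow]
    exact Function.iterate_fixed (hlam b) l
  · rw [map_nsmul, hproj, mul_nsmul]

theorem finite_or_exists_mem_socle (hN : N.carrier.Finite) (hfg : (N.factor X).FG)
    (hX : (N.factor X : Set N.Quot) ⊆ SkewBrace.socle N.Quot) :
    X.carrier.Finite ∨ ∃ v ∈ SkewBrace.socle D, ¬ IsOfFinAddOrder v := by
  by_cases htors : ∀ y ∈ N.factor X, IsOfFinAddOrder y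
  · refine Or.inl (finite_of_finite_factor hN ?_)
    exact finite_addSubgroup_of_torsion hfg (fun y hy z _ => (hX hy).2 z) htors
  · push Not at htors
    obtain ⟨y, hy, hinf⟩ := htors
    obtain ⟨x, rfl⟩ := N.proj_surjective y
    obtain ⟨v, hv, k, hk, hvk⟩ := exists_nsmul_proj_mem_socle hN (hX hy)
    refine Or.inr ⟨v, hv, fun hfin => hinf ?_⟩
    exact (isOfFinAddOrder_nsmul.1 (hvk ▸ N.proj.isOfFinAddOrder hfin)).resolve_right hk.ne'

theorem SkewBrace.IsAlmostPolycyclic.exists_mem_socle [Infinite D] (hD : IsAlmostPolycyclic D) :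
    ∃ v ∈ SkewBrace.socle D, ¬ IsOfFinAddOrder v := by
  obtain ⟨n, I, h0, hn, h⟩ := hD
  by_contra hsoc
  suffices ∀ i ≤ n, (I i).carrier.Finite from Set.infinite_univ (hn ▸ this n le_rfl)
  intro i hi
  induction i with
  | zero => exact h0 ▸ Set.finite_singleton 0
  | succ i ih =>
    have hN := ih (Nat.le_of_succ_le hi)
    rcases (h i hi).2 with hfin | ⟨hfg, hX⟩
    · exact finite_of_finite_factor hN hfin
    · exact (finite_or_exists_mem_socle hN hfg hX).resolve_right hsoc

end SocleElements

/-! ### Finite quotients of non-supersoluble braces -/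

section TorsionFreeIdeals

open SkewBrace BraceIdeal

variable {D : Type u} [SkewBrace D]

/-- The ideal `k A` of the `k`-fold multiples of the elements of an ideal `A` in the socle. -/
def BraceIdeal.smulIdeal (k : ℤ) {A : BraceIdeal D} (hA : A ≤ BraceIdeal.socle D) : BraceIdeal D :=
  ofSocle
    { carrier := {x | ∃ a ∈ A, k • a = x}
      zero_mem' := ⟨0, A.zero_mem, smul_zero k⟩
      add_mem' := by
        rintro _ _ ⟨a, ha, rfl⟩ ⟨b, hb, rfl⟩
        exact ⟨a + b, A.add_mem ha hb, AddCommute.zsmul_add ((hA ha).2 b) k⟩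
      neg_mem' := by
        rintro _ ⟨a, ha, rfl⟩
        exact ⟨-a, A.neg_mem ha, zsmul_neg a k⟩ }
    (by
      rintro _ ⟨a, ha, rfl⟩
      exact (BraceIdeal.socle D).zsmul_mem (hA ha) k)
    (by
      rintro b _ ⟨a, ha, rfl⟩
      exact ⟨lam b a, A.lam_mem' b ha, (lam_zsmul b k a).symm⟩)

theorem exists_ne_zero_smul_eq_zero_of_isOfFinAddOrder {F : AddSubgroup D} (hF : F.FG)
    (hcomm : ∀ x ∈ F, ∀ y ∈ F, x + y = y + x) :
    ∃ k : ℤ, k ≠ 0 ∧ ∀ x ∈ F, IsOfFinAddOrder x → k • x = 0 := by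
  let := addCommGroupOfComm F hcomm
  have : Module.Finite ℤ F := moduleFinite_int_of_fg hF hcomm
  obtain ⟨k, hk, h⟩ := exists_ne_zero_forall_smul_eq_zero
    (Submodule.torsion_isTorsion (R := ℤ) (M := F))
  refine ⟨k, hk, fun x hx hfin => ?_⟩
  obtain ⟨n, hn, hnx⟩ := isOfFinAddOrder_iff_zsmul_eq_zero.1 hfin
  have hmem : (⟨x, hx⟩ : F) ∈ Submodule.torsion ℤ F :=
    ⟨⟨n, mem_nonZeroDivisors_of_ne_zero hn⟩, Subtype.ext hnx⟩
  exact congrArg (fun y : Submodule.torsion ℤ F => (y : D)) (h ⟨_, hmem⟩)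

theorem exists_torsionFree_ideal (hfg : (BraceIdeal.socle D).toAddSubgroup.FG)
    {v : D} (hv : v ∈ SkewBrace.socle D) (hinf : ¬ IsOfFinAddOrder v) :
    ∃ A ≤ BraceIdeal.socle D, (∃ a ∈ A, a ≠ 0) ∧ ∀ a ∈ A, IsOfFinAddOrder a → a = 0 := by
  obtain ⟨k, hk, htors⟩ := exists_ne_zero_smul_eq_zero_of_isOfFinAddOrder hfg
    fun x hx y _ => hx.2 y
  refine ⟨smulIdeal k (A := BraceIdeal.socle D) fun _ h => h, ?_, ⟨k • v, ⟨v, hv, rfl⟩, ?_⟩, ?_⟩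
  · rintro _ ⟨a, ha, rfl⟩
    exact (BraceIdeal.socle D).zsmul_mem ha k
  · exact fun h => hinf (isOfFinAddOrder_iff_zsmul_eq_zero.2 ⟨k, hk, h⟩)
  · rintro _ ⟨a, ha, rfl⟩ hfin
    obtain ⟨n, hn, hna⟩ := isOfFinAddOrder_iff_zsmul_eq_zero.1 hfin
    refine htors a ha (isOfFinAddOrder_iff_zsmul_eq_zero.2 ⟨n * k, mul_ne_zero hn hk, ?_⟩)
    rwa [mul_smul]

end TorsionFreeIdeals

section FrobeniusFiltration

open SkewBrace BraceIdeal
open scoped Pointwise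

variable {B : Type u} [SkewBrace B]

/-- The action of `(B, ·)` on a commutative ideal by `λ`. -/
def idealAction (A : BraceIdeal B) (hA : ∀ x ∈ A, ∀ y ∈ A, x + y = y + x) :
    letI := addCommGroupOfComm A.toAddSubgroup hA
    Representation ℤ B A.toAddSubgroup :=
  letI := addCommGroupOfComm A.toAddSubgroup hA
  { toFun := fun g => AddMonoidHom.toIntLinearMap
      (AddMonoidHom.mk' (fun x => ⟨lam g x, A.lam_mem' g x.2⟩)
        fun x y => Subtype.ext (lam_add g x y))
    map_one' := by
      ext x
      exact lam_one (x : B)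
    map_mul' := fun g h => by
      ext x
      exact lam_mul g h (x : B) }

theorem BraceIdeal.CyclicStep.lam_comm {I I' : BraceIdeal B} (h : CyclicStep I I') {x : B}
    (hx : x ∈ I') (b b' : B) : lam b (lam b' x) - lam b' (lam b x) ∈ I := by
  obtain ⟨-, c, hc, hgen, -⟩ := h
  obtain ⟨k, hk⟩ := hgen x hx
  obtain ⟨l, hl⟩ := hgen _ (I'.lam_mem' b hc)
  obtain ⟨l', hl'⟩ := hgen _ (I'.lam_mem' b' hc)
  rw [proj_lam] at hl hl'
  rw [← proj_eq_zero, map_sub, proj_lam, proj_lam, proj_lam, proj_lam, hk]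
  simp only [lam_zsmul, hl, hl']
  rw [sub_eq_zero, smul_comm l' l]

theorem SkewBrace.lam_pow_eq_pow_smul {b c : B} {l : ℤ} (h : lam b c = l • c) (j : ℕ) :
    lam (b ^ j) c = l ^ j • c := by
  induction j with
  | zero => rw [pow_zero, lam_one, pow_zero, one_smul]
  | succ j ih => rw [pow_succ, lam_mul, h, lam_zsmul, ih, smul_smul, pow_succ']

theorem BraceIdeal.proj_pow (I : BraceIdeal B) (b : B) (k : ℕ) : I.proj (b ^ k) = I.proj b ^ k :=
  map_pow I.projHom.toMul b k

theorem BraceIdeal.CyclicStep.lam_pow_sub {I I' : BraceIdeal B} (h : CyclicStep I I') {x : B}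
    (hx : x ∈ I') (b : B) {p : ℕ} (hp : p.Prime) (hpx : p • x ∈ I) :
    lam (b ^ p) x - lam b x ∈ I := by
  obtain ⟨-, c, hc, hgen, -⟩ := h
  obtain ⟨k, hk⟩ := hgen x hx
  obtain ⟨l, hl⟩ := hgen _ (I'.lam_mem' b hc)
  rw [proj_lam] at hl
  have hscalar : lam (I.proj b) (I.proj x) = l • I.proj x := by
    rw [hk, lam_zsmul, hl, smul_comm]
  have hfermat : (p : ℤ) ∣ l ^ p - l := by
    have : Fact p.Prime := ⟨hp⟩
    rw [← ZMod.intCast_zmod_eq_zero_iff_dvd, Int.cast_sub, Int.cast_pow, ZMod.pow_card, sub_self]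
  obtain ⟨q, hq⟩ := hfermat
  have hpx0 : (p : ℤ) • I.proj x = 0 := by
    rw [natCast_zsmul, ← map_nsmul, proj_eq_zero]
    exact hpx
  rw [← proj_eq_zero, map_sub, proj_lam, proj_lam, proj_pow, lam_pow_eq_pow_smul hscalar, hscalar,
    sub_eq_add_neg, ← sub_zsmul, hq, mul_comm, mul_smul, hpx0, smul_zero]

variable {J : BraceIdeal B} {A : BraceIdeal J.Quot} (hA : ∀ x ∈ A, ∀ y ∈ A, x + y = y + x)

/-- The part of the ideal `A` of `B / J` that is covered by the ideal `I` of `B`. -/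
def coveredPart (I : BraceIdeal B) :
    letI := addCommGroupOfComm A.toAddSubgroup hA
    Submodule ℤ A.toAddSubgroup :=
  letI := addCommGroupOfComm A.toAddSubgroup hA
  AddSubgroup.toIntSubmodule ((I.toAddSubgroup.map J.proj).addSubgroupOf A.toAddSubgroup)

variable {hA} in
theorem mem_coveredPart {I : BraceIdeal B} {a : A.toAddSubgroup} :
    a ∈ coveredPart hA I ↔ ∃ x ∈ I, J.proj x = a := Iff.rfl

theorem hasFrobeniusFiltration_coveredPart {p : ℕ} (hp : p.Prime) {I : BraceIdeal B}
    (hI : QuotSupersoluble I) (hpI : ∀ x, J.proj x ∈ A → p • x ∈ I) :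
    letI := addCommGroupOfComm A.toAddSubgroup hA
    HasFrobeniusFiltration (idealAction A hA) p (coveredPart hA I) := by
  let := addCommGroupOfComm A.toAddSubgroup hA
  induction hI with
  | @top I h =>
    have htop : coveredPart hA I = ⊤ := eq_top_iff.2 fun a _ => by
      obtain ⟨x, hx⟩ := J.proj_surjective (a : J.Quot)
      exact mem_coveredPart.2 ⟨x, h x, hx⟩
    exact htop ▸ .top
  | @step I I' hstep _ ih =>
    refine .step ?_ ?_ ?_ (ih fun x hx => hstep.1 (hpI x hx))
    · rintro a ⟨x, hx, hxa⟩
      exact mem_coveredPart.2 ⟨x, hstep.1 hx, hxa⟩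
    · rintro a ⟨x, hx, hxa⟩ g g'
      obtain ⟨b, rfl⟩ := J.proj_surjective g
      obtain ⟨b', rfl⟩ := J.proj_surjective g'
      refine mem_coveredPart.2 ⟨_, hstep.lam_comm hx b b', ?_⟩
      rw [map_sub, proj_lam, proj_lam, proj_lam, proj_lam]
      exact hxa ▸ rfl
    · rintro a ⟨x, hx, hxa⟩ g
      obtain ⟨b, rfl⟩ := J.proj_surjective g
      refine mem_coveredPart.2 ⟨_, hstep.lam_pow_sub hx b hp (hpI x (hxa ▸ a.2)), ?_⟩
      rw [map_sub, proj_lam, proj_lam, proj_pow, ← MonoidHom.map_pow]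
      exact hxa ▸ rfl

theorem coveredPart_comap_smulIdeal (hA : A ≤ BraceIdeal.socle J.Quot) (k : ℤ) :
    letI := addCommGroupOfComm A.toAddSubgroup fun _ hx y _ => (hA hx).2 y
    coveredPart (fun _ hx y _ => (hA hx).2 y) (comap J.projHom (smulIdeal k hA)) =
      k • (⊤ : Submodule ℤ A.toAddSubgroup) := by
  let := addCommGroupOfComm A.toAddSubgroup fun _ hx y _ => (hA hx).2 y
  ext a
  rw [mem_coveredPart, Submodule.mem_smul_pointwise_iff_exists]
  constructor
  · rintro ⟨x, ⟨s, hs, hsx⟩, hxa⟩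
    exact ⟨⟨s, hs⟩, trivial, Subtype.ext (hsx.trans hxa)⟩
  · rintro ⟨y, -, rfl⟩
    obtain ⟨x, hx⟩ := J.proj_surjective (k • (y : J.Quot))
    exact ⟨x, ⟨y, y.2, hx.symm⟩, hx⟩

theorem exists_lam_eigenvector (hA : A ≤ BraceIdeal.socle J.Quot) (hfg : A.toAddSubgroup.FG)
    (hne : ∃ a ∈ A, a ≠ 0) (htf : ∀ a ∈ A, IsOfFinAddOrder a → a = 0)
    (hsup : ∀ K : BraceIdeal J.Quot, (∃ y ∈ K, y ≠ 0) → QuotSupersoluble (comap J.projHom K)) :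
    ∃ w ∈ A, w ≠ 0 ∧ ∀ b, lam b w = w ∨ lam b w = -w := by
  have hcomm : ∀ x ∈ A, ∀ y ∈ A, x + y = y + x := fun x hx y _ => (hA hx).2 y
  let := addCommGroupOfComm A.toAddSubgroup hcomm
  have hsmul : ∀ k : ℤ, k ≠ 0 → ∀ a ∈ A, k • a = 0 → a = 0 := fun k hk a ha h =>
    htf a ha (isOfFinAddOrder_iff_zsmul_eq_zero.2 ⟨k, hk, h⟩)
  have : Module.Finite ℤ A.toAddSubgroup := moduleFinite_int_of_fg hfg hcomm
  have : Module.IsTorsionFree ℤ A.toAddSubgroup := by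
    rw [Module.isTorsionFree_iff_smul_eq_zero]
    intro k x h
    by_cases hk : k = 0
    · exact Or.inl hk
    · exact Or.inr (Subtype.ext (hsmul k hk x x.2 (congrArg Subtype.val h)))
  obtain ⟨a, ha, ha0⟩ := hne
  have : Nontrivial A.toAddSubgroup := ⟨⟨a, ha⟩, 0, fun h => ha0 (congrArg Subtype.val h)⟩
  obtain ⟨w, hw0, hw⟩ := exists_common_eigenvector (idealAction A hcomm) fun p hp => by
    have hp0 : (p : ℤ) ≠ 0 := Int.natCast_ne_zero.2 hp.ne_zero
    rw [← coveredPart_comap_smulIdeal hA]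
    refine hasFrobeniusFiltration_coveredPart hcomm hp
      (hsup _ ⟨_, ⟨a, ha, rfl⟩, fun h => ha0 (hsmul p hp0 a ha h)⟩) fun x hx => ⟨_, hx, ?_⟩
    exact (natCast_zsmul _ p).trans (map_nsmul J.proj p x).symm
  exact ⟨w, w.2, fun h => hw0 (Subtype.ext h),
    fun b => (hw b).imp (congrArg Subtype.val) (congrArg Subtype.val)⟩

end FrobeniusFiltration

section MaximalNonSupersoluble

open SkewBrace BraceIdeal

variable {B : Type u} [SkewBrace B]

theorem BraceIdeal.cyclicStep_comap {J : BraceIdeal B} {K : BraceIdeal J.Quot} {a : J.Quot}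
    (hK : K.toAddSubgroup = AddSubgroup.zmultiples a)
    (ha : a ∈ SkewBrace.socle J.Quot ∨ ∃ p : ℕ, p.Prime ∧ p • a = 0) :
    CyclicStep J (comap J.projHom K) := by
  obtain ⟨c, rfl⟩ := J.proj_surjective a
  refine ⟨le_comap_projHom J K, c, ?_, fun x hx => ?_, ha⟩
  · exact hK.ge (AddSubgroup.mem_zmultiples (J.proj c))
  · obtain ⟨k, hk⟩ := AddSubgroup.mem_zmultiples_iff.1 (hK.le hx)
    exact ⟨k, hk.symm⟩

variable {J : BraceIdeal B}

theorem BraceIdeal.exists_maximal_not_quotSupersoluble (hB : IsAlmostPolycyclic B)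
    (h : ¬ IsSupersoluble B) :
    ∃ J : BraceIdeal B, ¬ QuotSupersoluble J ∧
      ∀ K : BraceIdeal J.Quot, (∃ y ∈ K, y ≠ 0) → QuotSupersoluble (comap J.projHom K) := by
  rw [isSupersoluble_iff_quotSupersoluble_zero] at h
  have := wellFoundedGT_addSubgroup_of_forall_fg hB.forall_fg
  have hwf : WellFounded fun I I' : BraceIdeal B => I.toAddSubgroup > I'.toAddSubgroup :=
    InvImage.wf _ (wellFounded_gt (α := AddSubgroup B))
  obtain ⟨J, hJ, hmax⟩ := hwf.has_min {J | ¬ QuotSupersoluble J} ⟨_, h⟩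
  refine ⟨J, hJ, fun K ⟨y, hy, hy0⟩ => not_not.1 fun hK => hmax _ hK ?_⟩
  obtain ⟨x, rfl⟩ := J.proj_surjective y
  exact lt_of_le_not_ge (le_comap_projHom J K) fun hle => hy0 (J.proj_eq_zero.2 (hle hy))

theorem finite_quot_of_maximal (hB : IsAlmostPolycyclic B) (hJ : ¬ QuotSupersoluble J)
    (hmax : ∀ K : BraceIdeal J.Quot, (∃ y ∈ K, y ≠ 0) → QuotSupersoluble (comap J.projHom K)) :
    Finite J.Quot := by
  by_contra hfin
  have : Infinite J.Quot := not_finite_iff_infinite.1 hfin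
  have hQ : IsAlmostPolycyclic J.Quot := hB.of_surjective J.projHom J.proj_surjective
  obtain ⟨v, hv, hinf⟩ := hQ.exists_mem_socle
  obtain ⟨A, hA, hne, htf⟩ := exists_torsionFree_ideal (hQ.forall_fg _) hv hinf
  obtain ⟨w, hw, hw0, hlam⟩ := exists_lam_eigenvector hA (hQ.forall_fg _) hne htf hmax
  have hspan : ∀ b, lam b w ∈ AddSubgroup.zmultiples w := fun b => by
    rcases hlam b with h | h <;> rw [h]
    · exact AddSubgroup.mem_zmultiples w
    · exact AddSubgroup.neg_mem _ (AddSubgroup.mem_zmultiples w)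
  exact hJ (.step (cyclicStep_comap (K := zmultiples (hA hw) hspan) rfl (Or.inl (hA hw)))
    (hmax _ ⟨w, AddSubgroup.mem_zmultiples w, hw0⟩))

end MaximalNonSupersoluble

section PrimeOrder

open SkewBrace BraceIdeal

/-- The brace `Q` has an ideal of prime order. -/
def HasIdealOfPrimeOrder (Q : Type u) [SkewBrace Q] : Prop :=
  ∃ K : BraceIdeal Q, (Nat.card K.toAddSubgroup).Prime

variable {Q : Type u} [SkewBrace Q]

theorem HasIdealOfPrimeOrder.exists_generator (h : HasIdealOfPrimeOrder Q) :
    ∃ (K : BraceIdeal Q) (a : Q) (p : ℕ), K.toAddSubgroup = AddSubgroup.zmultiples a ∧ a ≠ 0 ∧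
      p.Prime ∧ p • a = 0 := by
  obtain ⟨K, hK⟩ := h
  have : Fact (Nat.card K.toAddSubgroup).Prime := ⟨hK⟩
  obtain ⟨⟨a, ha⟩, hgen⟩ := (isAddCyclic_of_prime_card (α := K.toAddSubgroup) rfl).exists_generator
  have hspan : K.toAddSubgroup = AddSubgroup.zmultiples a := by
    refine le_antisymm (fun x hx => ?_) (AddSubgroup.zmultiples_le_of_mem ha)
    obtain ⟨k, hk⟩ := AddSubgroup.mem_zmultiples_iff.1 (hgen ⟨x, hx⟩)
    exact ⟨k, congrArg Subtype.val hk⟩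
  refine ⟨K, a, _, hspan, fun h0 => hK.one_lt.ne' ?_, hK, ?_⟩
  · rw [hspan, h0, AddSubgroup.zmultiples_zero_eq_bot, AddSubgroup.card_bot]
  · exact congrArg Subtype.val (card_nsmul_eq_zero' (x := (⟨a, ha⟩ : K.toAddSubgroup)))

theorem hasIdealOfPrimeOrder_of_eq_zmultiples {K : BraceIdeal Q} {a : Q}
    (hK : K.toAddSubgroup = AddSubgroup.zmultiples a) (ha : a ≠ 0) {p : ℕ} (hp : p.Prime)
    (hpa : p • a = 0) : HasIdealOfPrimeOrder Q := by
  have : Fact p.Prime := ⟨hp⟩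
  exact ⟨K, by rwa [hK, Nat.card_zmultiples, addOrderOf_eq_prime hpa ha]⟩

theorem hasIdealOfPrimeOrder_iff :
    HasIdealOfPrimeOrder Q ↔ ∃ a : Q, a ≠ 0 ∧ (∃ p : ℕ, p.Prime ∧ p • a = 0) ∧
      ∀ t ∈ AddSubgroup.zmultiples a, ∀ b, lam b t ∈ AddSubgroup.zmultiples a ∧
        b + t - b ∈ AddSubgroup.zmultiples a ∧ -b + lam t b ∈ AddSubgroup.zmultiples a := by
  constructor
  · intro h
    obtain ⟨K, a, p, hK, ha, hp, hpa⟩ := h.exists_generator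
    refine ⟨a, ha, ⟨p, hp, hpa⟩, fun t ht b => ?_⟩
    rw [← hK] at ht ⊢
    exact ⟨K.lam_mem' b ht, K.add_conj_mem' b ht, K.star_mem ht b⟩
  · rintro ⟨a, ha, ⟨p, hp, hpa⟩, h⟩
    exact hasIdealOfPrimeOrder_of_eq_zmultiples
      (K := ofAdd (AddSubgroup.zmultiples a) (fun b t ht => (h t ht b).1)
        (fun b t ht => (h t ht b).2.1) fun b t ht => (h t ht b).2.2) rfl ha hp hpa

theorem hasIdealOfPrimeOrder_of_socle {K : BraceIdeal Q} {d : Q} (hd : d ∈ SkewBrace.socle Q)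
    (hd0 : d ≠ 0) (hfin : IsOfFinAddOrder d) (hK : K.toAddSubgroup = AddSubgroup.zmultiples d) :
    HasIdealOfPrimeOrder Q := by
  have hp : (addOrderOf d).minFac.Prime :=
    Nat.minFac_prime fun h => hd0 (AddMonoid.addOrderOf_eq_one_iff.1 h)
  set p := (addOrderOf d).minFac
  set q := addOrderOf d / p
  have hpq : q * p = addOrderOf d := Nat.div_mul_cancel (Nat.minFac_dvd _)
  have hq : q • d ≠ 0 := fun h =>
    (Nat.le_of_dvd (Nat.div_pos (Nat.minFac_le hfin.addOrderOf_pos) hp.pos)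
      (addOrderOf_dvd_of_nsmul_eq_zero h)).not_gt
      (Nat.div_lt_self hfin.addOrderOf_pos hp.one_lt)
  have hlam : ∀ b, lam b (q • d) ∈ AddSubgroup.zmultiples (q • d) := fun b => by
    obtain ⟨k, hk⟩ := AddSubgroup.mem_zmultiples_iff.1
      (hK.le (K.lam_mem' b (hK.ge (AddSubgroup.mem_zmultiples d))))
    rw [lam_nsmul, ← hk, ← natCast_zsmul, ← natCast_zsmul, zsmul_comm]
    exact AddSubgroup.zsmul_mem_zmultiples _ k
  refine hasIdealOfPrimeOrder_of_eq_zmultiples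
    (K := zmultiples ((BraceIdeal.socle Q).nsmul_mem hd q) hlam) rfl hq hp ?_
  rw [← mul_nsmul, hpq, addOrderOf_nsmul_eq_zero]

end PrimeOrder

section FiniteQuotients

open SkewBrace BraceIdeal

variable {B : Type u} [SkewBrace B]

theorem exists_finite_quot_not_hasIdealOfPrimeOrder (hB : IsAlmostPolycyclic B)
    (h : ¬ IsSupersoluble B) :
    ∃ J : BraceIdeal B, Finite J.Quot ∧ Nontrivial J.Quot ∧ ¬ HasIdealOfPrimeOrder J.Quot := by
  obtain ⟨J, hJ, hmax⟩ := exists_maximal_not_quotSupersoluble hB h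
  refine ⟨J, finite_quot_of_maximal hB hJ hmax, ?_, fun hprime => hJ ?_⟩
  · by_contra htriv
    rw [not_nontrivial_iff_subsingleton] at htriv
    exact hJ (.top fun x => J.proj_eq_zero.1 (Subsingleton.elim _ _))
  · obtain ⟨K, a, p, hK, ha, hp, hpa⟩ := hprime.exists_generator
    exact .step (cyclicStep_comap hK (Or.inr ⟨p, hp, hpa⟩))
      (hmax K ⟨a, hK.ge (AddSubgroup.mem_zmultiples a), ha⟩)

variable {Q : Type v} [SkewBrace Q] (f : BraceHom B Q)

theorem BraceHom.map_eq_of_proj_eq {J : BraceIdeal B} (hJ : J ≤ ker f) {x y : B}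
    (h : J.proj x = J.proj y) : f.toFun x = f.toFun y := by
  have hker : f.toFun (-x + y) = 0 := hJ (J.proj_eq.1 h)
  rwa [f.map_add', f.map_neg, neg_add_eq_zero] at hker

theorem hasIdealOfPrimeOrder_of_cyclicStep [Finite Q] (hf : Function.Surjective f.toFun)
    {J J' : BraceIdeal B} (hstep : CyclicStep J J') (hJ : J ≤ ker f) (hJ' : ¬ J' ≤ ker f) :
    HasIdealOfPrimeOrder Q := by
  obtain ⟨-, c, hc, hgen, hor⟩ := hstep
  have hgenf : ∀ x ∈ J', ∃ k : ℤ, k • f.toFun c = f.toFun x := fun x hx => by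
    obtain ⟨k, hk⟩ := hgen x hx
    rw [← map_zsmul] at hk
    exact ⟨k, by rw [f.map_eq_of_proj_eq hJ hk, f.map_zsmul]⟩
  have hK : (J'.map f hf).toAddSubgroup = AddSubgroup.zmultiples (f.toFun c) := by
    refine le_antisymm ?_ (AddSubgroup.zmultiples_le_of_mem ⟨c, hc, rfl⟩)
    rintro _ ⟨x, hx, rfl⟩
    exact hgenf x hx
  have hc0 : f.toFun c ≠ 0 := fun h0 => hJ' fun x hx => by
    obtain ⟨k, hk⟩ := hgenf x hx
    rw [mem_ker, ← hk, h0, smul_zero]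
  rcases hor with hsoc | ⟨p, hp, hpc⟩
  · refine hasIdealOfPrimeOrder_of_socle ⟨fun b => ?_, fun b => ?_⟩ hc0
      (isOfFinAddOrder_of_finite _) hK <;> obtain ⟨b, rfl⟩ := hf b
    · rw [← f.map_lam]
      exact f.map_eq_of_proj_eq hJ (by rw [proj_lam, hsoc.1])
    · rw [← f.map_add', ← f.map_add']
      exact f.map_eq_of_proj_eq hJ (by rw [map_add, map_add, hsoc.2])
  · refine hasIdealOfPrimeOrder_of_eq_zmultiples hK hc0 hp ?_
    rw [← map_nsmul] at hpc
    rw [← f.map_nsmul]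
    exact hJ (J.proj_eq_zero.1 hpc)

theorem not_isSupersoluble_of_not_hasIdealOfPrimeOrder [Finite Q] [Nontrivial Q]
    (hf : Function.Surjective f.toFun) (hQ : ¬ HasIdealOfPrimeOrder Q) : ¬ IsSupersoluble B := by
  rw [isSupersoluble_iff_quotSupersoluble_zero]
  suffices h : ∀ J : BraceIdeal B, QuotSupersoluble J → ¬ J ≤ ker f from fun h0 =>
    h _ h0 fun x hx => by rw [mem_zero.1 hx]; exact f.map_zero
  intro J hJ
  induction hJ with
  | top h =>
    intro hker
    obtain ⟨y, hy⟩ := exists_ne (0 : Q)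
    obtain ⟨x, rfl⟩ := hf y
    exact hy (hker (h x))
  | step hstep _ ih =>
    exact fun hker => hQ (hasIdealOfPrimeOrder_of_cyclicStep f hf hstep hker ih)

end FiniteQuotients

/-! ### Recursively enumerable predicates -/

section Computability

open Encodable Denumerable

variable {α β γ σ : Type*} [Primcodable α] [Primcodable β] [Primcodable γ] [Primcodable σ]

attribute [fun_prop] Primrec

@[fun_prop]
theorem primrec_id : Primrec fun a : α => a := Primrec.id

@[fun_prop]
theorem primrec_const (x : σ) : Primrec fun _ : α => x := Primrec.const x

@[fun_prop]
theorem primrec_comp {f : β → σ} {g : α → β} (hf : Primrec f) (hg : Primrec g) :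
    Primrec fun a => f (g a) := hf.comp hg

@[fun_prop]
theorem primrec_fst {f : α → β × γ} (hf : Primrec f) : Primrec fun a => (f a).1 :=
  Primrec.fst.comp hf

@[fun_prop]
theorem primrec_snd {f : α → β × γ} (hf : Primrec f) : Primrec fun a => (f a).2 :=
  Primrec.snd.comp hf

@[fun_prop]
theorem primrec_pair {f : α → β} {g : α → γ} (hf : Primrec f) (hg : Primrec g) :
    Primrec fun a => (f a, g a) := hf.pair hg

@[fun_prop]
theorem primrec_add {f g : α → ℕ} (hf : Primrec f) (hg : Primrec g) :
    Primrec fun a => f a + g a := Primrec.nat_add.comp hf hg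

@[fun_prop]
theorem primrec_mul {f g : α → ℕ} (hf : Primrec f) (hg : Primrec g) :
    Primrec fun a => f a * g a := Primrec.nat_mul.comp hf hg

@[fun_prop]
theorem primrec_mod {f g : α → ℕ} (hf : Primrec f) (hg : Primrec g) :
    Primrec fun a => f a % g a := Primrec.nat_mod.comp hf hg

@[fun_prop]
theorem primrec_natPair {f g : α → ℕ} (hf : Primrec f) (hg : Primrec g) :
    Primrec fun a => Nat.pair (f a) (g a) := Primrec₂.natPair.comp hf hg

@[fun_prop]
theorem primrec_unpair {f : α → ℕ} (hf : Primrec f) : Primrec fun a => (f a).unpair :=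
  Primrec.unpair.comp hf

@[fun_prop]
theorem primrec_ofNat (τ : Type*) [Denumerable τ] {f : α → ℕ} (hf : Primrec f) :
    Primrec fun a => ofNat τ (f a) := (Primrec.ofNat τ).comp hf

@[fun_prop]
theorem primrec_encode {f : α → β} (hf : Primrec f) : Primrec fun a => encode (f a) :=
  Primrec.encode.comp hf

@[fun_prop]
theorem primrec_cons {f : α → β} {g : α → List β} (hf : Primrec f) (hg : Primrec g) :
    Primrec fun a => f a :: g a := Primrec.list_cons.comp hf hg

@[fun_prop]
theorem primrec_getD {f : α → List β} {g : α → ℕ} {d : α → β} (hf : Primrec f) (hg : Primrec g)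
    (hd : Primrec d) : Primrec fun a => (f a).getD (g a) (d a) := by
  simp only [List.getD_eq_getElem?_getD]
  exact Primrec.option_getD.comp (Primrec.list_getElem?.comp hf hg) hd

@[fun_prop]
theorem primrec_take {f : α → ℕ} {g : α → List β} (hf : Primrec f) (hg : Primrec g) :
    Primrec fun a => (g a).take (f a) := Primrec.list_take.comp hf hg

@[fun_prop]
theorem primrec_length {f : α → List β} (hf : Primrec f) : Primrec fun a => (f a).length :=
  Primrec.list_length.comp hf

@[fun_prop]
theorem primrec_foldr {f : α → List β} {g : α → σ} {h : α → β → σ → σ} (hf : Primrec f)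
    (hg : Primrec g) (hh : Primrec fun s : α × β × σ => h s.1 s.2.1 s.2.2) :
    Primrec fun a => (f a).foldr (h a) (g a) :=
  Primrec.list_foldr (h := fun a s => h a s.1 s.2) hf hg hh

@[fun_prop]
theorem primrec_cond {c : α → Bool} {f g : α → β} (hc : Primrec c) (hf : Primrec f)
    (hg : Primrec g) : Primrec fun a => bif c a then f a else g a := Primrec.cond hc hf hg

@[fun_prop]
theorem primrec_beq [DecidableEq β] {f g : α → β} (hf : Primrec f) (hg : Primrec g) :
    Primrec fun a => f a == g a := Primrec.beq.comp hf hg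

/-- Recursive enumerability of a predicate, in the form that is easiest to verify: the predicate is
the projection of a primitive recursive relation. -/
def Semidecidable (p : α → Prop) : Prop :=
  ∃ q : α → ℕ → Prop, PrimrecRel q ∧ ∀ a, p a ↔ ∃ n, q a n

namespace Semidecidable

theorem of_primrecPred {p : α → Prop} (hp : PrimrecPred p) : Semidecidable p :=
  ⟨fun a _ => p a, hp.comp Primrec.fst, fun _ => ⟨fun h => ⟨0, h⟩, fun ⟨_, h⟩ => h⟩⟩

theorem of_iff {p q : α → Prop} (hp : Semidecidable p) (h : ∀ a, q a ↔ p a) :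
    Semidecidable q := by
  obtain ⟨r, hr, h'⟩ := hp
  exact ⟨r, hr, fun a => (h a).trans (h' a)⟩

theorem comp {p : β → Prop} (hp : Semidecidable p) {f : α → β} (hf : Primrec f) :
    Semidecidable fun a => p (f a) := by
  obtain ⟨r, hr, h⟩ := hp
  exact ⟨fun a => r (f a), hr.comp (by fun_prop) Primrec.snd, fun a => h (f a)⟩

theorem eq {f g : α → β} (hf : Primrec f) (hg : Primrec g) :
    Semidecidable fun a => f a = g a :=
  .of_primrecPred (Primrec.eq.comp hf hg)

theorem ne {f g : α → β} (hf : Primrec f) (hg : Primrec g) :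
    Semidecidable fun a => f a ≠ g a :=
  .of_primrecPred (Primrec.eq.comp hf hg).not

theorem lt {f g : α → ℕ} (hf : Primrec f) (hg : Primrec g) :
    Semidecidable fun a => f a < g a :=
  .of_primrecPred (Primrec.nat_lt.comp hf hg)

theorem exists_right {β : Type*} [Denumerable β] {p : α → β → Prop}
    (hp : Semidecidable fun s : α × β => p s.1 s.2) : Semidecidable fun a => ∃ b, p a b := by
  obtain ⟨r, hr, h⟩ := hp
  refine ⟨fun a n => r (a, ofNat β n.unpair.1) n.unpair.2,
    PrimrecRel.comp hr (by fun_prop) (by fun_prop), fun a => ?_⟩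
  constructor
  · rintro ⟨b, hb⟩
    obtain ⟨n, hn⟩ := (h (a, b)).1 hb
    exact ⟨Nat.pair (encode b) n, by simpa using hn⟩
  · rintro ⟨n, hn⟩
    exact ⟨_, (h (a, _)).2 ⟨_, hn⟩⟩

theorem and {p q : α → Prop} (hp : Semidecidable p) (hq : Semidecidable q) :
    Semidecidable fun a => p a ∧ q a := by
  obtain ⟨r, hr, h⟩ := hp
  obtain ⟨s, hs, h'⟩ := hq
  refine ⟨fun a n => r a n.unpair.1 ∧ s a n.unpair.2,
    (PrimrecRel.comp hr (by fun_prop) (by fun_prop)).and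
    (PrimrecRel.comp hs (by fun_prop) (by fun_prop)), fun a => ?_⟩
  refine (and_congr (h a) (h' a)).trans ?_
  constructor
  · rintro ⟨⟨m, hm⟩, n, hn⟩
    exact ⟨Nat.pair m n, by simpa using ⟨hm, hn⟩⟩
  · rintro ⟨n, hn⟩
    exact ⟨⟨_, hn.1⟩, _, hn.2⟩

theorem or {p q : α → Prop} (hp : Semidecidable p) (hq : Semidecidable q) :
    Semidecidable fun a => p a ∨ q a := by
  obtain ⟨r, hr, h⟩ := hp
  obtain ⟨s, hs, h'⟩ := hq
  refine ⟨fun a n => r a n ∨ s a n, PrimrecPred.or hr hs, fun a => ?_⟩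
  exact (or_congr (h a) (h' a)).trans exists_or.symm

theorem forall_lt {p : α → ℕ → Prop} {f : α → ℕ} (hf : Primrec f)
    (hp : Semidecidable fun s : α × ℕ => p s.1 s.2) :
    Semidecidable fun a => ∀ i < f a, p a i := by
  obtain ⟨r, hr, h⟩ := hp
  have hr' : PrimrecRel fun (n : ℕ) (s : α × ℕ) => r s n :=
    PrimrecRel.comp hr Primrec.snd Primrec.fst
  have hex : PrimrecRel fun (i : ℕ) (s : α × ℕ) => ∃ n ∈ List.range s.2, r (s.1, i) n :=
    hr'.exists_mem_list.comp (Primrec.list_range.comp (by fun_prop)) (by fun_prop)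
  refine ⟨fun a m => ∀ i ∈ List.range (f a), ∃ n ∈ List.range m, r (a, i) n,
    hex.forall_mem_list.comp (Primrec.list_range.comp (by fun_prop)) Primrec.id, fun a => ?_⟩
  simp only [List.mem_range]
  constructor
  · intro ha
    choose! g hg using fun i hi => (h (a, i)).1 (ha i hi)
    refine ⟨(Finset.range (f a)).sup g + 1, fun i hi => ⟨g i, Nat.lt_succ_of_le ?_, hg i hi⟩⟩
    exact Finset.le_sup (f := g) (Finset.mem_range.2 hi)
  · rintro ⟨m, hm⟩ i hi
    obtain ⟨n, -, hn⟩ := hm i hi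
    exact (h (a, i)).2 ⟨n, hn⟩

protected theorem rePred {p : α → Prop} (hp : Semidecidable p) : REPred p := by
  obtain ⟨r, ⟨hdec, hr⟩, hp⟩ := hp
  have : ∀ a n, Decidable (r a n) := fun a n => hdec (a, n)
  have hr' : Computable₂ fun a n => decide (r a n) := (hr.of_eq fun _ => by congr 1).to_comp
  refine (Partrec.rfind hr'.partrec₂).dom_re.of_eq fun a => ?_
  simp [Nat.rfind_dom, hp]

theorem exists_partrec {p q : α → Prop} (hp : Semidecidable p) (hq : Semidecidable q) :
    ∃ f : α →. Bool, Partrec f ∧ (∀ a, true ∈ f a → p a) ∧ (∀ a, false ∈ f a → q a) ∧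
      ∀ a, p a ∨ q a → ∃ b, b ∈ f a := by
  have answer (b : Bool) {r : α → Prop} (hr : Semidecidable r) :
      Partrec fun a => (Part.assert (r a) fun _ => Part.some ()).map fun _ => b :=
    Partrec.map hr.rePred (Computable.const b)
  obtain ⟨f, hf, h⟩ := Partrec.merge' (answer true hp) (answer false hq)
  refine ⟨f, hf, fun a ha => ?_, fun a ha => ?_, fun a ha => Part.dom_iff_mem.1 ((h a).2.2 ?_)⟩
  · simpa using (h a).1 true ha
  · simpa using (h a).1 false ha
  · exact ha.imp (fun h => ⟨h, trivial⟩) fun h => ⟨h, trivial⟩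

end Semidecidable

theorem semidecidable_prime : Semidecidable Nat.Prime := by
  have hprime (p : ℕ) : p.Prime ↔ 1 < p ∧ ∀ m < p, p % m ≠ 0 ∨ m = 1 := by
    simp only [Nat.prime_def_lt, Nat.dvd_iff_mod_eq_zero, imp_iff_not_or, ne_eq]
    rfl
  refine .of_iff (.and (.lt (by fun_prop) (by fun_prop))
    (.forall_lt (by fun_prop) (.or ?_ ?_))) hprime
  · exact .ne (by fun_prop) (by fun_prop)
  · exact .eq (by fun_prop) (by fun_prop)

section StepClosure

variable {d : α → σ} {step : α → ℕ → σ → σ → σ}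

/-- The closure of `d a` under the binary operations `step a 0, step a 1, …`. -/
inductive StepClosure {α σ : Type*} (d : α → σ) (step : α → ℕ → σ → σ → σ) (a : α) : σ → Prop
  | base : StepClosure d step a (d a)
  | step (t : ℕ) {u v : σ} (hu : StepClosure d step a u) (hv : StepClosure d step a v) :
    StepClosure d step a (step a t u v)

theorem unpair_unpair_lt_succ (n : ℕ) :
    n.unpair.2.unpair.1 < n + 1 ∧ n.unpair.2.unpair.2 < n + 1 :=
  ⟨Nat.lt_succ_of_le ((Nat.unpair_left_le _).trans (Nat.unpair_right_le _)),
    Nat.lt_succ_of_le ((Nat.unpair_right_le _).trans (Nat.unpair_right_le _))⟩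

/-- An enumeration of `StepClosure d step a`: the index `n + 1` codes the number of an operation
and the indices of its two arguments. -/
def stepClosureEnum {α σ : Type*} (d : α → σ) (step : α → ℕ → σ → σ → σ) (a : α) : ℕ → σ
  | 0 => d a
  | n + 1 =>
    have := unpair_unpair_lt_succ n
    step a n.unpair.1 (stepClosureEnum d step a n.unpair.2.unpair.1)
      (stepClosureEnum d step a n.unpair.2.unpair.2)

theorem stepClosure_iff_exists {α σ : Type*} {d : α → σ} {step : α → ℕ → σ → σ → σ} {a : α}
    {s : σ} : StepClosure d step a s ↔ ∃ n, stepClosureEnum d step a n = s := by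
  constructor
  · intro h
    induction h with
    | base => exact ⟨0, by rw [stepClosureEnum]⟩
    | step t _ _ ih ih' =>
      obtain ⟨m, rfl⟩ := ih
      obtain ⟨n, rfl⟩ := ih'
      exact ⟨Nat.pair t (Nat.pair m n) + 1, by rw [stepClosureEnum]; simp⟩
  · rintro ⟨n, rfl⟩
    induction n using Nat.strong_induction_on with
    | _ n ih =>
      cases n with
      | zero => rw [stepClosureEnum]; exact .base
      | succ n =>
        rw [stepClosureEnum]
        exact .step _ (ih _ (unpair_unpair_lt_succ n).1) (ih _ (unpair_unpair_lt_succ n).2)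

theorem primrec_stepClosureEnum (hd : Primrec d)
    (hs : Primrec fun s : α × ℕ × σ × σ => step s.1 s.2.1 s.2.2.1 s.2.2.2) :
    Primrec₂ (stepClosureEnum d step) := by
  -- course-of-values recursion: `l` lists the first `l.length` terms of the enumeration
  refine Primrec.nat_strong_rec _ (g := fun a l => some (l.length.casesOn (d a) fun n =>
    step a n.unpair.1 (l.getD n.unpair.2.unpair.1 (d a)) (l.getD n.unpair.2.unpair.2 (d a)))) ?_ ?_
  · refine Primrec.option_some.comp (Primrec.nat_casesOn (Primrec.list_length.comp Primrec.snd)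
      (by fun_prop) ?_)
    exact hs.comp (f := fun s => step s.1 s.2.1 s.2.2.1 s.2.2.2) (g := fun s : (α × List σ) × ℕ =>
      (s.1.1, s.2.unpair.1, s.1.2.getD s.2.unpair.2.unpair.1 (d s.1.1),
        s.1.2.getD s.2.unpair.2.unpair.2 (d s.1.1))) (by fun_prop)
  · intro a n
    cases n with
    | zero => simp [stepClosureEnum]
    | succ n =>
      rw [stepClosureEnum]
      simp [unpair_unpair_lt_succ n]

theorem semidecidable_stepClosure (hd : Primrec d)
    (hs : Primrec fun s : α × ℕ × σ × σ => step s.1 s.2.1 s.2.2.1 s.2.2.2) :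
    Semidecidable fun s : α × σ => StepClosure d step s.1 s.2 :=
  ⟨fun s n => stepClosureEnum d step s.1 n = s.2,
    Primrec.eq.comp ((primrec_stepClosureEnum hd hs).comp (Primrec.fst.comp Primrec.fst)
      Primrec.snd) (Primrec.snd.comp Primrec.fst),
    fun _ => stepClosure_iff_exists⟩

end StepClosure

end Computability

/-! ### Equational derivations over a finite presentation -/

namespace BWord

open Encodable Denumerable

instance : DecidableEq (BWord ℕ) := Encodable.decidableEqOfEncodable _

section Primrec

variable {α : Type*} [Primcodable α] {f g : α → BWord ℕ}

@[fun_prop]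
theorem primrec_of {f : α → ℕ} (hf : Primrec f) : Primrec fun a => BWord.of (f a) :=
  Primrec.encode_iff.1 (show Primrec fun a => 5 * f a + 1 by fun_prop)

@[fun_prop]
theorem primrec_add (hf : Primrec f) (hg : Primrec g) : Primrec fun a => (f a).add (g a) :=
  Primrec.encode_iff.1
    (show Primrec fun a => 5 * Nat.pair (encode (f a)) (encode (g a)) + 2 by fun_prop)

@[fun_prop]
theorem primrec_mul (hf : Primrec f) (hg : Primrec g) : Primrec fun a => (f a).mul (g a) :=
  Primrec.encode_iff.1
    (show Primrec fun a => 5 * Nat.pair (encode (f a)) (encode (g a)) + 3 by fun_prop)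

@[fun_prop]
theorem primrec_neg (hf : Primrec f) : Primrec fun a => (f a).neg :=
  Primrec.encode_iff.1 (show Primrec fun a => 5 * encode (f a) + 4 by fun_prop)

@[fun_prop]
theorem primrec_inv (hf : Primrec f) : Primrec fun a => (f a).inv :=
  Primrec.encode_iff.1 (show Primrec fun a => 5 * encode (f a) + 5 by fun_prop)

end Primrec

/-- Equality of two `b`-words is derivable in equational logic from the laws of skew braces and
the relations of the presentation with code `P`. Symbols beyond the generators of `P` stand for
`0`. -/
inductive Deriv (P : ℕ × List (BWord ℕ)) : BWord ℕ → BWord ℕ → Prop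
  | refl (a) : Deriv P a a
  | symm {a b} : Deriv P a b → Deriv P b a
  | trans {a b c} : Deriv P a b → Deriv P b c → Deriv P a c
  | add_congr {a a' b b'} : Deriv P a a' → Deriv P b b' → Deriv P (add a b) (add a' b')
  | mul_congr {a a' b b'} : Deriv P a a' → Deriv P b b' → Deriv P (mul a b) (mul a' b')
  | neg_congr {a a'} : Deriv P a a' → Deriv P (neg a) (neg a')
  | inv_congr {a a'} : Deriv P a a' → Deriv P (inv a) (inv a')
  | add_assoc (a b c) : Deriv P (add (add a b) c) (add a (add b c))
  | zero_add (a) : Deriv P (add empty a) a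
  | neg_add_cancel (a) : Deriv P (add (neg a) a) empty
  | mul_assoc (a b c) : Deriv P (mul (mul a b) c) (mul a (mul b c))
  | one_mul (a) : Deriv P (mul empty a) a
  | inv_mul_cancel (a) : Deriv P (mul (inv a) a) empty
  | brace (a b c) : Deriv P (mul a (add b c)) (add (add (mul a b) (neg a)) (mul a c))
  | relator {w} : w ∈ P.2 → Deriv P w empty
  | of_of_le {i} : P.1 ≤ i → Deriv P (of i) empty

namespace Deriv

variable {P : ℕ × List (BWord ℕ)} {v w : BWord ℕ}

theorem eval_eq {B : Type v} [SkewBrace B] {x : ℕ → B} (hR : ∀ w ∈ P.2, w.eval x = 0)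
    (hx : ∀ i, P.1 ≤ i → x i = 0) (h : Deriv P v w) : v.eval x = w.eval x := by
  induction h with
  | refl => rfl
  | symm _ ih => exact ih.symm
  | trans _ _ ih ih' => exact ih.trans ih'
  | add_congr _ _ ih ih' => exact congrArg₂ (· + ·) ih ih'
  | mul_congr _ _ ih ih' => exact congrArg₂ (· * ·) ih ih'
  | neg_congr _ ih => exact congrArg (- ·) ih
  | inv_congr _ ih => exact congrArg (·⁻¹) ih
  | add_assoc => exact FreeBrace.eval_eq_of_rel x (.add_assoc _ _ _)
  | zero_add => exact FreeBrace.eval_eq_of_rel x (.zero_add _)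
  | neg_add_cancel => exact FreeBrace.eval_eq_of_rel x (.neg_add_cancel _)
  | mul_assoc => exact FreeBrace.eval_eq_of_rel x (.mul_assoc _ _ _)
  | one_mul => exact FreeBrace.eval_eq_of_rel x (.one_mul _)
  | inv_mul_cancel => exact FreeBrace.eval_eq_of_rel x (.inv_mul_cancel _)
  | brace => exact FreeBrace.eval_eq_of_rel x (.brace _ _ _)
  | relator hw => exact hR _ hw
  | of_of_le hi => exact hx _ hi

/-- The rules of `Deriv` as an operation with premises `p` and `q`: the rule is selected by `t.1`
and applied to the words in `t.2`, and an inapplicable rule returns the trivial equality. -/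
def applyRule (P : ℕ × List (BWord ℕ)) (t : ℕ × BWord ℕ × BWord ℕ × BWord ℕ)
    (p q : BWord ℕ × BWord ℕ) : BWord ℕ × BWord ℕ :=
  [(t.2.1, t.2.1),
    (p.2, p.1),
    bif p.2 == q.1 then (p.1, q.2) else (empty, empty),
    (add p.1 q.1, add p.2 q.2),
    (mul p.1 q.1, mul p.2 q.2),
    (neg p.1, neg p.2),
    (inv p.1, inv p.2),
    (add (add t.2.1 t.2.2.1) t.2.2.2, add t.2.1 (add t.2.2.1 t.2.2.2)),
    (add empty t.2.1, t.2.1),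
    (add (neg t.2.1) t.2.1, empty),
    (mul (mul t.2.1 t.2.2.1) t.2.2.2, mul t.2.1 (mul t.2.2.1 t.2.2.2)),
    (mul empty t.2.1, t.2.1),
    (mul (inv t.2.1) t.2.1, empty),
    (mul t.2.1 (add t.2.2.1 t.2.2.2),
      add (add (mul t.2.1 t.2.2.1) (neg t.2.1)) (mul t.2.1 t.2.2.2)),
    (P.2.getD (encode t.2.1) empty, empty),
    (of (P.1 + encode t.2.1), empty)].getD t.1 (empty, empty)

theorem applyRule_sound {p q : BWord ℕ × BWord ℕ} (t : ℕ × BWord ℕ × BWord ℕ × BWord ℕ)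
    (hp : Deriv P p.1 p.2) (hq : Deriv P q.1 q.2) :
    Deriv P (applyRule P t p q).1 (applyRule P t p q).2 := by
  obtain ⟨n, x, y, z⟩ := t
  rcases Nat.lt_or_ge n 16 with hn | hn
  · interval_cases n <;> simp only [applyRule, List.getD_cons_zero, List.getD_cons_succ]
    · exact .refl _
    · exact hp.symm
    · by_cases hpq : p.2 = q.1
      · simpa [hpq] using (hpq ▸ hp).trans hq
      · rw [beq_false_of_ne hpq]
        exact .refl empty
    · exact hp.add_congr hq
    · exact hp.mul_congr hq
    · exact hp.neg_congr
    · exact hp.inv_congr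
    · exact .add_assoc _ _ _
    · exact .zero_add _
    · exact .neg_add_cancel _
    · exact .mul_assoc _ _ _
    · exact .one_mul _
    · exact .inv_mul_cancel _
    · exact .brace _ _ _
    · rcases lt_or_ge (encode x) P.2.length with h | h
      · simpa [h] using .relator (List.getElem_mem h)
      · simpa [h] using .refl empty
    · exact .of_of_le (Nat.le_add_right _ _)
  · rw [applyRule, List.getD_eq_default _ _ hn]
    exact .refl _

/-- The equalities generated from the trivial one by `applyRule`. -/
abbrev RuleClosure (P : ℕ × List (BWord ℕ)) : BWord ℕ × BWord ℕ → Prop :=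
  StepClosure (fun _ => (empty, empty)) (fun P t => applyRule P (ofNat _ t)) P

theorem ruleClosure_of_eq (t : ℕ × BWord ℕ × BWord ℕ × BWord ℕ)
    {p q s : BWord ℕ × BWord ℕ} (hs : applyRule P t p q = s) (hp : RuleClosure P p)
    (hq : RuleClosure P q) : RuleClosure P s := by
  have h := StepClosure.step (encode t) hp hq
  rwa [ofNat_encode, hs] at h

theorem ruleClosure (h : Deriv P v w) : RuleClosure P (v, w) := by
  induction h with
  | refl a => exact ruleClosure_of_eq (0, a, a, a) rfl .base .base
  | symm _ ih => exact ruleClosure_of_eq (1, empty, empty, empty) rfl ih ih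
  | trans _ _ ih ih' =>
    exact ruleClosure_of_eq (2, empty, empty, empty) (by simp [applyRule]) ih ih'
  | add_congr _ _ ih ih' => exact ruleClosure_of_eq (3, empty, empty, empty) rfl ih ih'
  | mul_congr _ _ ih ih' => exact ruleClosure_of_eq (4, empty, empty, empty) rfl ih ih'
  | neg_congr _ ih => exact ruleClosure_of_eq (5, empty, empty, empty) rfl ih ih
  | inv_congr _ ih => exact ruleClosure_of_eq (6, empty, empty, empty) rfl ih ih
  | add_assoc a b c => exact ruleClosure_of_eq (7, a, b, c) rfl .base .base
  | zero_add a => exact ruleClosure_of_eq (8, a, a, a) rfl .base .base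
  | neg_add_cancel a => exact ruleClosure_of_eq (9, a, a, a) rfl .base .base
  | mul_assoc a b c => exact ruleClosure_of_eq (10, a, b, c) rfl .base .base
  | one_mul a => exact ruleClosure_of_eq (11, a, a, a) rfl .base .base
  | inv_mul_cancel a => exact ruleClosure_of_eq (12, a, a, a) rfl .base .base
  | brace a b c => exact ruleClosure_of_eq (13, a, b, c) rfl .base .base
  | relator hw =>
    obtain ⟨i, hi, rfl⟩ := List.getElem_of_mem hw
    exact ruleClosure_of_eq (14, ofNat _ i, empty, empty) (by simp [applyRule, hi]) .base .base
  | @of_of_le i hi =>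
    exact ruleClosure_of_eq (15, ofNat _ (i - P.1), empty, empty)
      (by simp [applyRule, hi]) .base .base

theorem of_ruleClosure {s : BWord ℕ × BWord ℕ} (h : RuleClosure P s) : Deriv P s.1 s.2 := by
  induction h with
  | base => exact .refl _
  | step t _ _ ih ih' => exact applyRule_sound _ ih ih'

/-- Derivable equality as a setoid. -/
def setoid (P : ℕ × List (BWord ℕ)) : Setoid (BWord ℕ) := ⟨Deriv P, refl, symm, trans⟩

end Deriv

theorem semidecidable_deriv :
    Semidecidable fun s : (ℕ × List (BWord ℕ)) × BWord ℕ × BWord ℕ => Deriv s.1 s.2.1 s.2.2 := by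
  refine .of_iff (semidecidable_stepClosure (by fun_prop) ?_) fun _ =>
    ⟨Deriv.ruleClosure, Deriv.of_ruleClosure⟩
  unfold Deriv.applyRule
  fun_prop

/-- The skew brace of `b`-words modulo derivable equality. -/
def Presented (P : ℕ × List (BWord ℕ)) : Type := Quotient (Deriv.setoid P)

namespace Presented

variable {P : ℕ × List (BWord ℕ)}

/-- The class of a `b`-word. -/
def mk (w : BWord ℕ) : Presented P := Quotient.mk _ w

instance : Add (Presented P) := ⟨Quotient.map₂ .add fun _ _ h _ _ h' => h.add_congr h'⟩
instance : Mul (Presented P) := ⟨Quotient.map₂ .mul fun _ _ h _ _ h' => h.mul_congr h'⟩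
instance : Neg (Presented P) := ⟨Quotient.map .neg fun _ _ h => h.neg_congr⟩
instance : Inv (Presented P) := ⟨Quotient.map .inv fun _ _ h => h.inv_congr⟩
instance : Zero (Presented P) := ⟨mk .empty⟩
instance : One (Presented P) := ⟨mk .empty⟩

instance : SkewBrace (Presented P) where
  toAddGroup := AddGroup.ofLeftAxioms
    (by rintro ⟨a⟩ ⟨b⟩ ⟨c⟩; exact Quotient.sound (.add_assoc a b c))
    (by rintro ⟨a⟩; exact Quotient.sound (.zero_add a))
    (by rintro ⟨a⟩; exact Quotient.sound (.neg_add_cancel a))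
  toGroup := Group.ofLeftAxioms
    (by rintro ⟨a⟩ ⟨b⟩ ⟨c⟩; exact Quotient.sound (.mul_assoc a b c))
    (by rintro ⟨a⟩; exact Quotient.sound (.one_mul a))
    (by rintro ⟨a⟩; exact Quotient.sound (.inv_mul_cancel a))
  mul_add_eq := by
    rintro ⟨a⟩ ⟨b⟩ ⟨c⟩
    exact Quotient.sound (.brace a b c)

theorem eval_mk (w : BWord ℕ) : w.eval (fun i => (mk (of i) : Presented P)) = mk w := by
  induction w with
  | empty => rfl
  | of => rfl
  | add _ _ h h' => rw [eval, h, h']; rfl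
  | mul _ _ h h' => rw [eval, h, h']; rfl
  | neg _ h => rw [eval, h]; rfl
  | inv _ h => rw [eval, h]; rfl

end Presented

theorem eval_map {X Y : Type*} {B : Type*} [SkewBrace B] (f : X → Y) (b : Y → B) (w : BWord X) :
    (w.map f).eval b = w.eval (b ∘ f) := by
  induction w with
  | empty => rfl
  | of => rfl
  | add _ _ h h' => rw [map, eval, eval, h, h']
  | mul _ _ h h' => rw [map, eval, eval, h, h']
  | neg _ h => rw [map, eval, eval, h]
  | inv _ h => rw [map, eval, eval, h]

end BWord

theorem FreeBrace.eval_mk {X : Type*} (w : BWord X) :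
    w.eval (fun x => FreeBrace.mk (.of x)) = FreeBrace.mk w := by
  induction w with
  | empty => rfl
  | of => rfl
  | add _ _ h h' => rw [BWord.eval, h, h']; rfl
  | mul _ _ h h' => rw [BWord.eval, h, h']; rfl
  | neg _ h => rw [BWord.eval, h]; rfl
  | inv _ h => rw [BWord.eval, h]; rfl

namespace FiniteBracePresentation

variable (P : FiniteBracePresentation)

/-- The `i`-th generator of the free brace. The code of a presentation uses symbols indexed by `ℕ`,
so those beyond the generators are sent to `0`. -/
def gen (i : ℕ) : FreeBrace (Fin P.n) := if h : i < P.n then FreeBrace.mk (.of ⟨i, h⟩) else 0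

theorem eval_gen_map (w : BWord (Fin P.n)) : (w.map Fin.val).eval P.gen = FreeBrace.mk w := by
  rw [BWord.eval_map, ← FreeBrace.eval_mk]
  congr 1
  ext i
  simp [gen]

variable {P} {B : Type u} [SkewBrace B] {θ : BraceHom (FreeBrace (Fin P.n)) B}

/-- The image in `B` of the `i`-th generator, which is `0` beyond the generators. -/
def genOf (θ : BraceHom (FreeBrace (Fin P.n)) B) (i : ℕ) : B := θ.toFun (P.gen i)

theorem genOf_of_le {i : ℕ} (h : P.n ≤ i) : genOf θ i = 0 := by
  rw [genOf, gen, dif_neg (not_lt.2 h), θ.map_zero]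

theorem IsPresentation.eval_relator (h : P.IsPresentation θ) {w : BWord ℕ}
    (hw : w ∈ P.code.2) : w.eval (genOf θ) = 0 := by
  obtain ⟨r, hr, rfl⟩ := List.mem_map.1 hw
  change (r.map Fin.val).eval (fun i => θ.toFun (P.gen i)) = 0
  rw [← θ.map_eval, eval_gen_map]
  have h2 : FreeBrace.mk r ∈ {x | θ.toFun x = 0} := by
    rw [h.2]
    exact BraceIdeal.subset_span ⟨r, hr, rfl⟩
  exact h2

theorem IsPresentation.exists_eval (h : P.IsPresentation θ) (b : B) :
    ∃ w : BWord ℕ, w.eval (genOf θ) = b := by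
  obtain ⟨⟨w⟩, rfl⟩ := h.1 b
  refine ⟨w.map Fin.val, ?_⟩
  change (w.map Fin.val).eval (fun i => θ.toFun (P.gen i)) = _
  rw [← θ.map_eval, eval_gen_map]
  rfl

theorem IsPresentation.eval_eq_of_eq (h : P.IsPresentation θ) {C : Type v} [SkewBrace C]
    {c : ℕ → C} (hR : ∀ w ∈ P.code.2, w.eval c = 0) (hc : ∀ i, P.n ≤ i → c i = 0)
    {v w : BWord ℕ} (hvw : v.eval (genOf θ) = w.eval (genOf θ)) : v.eval c = w.eval c := by
  let ψ : BraceHom (FreeBrace (Fin P.n)) C := FreeBrace.lift fun i => c i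
  have hψ : ∀ w : BWord ℕ, ψ.toFun (w.eval P.gen) = w.eval c := by
    intro w
    rw [ψ.map_eval]
    congr 1
    ext i
    unfold gen
    split_ifs with hi
    · rfl
    · rw [ψ.map_zero, hc i (not_lt.1 hi)]
  have hker : ∀ x, θ.toFun x = 0 → ψ.toFun x = 0 := by
    intro x hx
    have hx' : x ∈ {x | θ.toFun x = 0} := hx
    rw [h.2] at hx'
    refine BraceIdeal.span_le (I := BraceIdeal.ker ψ) ?_ hx'
    rintro _ ⟨r, hr, rfl⟩
    rw [BraceIdeal.mem_ker, ← eval_gen_map, hψ]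
    exact hR _ (List.mem_map.2 ⟨r, hr, rfl⟩)
  rw [← hψ, ← hψ, ← sub_eq_zero, ← ψ.map_sub]
  refine hker _ ?_
  rw [θ.map_sub, sub_eq_zero, θ.map_eval, θ.map_eval]
  exact hvw

theorem IsPresentation.deriv_iff (h : P.IsPresentation θ) {v w : BWord ℕ} :
    BWord.Deriv P.code v w ↔ v.eval (genOf θ) = w.eval (genOf θ) := by
  constructor
  · exact BWord.Deriv.eval_eq (fun w hw => h.eval_relator hw) fun i hi => genOf_of_le hi
  · intro hvw
    have := h.eval_eq_of_eq (C := BWord.Presented P.code) (c := fun i => .mk (.of i))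
      (fun w hw => by
        rw [BWord.Presented.eval_mk]
        exact Quotient.sound (BWord.Deriv.relator hw))
      (fun i hi => Quotient.sound (BWord.Deriv.of_of_le hi)) hvw
    rw [BWord.Presented.eval_mk, BWord.Presented.eval_mk] at this
    exact Quotient.exact this

theorem IsPresentation.exists_hom (h : P.IsPresentation θ) {C : Type v} [SkewBrace C]
    {c : ℕ → C} (hR : ∀ w ∈ P.code.2, w.eval c = 0) (hc : ∀ i, P.n ≤ i → c i = 0) :
    ∃ f : BraceHom B C, ∀ w : BWord ℕ, f.toFun (w.eval (genOf θ)) = w.eval c := by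
  choose g hg using h.exists_eval
  have hkey : ∀ (b : B) (w : BWord ℕ), w.eval (genOf θ) = b → (g b).eval c = w.eval c :=
    fun b w hw => h.eval_eq_of_eq hR hc ((hg b).trans hw.symm)
  refine ⟨⟨fun b => (g b).eval c, fun a b => ?_, fun a b => ?_⟩, fun w => hkey _ _ rfl⟩
  · exact hkey _ ((g a).add (g b)) (by rw [BWord.eval, hg, hg])
  · exact hkey _ ((g a).mul (g b)) (by rw [BWord.eval, hg, hg])

end FiniteBracePresentation

/-! ### Chains of ideals generated by a sequence of elements -/

section InitSpan

variable {G : Type*} [AddGroup G]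

open AddSubgroup (normalizer mem_normalizer_iff le_normalizer zmultiples)

/-- The additive subgroup generated by the first `i` terms of the sequence `a`. -/
def initSpan (a : ℕ → G) (i : ℕ) : AddSubgroup G := AddSubgroup.closure (a '' Set.Iio i)

theorem mem_initSpan {a : ℕ → G} {i j : ℕ} (h : j < i) : a j ∈ initSpan a i :=
  AddSubgroup.subset_closure ⟨j, h, rfl⟩

theorem initSpan_le {a : ℕ → G} {i : ℕ} {H : AddSubgroup G} (h : ∀ j < i, a j ∈ H) :
    initSpan a i ≤ H := by
  rw [initSpan, AddSubgroup.closure_le]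
  rintro _ ⟨j, hj, rfl⟩
  exact h j hj

theorem initSpan_mono (a : ℕ → G) {i i' : ℕ} (h : i ≤ i') : initSpan a i ≤ initSpan a i' :=
  initSpan_le fun _ hj => mem_initSpan (hj.trans_le h)

theorem initSpan_zero (a : ℕ → G) : initSpan a 0 = ⊥ :=
  eq_bot_iff.2 (initSpan_le fun j hj => absurd hj (Nat.not_lt_zero j))

theorem initSpan_succ (a : ℕ → G) (i : ℕ) :
    initSpan a (i + 1) = zmultiples (a i) ⊔ initSpan a i := by
  rw [initSpan, initSpan, AddSubgroup.zmultiples_eq_closure, ← AddSubgroup.closure_union,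
    ← Set.image_singleton, ← Set.image_union]
  congr 2
  ext j
  simp [le_iff_eq_or_lt]

theorem exists_zsmul_add_of_mem_initSpan {a : ℕ → G} {i : ℕ}
    (ha : a i ∈ normalizer (initSpan a i : Set G)) {x : G} (hx : x ∈ initSpan a (i + 1)) :
    ∃ k : ℤ, ∃ t ∈ initSpan a i, x = k • a i + t := by
  rw [initSpan_succ, ← SetLike.mem_coe, AddSubgroup.coe_add_of_left_le_normalizer_right _ _
    ((AddSubgroup.zmultiples_le).2 ha)] at hx
  obtain ⟨_, ⟨k, rfl⟩, t, ht, rfl⟩ := hx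
  exact ⟨k, t, ht, rfl⟩

theorem conj_mem_initSpan {a : ℕ → G} {i : ℕ} {g : G} (h : ∀ j < i, g + a j + -g ∈ initSpan a i)
    {t : G} (ht : t ∈ initSpan a i) : g + t + -g ∈ initSpan a i :=
  initSpan_le (H := (initSpan a i).comap
    (AddMonoidHom.mk' (fun x => g + x + -g) fun x y => by simp [add_assoc])) h ht

theorem mem_normalizer_initSpan {a : ℕ → G} {i : ℕ} {g : G}
    (h : ∀ j < i, g + a j - g ∈ initSpan a i) (h' : ∀ j < i, -g + a j + g ∈ initSpan a i) :
    g ∈ normalizer (initSpan a i : Set G) := by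
  refine mem_normalizer_iff.2 fun t => ⟨conj_mem_initSpan (by simpa only [sub_eq_add_neg] using h),
    fun ht => ?_⟩
  simpa [add_assoc] using conj_mem_initSpan (g := -g) (by simpa only [neg_neg] using h') ht

theorem neg_zsmul_add_zsmul_mem {T : AddSubgroup G} {a s : G} (ha : a ∈ normalizer (T : Set G))
    (hs : s ∈ T) (k : ℤ) : -(k • a) + k • (a + s) ∈ T := by
  let N := normalizer (T : Set G)
  let a' : N := ⟨a, ha⟩
  let s' : N := ⟨s, le_normalizer hs⟩
  have hmk : ((a' + s' : N) : N ⧸ T.addSubgroupOf N) = a' :=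
    QuotientAddGroup.mk_add_of_mem a' hs
  have hmk' : ((k • a' : N) : N ⧸ T.addSubgroupOf N) = (k • (a' + s') : N) := by
    rw [QuotientAddGroup.mk_zsmul, QuotientAddGroup.mk_zsmul, hmk]
  exact AddSubgroup.mem_addSubgroupOf.1 (QuotientAddGroup.eq.1 hmk')

theorem exists_zsmul_eq_nsmul_add {q : ℕ} (hq : q ≠ 0) (k : ℤ) (c : G) :
    ∃ r < q, ∃ l : ℤ, k • c = r • c + l • q • c := by
  have hq' : (q : ℤ) ≠ 0 := Nat.cast_ne_zero.2 hq
  obtain ⟨r, hr⟩ := Int.eq_ofNat_of_zero_le (Int.emod_nonneg k hq')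
  refine ⟨r, ?_, k / q, ?_⟩
  · have := Int.emod_lt_of_pos k (Int.natCast_pos.2 (Nat.pos_of_ne_zero hq))
    omega
  · rw [← natCast_zsmul c r, ← natCast_zsmul c q, ← mul_zsmul', ← add_zsmul, ← hr,
      Int.emod_add_mul_ediv]

theorem commutator_mem_of_mem_initSpan {T : AddSubgroup G} [T.Normal] {a : ℕ → G} {n : ℕ} {c : G}
    (h : ∀ i < n, c + a i - c - a i ∈ T) {b : G} (hb : b ∈ initSpan a n) : c + b - c - b ∈ T := by
  have hcomm : ∀ x, c + x - c - x ∈ T ↔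
      x ∈ (AddSubgroup.centralizer {(c : G ⧸ T)}).comap (QuotientAddGroup.mk' T) := fun x => by
    rw [AddSubgroup.mem_comap, AddSubgroup.mem_centralizer_singleton_iff,
      QuotientAddGroup.mk'_apply, ← QuotientAddGroup.eq_zero_iff, QuotientAddGroup.mk_sub,
      QuotientAddGroup.mk_sub, QuotientAddGroup.mk_add, sub_eq_zero, sub_eq_iff_eq_add, eq_comm]
  exact (hcomm b).2 (initSpan_le (fun i hi => (hcomm _).1 (h i hi)) hb)

end InitSpan

section LamStabilizer

open SkewBrace AddSubgroup

variable {B : Type u} [SkewBrace B]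

/-- The elements `g` for which `λ_g` maps `T` onto itself. -/
def lamStabilizer (T : AddSubgroup B) : Subgroup B where
  carrier := {g | ∀ t, t ∈ T ↔ lam g t ∈ T}
  one_mem' t := by rw [lam_one]
  mul_mem' {g g'} hg hg' t := by rw [lam_mul, ← hg, ← hg']
  inv_mem' {g} hg t := by rw [hg (lam g⁻¹ t), lam_lam_inv]

theorem lam_mem_of_mem_lamStabilizer {T : AddSubgroup B} {g t : B} (hg : g ∈ lamStabilizer T)
    (ht : t ∈ T) : lam g t ∈ T := (hg t).1 ht

/-- The elements `g` for which `λ_g` induces the identity on the cosets of `T`. -/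
def lamKernel (T : AddSubgroup B) : Subgroup B where
  carrier := {g | ∀ b, -b + lam g b ∈ T}
  one_mem' b := by
    rw [lam_one, neg_add_cancel]
    exact T.zero_mem
  mul_mem' {g g'} hg hg' b := by
    have := T.add_mem (hg' b) (hg (lam g' b))
    rwa [add_assoc, add_neg_cancel_left, ← lam_mul] at this
  inv_mem' {g} hg b := by
    have := T.neg_mem (hg (lam g⁻¹ b))
    rwa [lam_lam_inv, neg_add_rev, neg_neg] at this

theorem neg_zsmul_add_zpow_mem {T : AddSubgroup B} {c : B} (hn : c ∈ normalizer (T : Set B))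
    (hl : c ∈ lamStabilizer T) (hc : -c + lam c c ∈ T) (k : ℤ) : -(k • c) + c ^ k ∈ T := by
  have hlam : lam c c = c + (-c + lam c c) := (add_neg_cancel_left _ _).symm
  generalize -c + lam c c = s at hc hlam
  induction k with
  | zero => simp [one_eq_zero]
  | succ k ih =>
    have hpow : c ^ ((k : ℤ) + 1) =
        c + (k : ℤ) • (c + s) + lam c (-((k : ℤ) • c) + c ^ (k : ℤ)) := by
      rw [add_assoc, ← hlam, ← lam_zsmul, ← lam_add, add_neg_cancel_left, add_comm, zpow_one_add,
        mul_eq]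
    rw [hpow, add_comm (k : ℤ), add_zsmul, one_zsmul, neg_add_rev, ← add_assoc, add_assoc _ (-c),
      neg_add_cancel_left]
    exact T.add_mem (neg_zsmul_add_zsmul_mem hn hc k) (lam_mem_of_mem_lamStabilizer hl ih)
  | pred k ih =>
    have hl' : c⁻¹ ∈ lamStabilizer T := inv_mem hl
    have hinv : lam c⁻¹ c = c + -lam c⁻¹ s := by
      rw [eq_add_neg_iff_add_eq, ← lam_add, ← hlam, lam_inv_lam]
    have hpow : c ^ (-(k : ℤ) - 1) = (-(k : ℤ) - 1) • lam c⁻¹ c +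
        lam c⁻¹ (-(-(k : ℤ) • c) + c ^ (-(k : ℤ))) := by
      rw [sub_eq_neg_add, zpow_add, zpow_neg_one, mul_eq, add_zsmul, neg_one_zsmul,
        ← inv_eq_neg_lam, add_assoc, ← lam_zsmul, ← lam_add, add_neg_cancel_left]
    rw [hpow, ← add_assoc, hinv]
    exact T.add_mem
      (neg_zsmul_add_zsmul_mem hn (T.neg_mem (lam_mem_of_mem_lamStabilizer hl' hc)) _)
      (lam_mem_of_mem_lamStabilizer hl' ih)

theorem neg_add_lam_mem_of_mem_initSpan {T : AddSubgroup B} [T.Normal] {a : ℕ → B} {n : ℕ} {g : B}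
    (h : ∀ i < n, -a i + lam g (a i) ∈ T) {b : B} (hb : b ∈ initSpan a n) : -b + lam g b ∈ T :=
  QuotientAddGroup.eq.1 <| initSpan_le
    (H := (QuotientAddGroup.mk' T).eqLocus ((QuotientAddGroup.mk' T).comp (lamHom g)))
    (fun i hi => QuotientAddGroup.eq.2 (h i hi)) hb

end LamStabilizer

section IdealChain

open SkewBrace

variable {B : Type u} [SkewBrace B]

/-- The first `n` terms of `a` generate, one after the other, a chain of ideals of `B` whose factors
lie in the socle (`p i = 0`) or have order dividing the prime `p i`. The bound `k < p j + 2` covers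
`k = 0, 1` if `p j = 0`, and all residues modulo `p j` otherwise; it makes the condition a finite
one. -/
structure IdealChain (a : ℕ → B) (p : ℕ → ℕ) (n : ℕ) : Prop where
  lam_mem : ∀ j < n, ∀ k < p j + 2, ∀ i < n, lam (k • a j) (a i) ∈ initSpan a (i + 1)
  lam_inv_mem : ∀ j < n, ∀ k < p j + 2, ∀ i < n, lam (k • a j)⁻¹ (a i) ∈ initSpan a (i + 1)
  add_conj_mem : ∀ j < n, ∀ i < n, a j + a i - a j ∈ initSpan a (i + 1)
  neg_conj_mem : ∀ j < n, ∀ i < n, -a j + a i + a j ∈ initSpan a (i + 1)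
  star_mem : ∀ j < n, ∀ k < p j + 2, ∀ i < n, -a i + lam (k • a j) (a i) ∈ initSpan a (j + 1)
  factor : ∀ i < n, (p i = 0 ∧ ∀ j < n, -a j + lam (a i) (a j) ∈ initSpan a i ∧
    a i + a j - a i - a j ∈ initSpan a i) ∨ (p i).Prime ∧ p i • a i ∈ initSpan a i

namespace IdealChain

variable {a : ℕ → B} {p : ℕ → ℕ} {n i j k : ℕ}

theorem mem_normalizer (h : IdealChain a p n) (hi : i ≤ n) (hj : j < n) :
    a j ∈ AddSubgroup.normalizer (initSpan a i : Set B) :=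
  mem_normalizer_initSpan
    (fun l hl => initSpan_mono a hl (h.add_conj_mem j hj l (hl.trans_le hi)))
    (fun l hl => initSpan_mono a hl (h.neg_conj_mem j hj l (hl.trans_le hi)))

/-- The multiplicative subgroup generated by the small multiples of `a 0, ..., a (i - 1)`. It
coincides with `initSpan a i` for a chain of ideals, which makes the latter a sub-brace. -/
def mulSpan (a : ℕ → B) (p : ℕ → ℕ) (i : ℕ) : Subgroup B :=
  Subgroup.closure {g | ∃ j < i, ∃ k < p j + 2, g = k • a j}

theorem nsmul_mem_mulSpan (hj : j < i) (hk : k < p j + 2) : k • a j ∈ mulSpan a p i :=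
  Subgroup.subset_closure ⟨j, hj, k, hk, rfl⟩

theorem mem_mulSpan_succ : a i ∈ mulSpan a p (i + 1) := by
  simpa only [one_nsmul] using
    nsmul_mem_mulSpan (a := a) (p := p) (k := 1) i.lt_succ_self (by omega)

theorem mulSpan_le {H : Subgroup B} (hH : ∀ j < i, ∀ k < p j + 2, k • a j ∈ H) :
    mulSpan a p i ≤ H := by
  rw [mulSpan, Subgroup.closure_le]
  rintro _ ⟨j, hj, k, hk, rfl⟩
  exact hH j hj k hk

theorem mulSpan_mono {i' : ℕ} (hi : i ≤ i') : mulSpan a p i ≤ mulSpan a p i' :=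
  mulSpan_le fun _ hj _ hk => nsmul_mem_mulSpan (hj.trans_le hi) hk

theorem mulSpan_le_lamStabilizer (h : IdealChain a p n) (hi : i ≤ n) :
    mulSpan a p n ≤ lamStabilizer (initSpan a i) := by
  have hlam : ∀ j < n, ∀ k < p j + 2, initSpan a i ≤ (initSpan a i).comap (lamHom (k • a j)) :=
    fun j hj k hk => initSpan_le fun l hl =>
      initSpan_mono a hl (h.lam_mem j hj k hk l (hl.trans_le hi))
  have hinv : ∀ j < n, ∀ k < p j + 2, initSpan a i ≤ (initSpan a i).comap (lamHom (k • a j)⁻¹) :=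
    fun j hj k hk => initSpan_le fun l hl =>
      initSpan_mono a hl (h.lam_inv_mem j hj k hk l (hl.trans_le hi))
  refine mulSpan_le fun j hj k hk t => ⟨fun ht => hlam j hj k hk ht, fun ht => ?_⟩
  rw [← lam_inv_lam (k • a j) t]
  exact hinv j hj k hk ht

theorem add_mem_mulSpan (h : IdealChain a p n) (hi : i < n)
    (hle : ∀ t ∈ initSpan a i, t ∈ mulSpan a p i) {g t : B} (hg : g ∈ mulSpan a p (i + 1))
    (ht : t ∈ initSpan a i) : g + t ∈ mulSpan a p (i + 1) := by
  rw [add_eq]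
  exact mul_mem hg (mulSpan_mono i.le_succ (hle _ (lam_mem_of_mem_lamStabilizer
    (h.mulSpan_le_lamStabilizer hi.le (mulSpan_mono hi (inv_mem hg))) ht)))

theorem zsmul_mem_mulSpan (h : IdealChain a p n) (hi : i < n)
    (hle : ∀ t ∈ initSpan a i, t ∈ mulSpan a p i) (k : ℤ) : k • a i ∈ mulSpan a p (i + 1) := by
  rcases h.factor i hi with ⟨-, hsoc⟩ | ⟨hp, hpa⟩
  · have hmem := neg_zsmul_add_zpow_mem (h.mem_normalizer hi.le hi)
      (h.mulSpan_le_lamStabilizer hi.le (mulSpan_mono hi mem_mulSpan_succ)) (hsoc i hi).1 k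
    have hpow := zpow_mem (mem_mulSpan_succ (a := a) (p := p) (i := i)) k
    simpa using h.add_mem_mulSpan hi hle hpow (neg_mem hmem)
  · obtain ⟨r, hr, l, hk⟩ := exists_zsmul_eq_nsmul_add hp.ne_zero k (a i)
    rw [hk]
    exact h.add_mem_mulSpan hi hle (nsmul_mem_mulSpan i.lt_succ_self (by omega)) (zsmul_mem hpa l)

theorem mem_mulSpan_of_mem_initSpan (h : IdealChain a p n) (hi : i ≤ n) :
    ∀ t ∈ initSpan a i, t ∈ mulSpan a p i := by
  induction i with
  | zero =>
    intro t ht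
    rw [initSpan_zero, AddSubgroup.mem_bot] at ht
    rw [ht, ← one_eq_zero]
    exact one_mem _
  | succ i ih =>
    intro x hx
    obtain ⟨k, t, ht, rfl⟩ := exists_zsmul_add_of_mem_initSpan
      (h.mem_normalizer (Nat.le_of_succ_le hi) hi) hx
    have hle := ih (Nat.le_of_succ_le hi)
    exact h.add_mem_mulSpan hi hle (h.zsmul_mem_mulSpan hi hle k) ht

theorem mem_initSpan_of_mem_mulSpan (h : IdealChain a p n) {g : B} (hg : g ∈ mulSpan a p n) :
    g ∈ initSpan a n := by
  induction hg using Subgroup.closure_induction with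
  | mem _ hx =>
    obtain ⟨j, hj, k, -, rfl⟩ := hx
    exact nsmul_mem (mem_initSpan hj) k
  | one =>
    rw [one_eq_zero]
    exact zero_mem _
  | mul x y hx _ hx' hy' =>
    rw [mul_eq]
    exact add_mem hx' (lam_mem_of_mem_lamStabilizer (h.mulSpan_le_lamStabilizer le_rfl hx) hy')
  | inv x hx hx' =>
    rw [inv_eq_neg_lam]
    exact neg_mem (lam_mem_of_mem_lamStabilizer
      (h.mulSpan_le_lamStabilizer le_rfl (inv_mem hx)) hx')

theorem mem_mulSpan_iff (h : IdealChain a p n) {g : B} : g ∈ mulSpan a p n ↔ g ∈ initSpan a n :=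
  ⟨h.mem_initSpan_of_mem_mulSpan, h.mem_mulSpan_of_mem_initSpan le_rfl g⟩

theorem eval_mem (h : IdealChain a p n) {x : ℕ → B} (hx : ∀ i, x i ∈ initSpan a n) (w : BWord ℕ) :
    w.eval x ∈ initSpan a n := by
  induction w with
  | empty => exact zero_mem _
  | of i => exact hx i
  | add v w hv hw => exact add_mem hv hw
  | mul v w hv hw =>
    rw [← h.mem_mulSpan_iff] at *
    exact mul_mem hv hw
  | neg w hw => exact neg_mem hw
  | inv w hw =>
    rw [← h.mem_mulSpan_iff] at *
    exact inv_mem hw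

theorem normal_initSpan (h : IdealChain a p n) (hB : ∀ b, b ∈ initSpan a n) (hi : i ≤ n) :
    (initSpan a i).Normal := by
  have hle : initSpan a n ≤ AddSubgroup.normalizer (initSpan a i : Set B) :=
    initSpan_le fun _ hj => h.mem_normalizer hi hj
  rw [← AddSubgroup.normalizer_eq_top_iff, eq_top_iff]
  exact fun b _ => hle (hB b)

theorem mulSpan_le_lamKernel (h : IdealChain a p n) (hB : ∀ b, b ∈ initSpan a n) (hi : i ≤ n) :
    mulSpan a p i ≤ lamKernel (initSpan a i) := by
  have := h.normal_initSpan hB hi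
  exact mulSpan_le fun j hj k hk b => neg_add_lam_mem_of_mem_initSpan (fun l hl =>
    initSpan_mono a hj (h.star_mem j (hj.trans_le hi) k hk l hl)) (hB b)

/-- The ideal of the chain generated by the first `i` terms of `a`. -/
def ideal (h : IdealChain a p n) (hB : ∀ b, b ∈ initSpan a n) (hi : i ≤ n) : BraceIdeal B :=
  BraceIdeal.ofAdd (initSpan a i)
    (fun b _ ht => lam_mem_of_mem_lamStabilizer
      (h.mulSpan_le_lamStabilizer hi (h.mem_mulSpan_iff.2 (hB b))) ht)
    (fun b t ht => by
      simpa only [sub_eq_add_neg] using (h.normal_initSpan hB hi).conj_mem t ht b)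
    (fun b t ht => h.mulSpan_le_lamKernel hB hi (h.mem_mulSpan_of_mem_initSpan hi t ht) b)

theorem mem_ideal (h : IdealChain a p n) (hB : ∀ b, b ∈ initSpan a n) (hi : i ≤ n) {x : B} :
    x ∈ h.ideal hB hi ↔ x ∈ initSpan a i := Iff.rfl

theorem proj_mem_socle (h : IdealChain a p n) (hB : ∀ b, b ∈ initSpan a n) (hi : i ≤ n) {c : B}
    (hlam : ∀ j < n, -a j + lam c (a j) ∈ initSpan a i)
    (hcomm : ∀ j < n, c + a j - c - a j ∈ initSpan a i) :
    (h.ideal hB hi).proj c ∈ SkewBrace.socle (h.ideal hB hi).Quot := by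
  have := h.normal_initSpan hB hi
  exact (BraceIdeal.proj_mem_socle_iff _).2 fun b =>
    ⟨neg_add_lam_mem_of_mem_initSpan hlam (hB b), commutator_mem_of_mem_initSpan hcomm (hB b)⟩

theorem cyclicStep (h : IdealChain a p n) (hB : ∀ b, b ∈ initSpan a n) (hi : i < n) :
    (h.ideal hB hi.le).CyclicStep (h.ideal hB (i := i + 1) hi) := by
  refine ⟨fun x hx => initSpan_mono a i.le_succ hx, a i, mem_initSpan i.lt_succ_self,
    fun x hx => ?_, ?_⟩
  · obtain ⟨k, t, ht, rfl⟩ := exists_zsmul_add_of_mem_initSpan (h.mem_normalizer hi.le hi) hx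
    refine ⟨k, ?_⟩
    rw [map_add, map_zsmul, (BraceIdeal.proj_eq_zero _).2 ((h.mem_ideal hB hi.le).2 ht), add_zero]
  · rcases h.factor i hi with ⟨-, hsoc⟩ | ⟨hp, hpa⟩
    · exact Or.inl (h.proj_mem_socle hB hi.le (fun j hj => (hsoc j hj).1) fun j hj => (hsoc j hj).2)
    · refine Or.inr ⟨p i, hp, ?_⟩
      rw [← map_nsmul]
      exact (BraceIdeal.proj_eq_zero _).2 hpa

theorem quotSupersoluble_ideal (h : IdealChain a p n) (hB : ∀ b, b ∈ initSpan a n) (hi : i ≤ n) :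
    (h.ideal hB hi).QuotSupersoluble := by
  induction hi using Nat.decreasingInduction with
  | self => exact .top hB
  | of_succ i hi ih => exact .step (h.cyclicStep hB hi) ih

theorem isSupersoluble (h : IdealChain a p n) (hB : ∀ b, b ∈ initSpan a n) : IsSupersoluble B := by
  have hzero : h.ideal hB n.zero_le = BraceIdeal.zero B := by
    ext x
    rw [mem_ideal, initSpan_zero, AddSubgroup.mem_bot, BraceIdeal.mem_zero]
  rw [BraceIdeal.isSupersoluble_iff_quotSupersoluble_zero, ← hzero]
  exact h.quotSupersoluble_ideal hB n.zero_le

end IdealChain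

theorem BraceIdeal.QuotSupersoluble.exists_chain {J : BraceIdeal B} (h : J.QuotSupersoluble) :
    ∃ (n : ℕ) (I : ℕ → BraceIdeal B), I 0 = J ∧ (∀ x, x ∈ I n) ∧
      ∀ i < n, (I i).CyclicStep (I (i + 1)) := by
  induction h with
  | @top J h => exact ⟨0, fun _ => J, rfl, h, fun i hi => absurd hi i.not_lt_zero⟩
  | @step J J' h _ ih =>
    obtain ⟨n, I, rfl, hn, hI⟩ := ih
    refine ⟨n + 1, fun i => Nat.casesOn i J I, rfl, hn, fun i hi => ?_⟩
    cases i with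
    | zero => exact h
    | succ i => exact hI i (by omega)

theorem initSpan_eq_of_forall_proj_eq_zsmul {I : ℕ → BraceIdeal B} {a : ℕ → B} {n : ℕ}
    (h0 : I 0 = .zero B) (hle : ∀ i < n, I i ≤ I (i + 1)) (ha : ∀ i < n, a i ∈ I (i + 1))
    (hgen : ∀ i < n, ∀ x ∈ I (i + 1), ∃ k : ℤ, (I i).proj x = k • (I i).proj (a i)) {i : ℕ}
    (hi : i ≤ n) : initSpan a i = (I i).toAddSubgroup := by
  induction i with
  | zero =>
    rw [initSpan_zero, h0]
    rfl
  | succ i ih =>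
    specialize ih (Nat.le_of_succ_le hi)
    apply le_antisymm
    · rw [initSpan_succ, sup_le_iff, AddSubgroup.zmultiples_le, ih]
      exact ⟨ha i hi, hle i hi⟩
    · intro x hx
      obtain ⟨k, hk⟩ := hgen i hi x hx
      rw [eq_comm, ← map_zsmul, (I i).proj_eq] at hk
      have hx' := add_mem (zsmul_mem (mem_initSpan (a := a) i.lt_succ_self) k)
        (initSpan_mono a i.le_succ (ih.ge hk))
      rwa [add_neg_cancel_left] at hx'

theorem idealChain_of_ideals {I : ℕ → BraceIdeal B} {a : ℕ → B} {p : ℕ → ℕ} {n : ℕ}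
    (hI : ∀ i ≤ n, initSpan a i = (I i).toAddSubgroup)
    (hp : ∀ i < n, p i = 0 ∧ (I i).proj (a i) ∈ SkewBrace.socle (I i).Quot ∨
      (p i).Prime ∧ p i • (I i).proj (a i) = 0) : IdealChain a p n := by
  have hmem : ∀ i ≤ n, ∀ x, x ∈ initSpan a i ↔ x ∈ I i := fun i hi x => by rw [hI i hi]; rfl
  have ha : ∀ i < n, a i ∈ I (i + 1) := fun i hi => (hmem _ hi _).1 (mem_initSpan i.lt_succ_self)
  refine ⟨fun j _ k _ i hi => ?_, fun j _ k _ i hi => ?_, fun j _ i hi => ?_, fun j _ i hi => ?_,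
    fun j hj k _ i _ => ?_, fun i hi => ?_⟩
  · exact (hmem _ hi _).2 ((I (i + 1)).lam_mem' _ (ha i hi))
  · exact (hmem _ hi _).2 ((I (i + 1)).lam_mem' _ (ha i hi))
  · exact (hmem _ hi _).2 ((I (i + 1)).add_conj_mem' _ (ha i hi))
  · rw [hmem _ hi, ← sub_neg_eq_add]
    exact (I (i + 1)).add_conj_mem' _ (ha i hi)
  · exact (hmem _ hj _).2 ((I (j + 1)).star_mem ((I (j + 1)).nsmul_mem (ha j hj) k) _)
  · refine (hp i hi).imp (fun ⟨hpi, hsoc⟩ => ⟨hpi, fun j _ => ?_⟩) fun ⟨hpi, hpa⟩ => ⟨hpi, ?_⟩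
    · rw [hmem i hi.le, hmem i hi.le]
      exact (I i).proj_mem_socle_iff.1 hsoc _
    · rw [hmem i hi.le, ← BraceIdeal.proj_eq_zero, map_nsmul, hpa]

theorem SkewBrace.IsSupersoluble.exists_idealChain (h : IsSupersoluble B) :
    ∃ (a : ℕ → B) (p : ℕ → ℕ) (n : ℕ), IdealChain a p n ∧ (∀ b, b ∈ initSpan a n) ∧
      ∀ i, n ≤ i → a i = 0 ∧ p i = 0 := by
  rw [BraceIdeal.isSupersoluble_iff_quotSupersoluble_zero] at h
  obtain ⟨n, I, h0, hn, hI⟩ := h.exists_chain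
  have hgen : ∀ i, ∃ (c : B) (p : ℕ), (n ≤ i → c = 0 ∧ p = 0) ∧ (i < n → c ∈ I (i + 1) ∧
      (∀ x ∈ I (i + 1), ∃ k : ℤ, (I i).proj x = k • (I i).proj c) ∧
      (p = 0 ∧ (I i).proj c ∈ SkewBrace.socle (I i).Quot ∨ p.Prime ∧ p • (I i).proj c = 0)) := by
    intro i
    by_cases hi : i < n
    · obtain ⟨-, c, hc, hgen, h | ⟨p, hp, h⟩⟩ := hI i hi
      · exact ⟨c, 0, fun h => absurd hi h.not_gt, fun _ => ⟨hc, hgen, .inl ⟨rfl, h⟩⟩⟩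
      · exact ⟨c, p, fun h => absurd hi h.not_gt, fun _ => ⟨hc, hgen, .inr ⟨hp, h⟩⟩⟩
    · exact ⟨0, 0, fun _ => ⟨rfl, rfl⟩, fun h => absurd h hi⟩
  choose a p hap0 hap using hgen
  have hspan : ∀ i ≤ n, initSpan a i = (I i).toAddSubgroup := fun i hi =>
    initSpan_eq_of_forall_proj_eq_zsmul h0 (fun i hi => (hI i hi).1) (fun i hi => (hap i hi).1)
      (fun i hi => (hap i hi).2.1) hi
  exact ⟨a, p, n, idealChain_of_ideals hspan fun i hi => (hap i hi).2.2,
    fun b => (hspan n le_rfl).ge (hn b), hap0⟩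

end IdealChain

/-! ### Certificates of supersolubility -/

theorem getD_ofFn {α : Type*} {f : ℕ → α} {n : ℕ} {d : α} (h : ∀ i, n ≤ i → f i = d) (i : ℕ) :
    (List.ofFn fun i : Fin n => f i).getD i d = f i := by
  rcases lt_or_ge i n with hi | hi
  · simp [List.getD_eq_getElem?_getD, hi]
  · rw [List.getD_eq_default _ _ (by simpa using hi), h i hi]

namespace BWord

open FiniteBracePresentation

/-- The sum of the words `± A[j]` listed in `c`. -/
def comb (A : List (BWord ℕ)) (c : List (ℕ × ℕ)) : BWord ℕ :=
  c.foldr (fun e w => add (bif e.1 == 0 then A.getD e.2 empty else neg (A.getD e.2 empty)) w) empty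

/-- The `k`-th multiple of a word. -/
def nmul (k : ℕ) (w : BWord ℕ) : BWord ℕ := k.rec empty fun _ v => add v w

/-- The word for `λ_v(w)`. -/
def lamW (v w : BWord ℕ) : BWord ℕ := add (neg v) (mul v w)

section Primrec

variable {α : Type*} [Primcodable α]

@[fun_prop]
theorem primrec_comb {f : α → List (BWord ℕ)} {g : α → List (ℕ × ℕ)} (hf : Primrec f)
    (hg : Primrec g) : Primrec fun a => comb (f a) (g a) :=
  primrec_foldr hg (by fun_prop) (by fun_prop)

@[fun_prop]
theorem primrec_nmul {f : α → ℕ} {g : α → BWord ℕ} (hf : Primrec f) (hg : Primrec g) :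
    Primrec fun a => nmul (f a) (g a) :=
  Primrec.nat_rec' (h := fun a s => add s.2 (g a)) hf (by fun_prop)
    (show Primrec fun s : α × ℕ × BWord ℕ => add s.2.2 (g s.1) by fun_prop)

@[fun_prop]
theorem primrec_lamW {f g : α → BWord ℕ} (hf : Primrec f) (hg : Primrec g) :
    Primrec fun a => lamW (f a) (g a) := by
  unfold lamW
  fun_prop

end Primrec

section Eval

variable {B : Type u} [SkewBrace B] (x : ℕ → B)

theorem eval_nmul (k : ℕ) (w : BWord ℕ) : (nmul k w).eval x = k • w.eval x := by
  induction k with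
  | zero => rw [zero_nsmul]; rfl
  | succ k ih => rw [succ_nsmul, ← ih]; rfl

theorem eval_lamW (v w : BWord ℕ) : (lamW v w).eval x = SkewBrace.lam (v.eval x) (w.eval x) := rfl

theorem exists_comb_of_mem_closure {A : List (BWord ℕ)} {b : B}
    (hb : b ∈ AddSubgroup.closure (Set.range fun j => (A.getD j empty).eval x)) :
    ∃ c, (comb A c).eval x = b := by
  rw [← AddSubgroup.mem_toAddSubmonoid, AddSubgroup.closure_toAddSubmonoid] at hb
  obtain ⟨l, hl, rfl⟩ := AddSubmonoid.exists_list_of_mem_closure hb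
  clear hb
  induction l with
  | nil => exact ⟨[], rfl⟩
  | cons y l ih =>
    obtain ⟨c, hc⟩ := ih fun z hz => hl z (List.mem_cons_of_mem y hz)
    rw [List.sum_cons, ← hc]
    rcases hl y List.mem_cons_self with ⟨j, rfl⟩ | ⟨j, hj⟩
    · exact ⟨(0, j) :: c, rfl⟩
    · exact ⟨(1, j) :: c, congrArg (· + _) (neg_eq_iff_eq_neg.2 hj)⟩

theorem eval_comb_mem_closure (A : List (BWord ℕ)) (c : List (ℕ × ℕ)) :
    (comb A c).eval x ∈ AddSubgroup.closure (Set.range fun j => (A.getD j empty).eval x) := by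
  induction c with
  | nil => exact zero_mem _
  | cons e c ih =>
    refine add_mem ?_ ih
    have hmem : (A.getD e.2 empty).eval x ∈
        AddSubgroup.closure (Set.range fun j => (A.getD j empty).eval x) :=
      AddSubgroup.subset_closure ⟨e.2, rfl⟩
    cases e.1 == 0
    · exact neg_mem hmem
    · exact hmem

theorem closure_range_getD_take (A : List (BWord ℕ)) (i : ℕ) :
    AddSubgroup.closure (Set.range fun j => ((A.take i).getD j empty).eval x) =
      initSpan (fun j => (A.getD j empty).eval x) i := by
  apply le_antisymm
  · rw [AddSubgroup.closure_le]
    rintro _ ⟨j, rfl⟩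
    rcases lt_or_ge j i with h | h
    · simpa [List.getD_eq_getElem?_getD, List.getElem?_take_of_lt h] using
        mem_initSpan (a := fun j => (A.getD j empty).eval x) h
    · beta_reduce
      rw [List.getD_eq_default]
      · exact zero_mem _
      · exact (List.length_take_le _ _).trans h
  · refine initSpan_le fun j hj => AddSubgroup.subset_closure ⟨j, ?_⟩
    simp [List.getD_eq_getElem?_getD, List.getElem?_take_of_lt hj]

end Eval

/-- In the brace with code `P`, the word `w` represents an element of the additive subgroup
generated by the list `A`. -/
def InSpan (P : ℕ × List (BWord ℕ)) (A : List (BWord ℕ)) (w : BWord ℕ) : Prop :=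
  ∃ c, Deriv P (comb A c) w

theorem semidecidable_inSpan {α : Type*} [Primcodable α] {f : α → ℕ × List (BWord ℕ)}
    {g : α → List (BWord ℕ)} {h : α → BWord ℕ} (hf : Primrec f) (hg : Primrec g)
    (hh : Primrec h) : Semidecidable fun a => InSpan (f a) (g a) (h a) :=
  .exists_right (semidecidable_deriv.comp
    (f := fun s : α × List (ℕ × ℕ) => (f s.1, comb (g s.1) s.2, h s.1)) (by fun_prop))

theorem inSpan_iff {P : FiniteBracePresentation} {B : Type u} [SkewBrace B]
    {θ : BraceHom (FreeBrace (Fin P.n)) B} (hθ : P.IsPresentation θ) (A : List (BWord ℕ)) (i : ℕ)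
    (w : BWord ℕ) : InSpan P.code (A.take i) w ↔ w.eval (genOf θ) ∈
      initSpan (fun j => (A.getD j empty).eval (genOf θ)) i := by
  rw [← closure_range_getD_take, InSpan]
  simp only [hθ.deriv_iff]
  refine ⟨?_, exists_comb_of_mem_closure _⟩
  rintro ⟨c, hc⟩
  rw [← hc]
  exact eval_comb_mem_closure _ _ _

/-- The condition that the values of the words `A` form an `IdealChain` with exponents `p` which
exhausts the brace with code `P`, in terms of derivable equations between words. -/
def SupersolubilityCertificate (P : ℕ × List (BWord ℕ)) (A : List (BWord ℕ)) (p : List ℕ) : Prop :=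
  (∀ j < A.length, ∀ k < p.getD j 0 + 2, ∀ i < A.length,
    InSpan P (A.take (i + 1)) (lamW (nmul k (A.getD j empty)) (A.getD i empty)) ∧
    InSpan P (A.take (i + 1)) (lamW (inv (nmul k (A.getD j empty))) (A.getD i empty)) ∧
    InSpan P (A.take (i + 1))
      (add (add (A.getD j empty) (A.getD i empty)) (neg (A.getD j empty))) ∧
    InSpan P (A.take (i + 1))
      (add (add (neg (A.getD j empty)) (A.getD i empty)) (A.getD j empty)) ∧
    InSpan P (A.take (j + 1))
      (add (neg (A.getD i empty)) (lamW (nmul k (A.getD j empty)) (A.getD i empty)))) ∧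
  (∀ i < A.length, (p.getD i 0 = 0 ∧ ∀ j < A.length,
      InSpan P (A.take i) (add (neg (A.getD j empty)) (lamW (A.getD i empty) (A.getD j empty))) ∧
      InSpan P (A.take i) (add (add (add (A.getD i empty) (A.getD j empty))
        (neg (A.getD i empty))) (neg (A.getD j empty)))) ∨
    (p.getD i 0).Prime ∧ InSpan P (A.take i) (nmul (p.getD i 0) (A.getD i empty))) ∧
  ∀ s < P.1, InSpan P (A.take A.length) (of s)

theorem semidecidable_supersolubilityCertificate :
    Semidecidable fun P : ℕ × List (BWord ℕ) => ∃ A p, SupersolubilityCertificate P A p := by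
  refine .exists_right (.exists_right (.and ?_ (.and ?_ ?_)))
  · refine .forall_lt (by fun_prop) (.forall_lt (by fun_prop) (.forall_lt (by fun_prop) ?_))
    refine .and ?_ (.and ?_ (.and ?_ (.and ?_ ?_))) <;>
    exact semidecidable_inSpan (by fun_prop) (by fun_prop) (by fun_prop)
  · refine .forall_lt (by fun_prop) (.or (.and (.eq (by fun_prop) (by fun_prop))
      (.forall_lt (by fun_prop) (.and ?_ ?_))) (.and (semidecidable_prime.comp (by fun_prop)) ?_))
    all_goals exact semidecidable_inSpan (by fun_prop) (by fun_prop) (by fun_prop)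
  · exact .forall_lt (by fun_prop)
      (semidecidable_inSpan (by fun_prop) (by fun_prop) (by fun_prop))

section Correctness

variable {P : FiniteBracePresentation} {B : Type u} [SkewBrace B]
  {θ : BraceHom (FreeBrace (Fin P.n)) B}

theorem supersolubilityCertificate_iff (hθ : P.IsPresentation θ) (A : List (BWord ℕ))
    (p : List ℕ) : SupersolubilityCertificate P.code A p ↔
      IdealChain (fun j => (A.getD j empty).eval (genOf θ)) (fun j => p.getD j 0) A.length ∧
      ∀ b : B, b ∈ initSpan (fun j => (A.getD j empty).eval (genOf θ)) A.length := by
  simp only [SupersolubilityCertificate, inSpan_iff hθ, eval_lamW, eval, eval_nmul,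
    ← sub_eq_add_neg]
  constructor
  · rintro ⟨hpair, hfactor, hgen⟩
    have h : IdealChain (fun j => (A.getD j empty).eval (genOf θ)) (fun j => p.getD j 0)
        A.length :=
      ⟨fun j hj k hk i hi => (hpair j hj k hk i hi).1,
        fun j hj k hk i hi => (hpair j hj k hk i hi).2.1,
        fun j hj i hi => (hpair j hj 0 (by omega) i hi).2.2.1,
        fun j hj i hi => (hpair j hj 0 (by omega) i hi).2.2.2.1,
        fun j hj k hk i hi => (hpair j hj k hk i hi).2.2.2.2, hfactor⟩
    refine ⟨h, fun b => ?_⟩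
    obtain ⟨w, rfl⟩ := hθ.exists_eval b
    refine h.eval_mem (fun i => ?_) w
    rcases lt_or_ge i P.n with hi | hi
    · exact hgen i hi
    · rw [genOf_of_le hi]
      exact zero_mem _
  · rintro ⟨h, hB⟩
    exact ⟨fun j hj k hk i hi => ⟨h.lam_mem j hj k hk i hi, h.lam_inv_mem j hj k hk i hi,
      h.add_conj_mem j hj i hi, h.neg_conj_mem j hj i hi, h.star_mem j hj k hk i hi⟩, h.factor,
      fun s _ => hB _⟩

theorem exists_supersolubilityCertificate_iff (hθ : P.IsPresentation θ) :
    (∃ A p, SupersolubilityCertificate P.code A p) ↔ SkewBrace.IsSupersoluble B := by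
  simp only [supersolubilityCertificate_iff hθ]
  constructor
  · rintro ⟨A, p, h, hB⟩
    exact h.isSupersoluble hB
  · intro hB
    obtain ⟨a, p, n, h, hspan, h0⟩ := hB.exists_idealChain
    have hw : ∀ i, ∃ w : BWord ℕ, w.eval (genOf θ) = a i ∧ (n ≤ i → w = empty) := fun i => by
      rcases lt_or_ge i n with hi | hi
      · obtain ⟨w, hw⟩ := hθ.exists_eval (a i)
        exact ⟨w, hw, fun h => absurd hi h.not_gt⟩
      · exact ⟨empty, (h0 i hi).1.symm, fun _ => rfl⟩
    choose w hw hw0 using hw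
    refine ⟨List.ofFn fun i : Fin n => w i, List.ofFn fun i : Fin n => p i, ?_⟩
    simp only [getD_ofFn hw0, getD_ofFn fun i hi => (h0 i hi).2, hw, List.length_ofFn]
    exact ⟨h, hspan⟩

end Correctness

end BWord

/-! ### Finite skew braces given by operation tables -/

section PrimeOrder

theorem exists_prime_nsmul_eq_zero_iff {G : Type*} [AddGroup G] {a : G} (ha : a ≠ 0) :
    (∃ p : ℕ, p.Prime ∧ p • a = 0) ↔ ∀ k : ℕ, k • a ≠ 0 → a ∈ AddSubgroup.zmultiples (k • a) := by
  simp only [mem_zmultiples_nsmul_iff, ne_eq, ← addOrderOf_dvd_iff_nsmul_eq_zero]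
  have h1 : addOrderOf a ≠ 1 := mt AddMonoid.addOrderOf_eq_one_iff.1 ha
  constructor
  · rintro ⟨p, hp, hpa⟩ k hk
    rw [((Nat.dvd_prime hp).1 hpa).resolve_left h1] at hk ⊢
    exact ((hp.coprime_iff_not_dvd).2 hk).symm
  · intro h
    have hp := Nat.minFac_prime h1
    refine ⟨_, hp, by_contra fun hdvd => hp.one_lt.ne' ?_⟩
    rw [← Nat.gcd_eq_left (Nat.minFac_dvd (addOrderOf a))]
    exact h _ hdvd

theorem mem_zmultiples_iff_exists_nsmul_lt {G : Type*} [AddGroup G] [Finite G] {a b : G} {N : ℕ}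
    (hN : Nat.card G ≤ N) : b ∈ AddSubgroup.zmultiples a ↔ ∃ k < N, k • a = b := by
  classical
  constructor
  · intro h
    rw [mem_zmultiples_iff_mem_range_addOrderOf, Finset.mem_image] at h
    obtain ⟨k, hk, h⟩ := h
    exact ⟨k, (Finset.mem_range.1 hk).trans_le (addOrderOf_le_card.trans hN), h⟩
  · rintro ⟨k, -, rfl⟩
    exact AddSubgroup.nsmul_mem_zmultiples _ _

open SkewBrace

theorem not_hasIdealOfPrimeOrder_iff {Q : Type u} [SkewBrace Q] [Finite Q] {N : ℕ}
    (hN : Nat.card Q ≤ N) : ¬ HasIdealOfPrimeOrder Q ↔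
      ∀ a : Q, a = 0 ∨ (∃ k : ℕ, k • a ≠ 0 ∧ ∀ j < N, j • k • a ≠ a) ∨
        ∃ (b : Q) (t : ℕ), (∀ k < N, k • a ≠ lam b (t • a)) ∨
          (∀ k < N, k • a ≠ b + t • a + -b) ∨ ∀ k < N, k • a ≠ -b + lam (t • a) b := by
  have notMem (a b : Q) : (∀ k < N, k • a ≠ b) ↔ b ∉ AddSubgroup.zmultiples a := by
    rw [mem_zmultiples_iff_exists_nsmul_lt hN]
    push Not
    rfl
  simp only [notMem, ← sub_eq_add_neg, hasIdealOfPrimeOrder_iff, not_exists]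
  refine forall_congr' fun a => ?_
  by_cases ha : a = 0
  · simp only [ha, ne_eq, not_true_eq_false, false_and, not_false_eq_true, true_or]
  rw [exists_prime_nsmul_eq_zero_iff ha]
  constructor
  · intro h
    by_contra! h'
    refine h ⟨ha, h'.2.1, ?_⟩
    intro t ht b
    obtain ⟨k, -, rfl⟩ := (mem_zmultiples_iff_exists_nsmul_lt hN).1 ht
    exact h'.2.2 b k
  · rintro (h | ⟨k, hk, h⟩ | ⟨b, t, h⟩) ⟨-, hord, hideal⟩
    · exact ha h
    · exact h (hord k hk)
    · obtain ⟨hlam, hconj, hstar⟩ := hideal _ (AddSubgroup.nsmul_mem_zmultiples a t) b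
      tauto

end PrimeOrder

/-- Operation tables on the set of numbers `≤ D.1`: the lists hold the sums and products (indexed by
`Nat.pair`), the negatives, the inverses, and some elements. Entries are read modulo `D.1 + 1`, and
missing ones as `0`, so that every list makes sense as a table. -/
abbrev Table : Type := ℕ × List ℕ × List ℕ × List ℕ × List ℕ × List ℕ

namespace Table

open Encodable Denumerable

variable (D : Table)

/-- Addition according to the table. -/
def add (a b : ℕ) : ℕ := D.2.1.getD (Nat.pair a b) 0 % (D.1 + 1)

/-- Multiplication according to the table. -/
def mul (a b : ℕ) : ℕ := D.2.2.1.getD (Nat.pair a b) 0 % (D.1 + 1)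

/-- Negatives according to the table. -/
def neg (a : ℕ) : ℕ := D.2.2.2.1.getD a 0 % (D.1 + 1)

/-- Inverses according to the table. -/
def inv (a : ℕ) : ℕ := D.2.2.2.2.1.getD a 0 % (D.1 + 1)

/-- The first `n` listed elements, followed by zeros. -/
def elem (n i : ℕ) : ℕ := (D.2.2.2.2.2.take n).getD i 0 % (D.1 + 1)

/-- The map `λ` according to the table. -/
def lam (a b : ℕ) : ℕ := D.add (D.neg a) (D.mul a b)

/-- Multiples according to the table. -/
def nsmul (k a : ℕ) : ℕ := k.rec 0 fun _ b => D.add b a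

section Primrec

variable {α : Type*} [Primcodable α] {d : α → Table} {f g : α → ℕ}

@[fun_prop]
theorem primrec_add (hd : Primrec d) (hf : Primrec f) (hg : Primrec g) :
    Primrec fun a => (d a).add (f a) (g a) := by
  unfold add
  fun_prop

@[fun_prop]
theorem primrec_mul (hd : Primrec d) (hf : Primrec f) (hg : Primrec g) :
    Primrec fun a => (d a).mul (f a) (g a) := by
  unfold mul
  fun_prop

@[fun_prop]
theorem primrec_neg (hd : Primrec d) (hf : Primrec f) : Primrec fun a => (d a).neg (f a) := by
  unfold neg
  fun_prop

@[fun_prop]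
theorem primrec_inv (hd : Primrec d) (hf : Primrec f) : Primrec fun a => (d a).inv (f a) := by
  unfold inv
  fun_prop

@[fun_prop]
theorem primrec_elem (hd : Primrec d) (hf : Primrec f) (hg : Primrec g) :
    Primrec fun a => (d a).elem (f a) (g a) := by
  unfold elem
  fun_prop

@[fun_prop]
theorem primrec_lam (hd : Primrec d) (hf : Primrec f) (hg : Primrec g) :
    Primrec fun a => (d a).lam (f a) (g a) := by
  unfold lam
  fun_prop

@[fun_prop]
theorem primrec_nsmul (hd : Primrec d) (hf : Primrec f) (hg : Primrec g) :
    Primrec fun a => (d a).nsmul (f a) (g a) :=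
  Primrec.nat_rec' (h := fun a s => (d a).add s.2 (g a)) hf (by fun_prop)
    (show Primrec fun s : α × ℕ × ℕ => (d s.1).add s.2.2 (g s.1) by fun_prop)

end Primrec

/-- The tables define a skew brace with zero element `0`. -/
def IsBrace : Prop :=
  ∀ a < D.1 + 1, ∀ b < D.1 + 1, ∀ c < D.1 + 1,
    D.add (D.add a b) c = D.add a (D.add b c) ∧ D.add 0 a = a ∧ D.add (D.neg a) a = 0 ∧
    D.mul (D.mul a b) c = D.mul a (D.mul b c) ∧ D.mul 0 a = a ∧ D.mul (D.inv a) a = 0 ∧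
    D.mul a (D.add b c) = D.add (D.add (D.mul a b) (D.neg a)) (D.mul a c)

theorem semidecidable_isBrace : Semidecidable IsBrace := by
  refine .forall_lt (by fun_prop) (.forall_lt (by fun_prop) (.forall_lt (by fun_prop) ?_))
  refine .and ?_ (.and ?_ (.and ?_ (.and ?_ (.and ?_ (.and ?_ ?_)))))
  all_goals exact .eq (by fun_prop) (by fun_prop)

/-- The rules for the evaluation of `b`-words at the first `s.1` elements listed in the
table `s.2`. A rule with number `t.1 ≥ 5` repeats the law that the empty word has value `0`. -/
def valStep (s : ℕ × Table) (t : ℕ × ℕ) (p q : BWord ℕ × ℕ) : BWord ℕ × ℕ :=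
  [(.of t.2, s.2.elem s.1 t.2), (.add p.1 q.1, s.2.add p.2 q.2), (.mul p.1 q.1, s.2.mul p.2 q.2),
    (.neg p.1, s.2.neg p.2), (.inv p.1, s.2.inv p.2)].getD t.1 (.empty, 0)

/-- The word `w` has value `a` at the first `s.1` elements listed in the table `s.2`. -/
def Val (s : ℕ × Table) (w : BWord ℕ) (a : ℕ) : Prop :=
  StepClosure (fun _ => (.empty, 0)) (fun s t => valStep s (ofNat _ t)) s (w, a)

theorem semidecidable_val {α : Type*} [Primcodable α] {f : α → ℕ × Table} {g : α → BWord ℕ}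
    {h : α → ℕ} (hf : Primrec f) (hg : Primrec g) (hh : Primrec h) :
    Semidecidable fun a => Val (f a) (g a) (h a) := by
  have hv : Semidecidable fun s : (ℕ × Table) × BWord ℕ × ℕ => Val s.1 s.2.1 s.2.2 := by
    refine semidecidable_stepClosure (by fun_prop) ?_
    unfold valStep
    fun_prop
  exact hv.comp (f := fun a => (f a, g a, h a)) (by fun_prop)

theorem Val.rule {s : ℕ × Table} (t : ℕ × ℕ) {v w : BWord ℕ} {a b : ℕ} (hv : Val s v a)
    (hw : Val s w b) : Val s (valStep s t (v, a) (w, b)).1 (valStep s t (v, a) (w, b)).2 := by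
  have h := StepClosure.step (encode t) hv hw
  rwa [ofNat_encode] at h

/-- If the tables describe a skew brace, then it is an obstruction to the supersolubility of the
brace with code `P`: a nonzero quotient without ideals of prime order. -/
def IsObstruction (P : ℕ × List (BWord ℕ)) : Prop :=
  0 < D.1 ∧ (∀ i < P.2.length, Val (P.1, D) (P.2.getD i .empty) 0) ∧
  (∀ a < D.1 + 1, ∃ w, Val (P.1, D) w a) ∧
  ∀ a < D.1 + 1, a = 0 ∨
    (∃ k, D.nsmul k a ≠ 0 ∧ ∀ j < D.1 + 1, D.nsmul j (D.nsmul k a) ≠ a) ∨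
    ∃ b, b < D.1 + 1 ∧ ∃ t, (∀ k < D.1 + 1, D.nsmul k a ≠ D.lam b (D.nsmul t a)) ∨
      (∀ k < D.1 + 1, D.nsmul k a ≠ D.add (D.add b (D.nsmul t a)) (D.neg b)) ∨
      ∀ k < D.1 + 1, D.nsmul k a ≠ D.add (D.neg b) (D.lam (D.nsmul t a) b)

theorem semidecidable_exists_isObstruction :
    Semidecidable fun P : ℕ × List (BWord ℕ) => ∃ D : Table, D.IsBrace ∧ D.IsObstruction P := by
  refine .exists_right
    (.and (semidecidable_isBrace.comp (by fun_prop)) (.and ?_ (.and ?_ (.and ?_ ?_))))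
  · exact .lt (by fun_prop) (by fun_prop)
  · exact .forall_lt (by fun_prop) (semidecidable_val (by fun_prop) (by fun_prop) (by fun_prop))
  · exact .forall_lt (by fun_prop)
      (.exists_right (semidecidable_val (by fun_prop) (by fun_prop) (by fun_prop)))
  · refine .forall_lt (by fun_prop) (.or (.eq (by fun_prop) (by fun_prop)) (.or ?_ ?_))
    · exact .exists_right (.and (.ne (by fun_prop) (by fun_prop))
        (.forall_lt (by fun_prop) (.ne (by fun_prop) (by fun_prop))))
    · refine .exists_right (.and (.lt (by fun_prop) (by fun_prop))
        (.exists_right (.or ?_ (.or ?_ ?_)))) <;>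
      exact .forall_lt (by fun_prop) (.ne (by fun_prop) (by fun_prop))

/-- The map `e` identifies the skew brace `Q` with the tables. -/
structure Represents (Q : Type u) [SkewBrace Q] (e : Q → ℕ) : Prop where
  inj : Function.Injective e
  lt : ∀ x, e x < D.1 + 1
  surj : ∀ a < D.1 + 1, ∃ x, e x = a
  map_zero : e 0 = 0
  map_add : ∀ x y, e (x + y) = D.add (e x) (e y)
  map_mul : ∀ x y, e (x * y) = D.mul (e x) (e y)
  map_neg : ∀ x, e (-x) = D.neg (e x)
  map_inv : ∀ x, e x⁻¹ = D.inv (e x)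

namespace Represents

variable {D} {Q : Type u} [SkewBrace Q] {e : Q → ℕ}

theorem forall_lt (h : D.Represents Q e) {p : ℕ → Prop} :
    (∀ a < D.1 + 1, p a) ↔ ∀ x, p (e x) := by
  refine ⟨fun hp x => hp _ (h.lt x), fun hp a ha => ?_⟩
  obtain ⟨x, rfl⟩ := h.surj a ha
  exact hp x

theorem exists_lt (h : D.Represents Q e) {p : ℕ → Prop} :
    (∃ a, a < D.1 + 1 ∧ p a) ↔ ∃ x, p (e x) := by
  constructor
  · rintro ⟨a, ha, hp⟩
    obtain ⟨x, rfl⟩ := h.surj a ha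
    exact ⟨x, hp⟩
  · rintro ⟨x, hx⟩
    exact ⟨_, h.lt x, hx⟩

theorem map_nsmul (h : D.Represents Q e) (k : ℕ) (x : Q) : e (k • x) = D.nsmul k (e x) := by
  induction k with
  | zero => rw [zero_nsmul, h.map_zero]; rfl
  | succ k ih => rw [succ_nsmul, h.map_add, ih]; rfl

theorem map_lam (h : D.Represents Q e) (x y : Q) : e (SkewBrace.lam x y) = D.lam (e x) (e y) := by
  rw [SkewBrace.lam, h.map_add, h.map_neg, h.map_mul]
  rfl

theorem bijective (h : D.Represents Q e) :
    Function.Bijective fun x => (⟨e x, h.lt x⟩ : Fin (D.1 + 1)) :=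
  ⟨fun _ _ hxy => h.inj (Fin.ext_iff.1 hxy), fun ⟨a, ha⟩ => by
    obtain ⟨x, rfl⟩ := h.surj a ha
    exact ⟨x, rfl⟩⟩

theorem finite (h : D.Represents Q e) : Finite Q := Finite.of_injective _ h.bijective.1

theorem card_eq (h : D.Represents Q e) : Nat.card Q = D.1 + 1 := by
  rw [Nat.card_eq_of_bijective _ h.bijective, Nat.card_fin]

theorem isBrace (h : D.Represents Q e) : D.IsBrace := by
  simp only [IsBrace, h.forall_lt, ← h.map_zero, ← h.map_add, ← h.map_mul, ← h.map_neg,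
    ← h.map_inv, h.inj.eq_iff]
  refine fun x y z => ⟨add_assoc _ _ _, zero_add _, neg_add_cancel _, mul_assoc _ _ _, ?_, ?_, ?_⟩
  · rw [← SkewBrace.one_eq_zero, one_mul]
  · rw [← SkewBrace.one_eq_zero, inv_mul_cancel]
  · rw [SkewBrace.mul_add_eq, sub_eq_add_neg]

section Val

variable {n : ℕ} {x : ℕ → Q} {w : BWord ℕ} {a : ℕ}

theorem map_eval_of_val (h : D.Represents Q e) (hx : ∀ i, e (x i) = D.elem n i)
    (hw : Val (n, D) w a) : e (w.eval x) = a := by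
  suffices hs : ∀ s : BWord ℕ × ℕ,
      StepClosure (fun _ => (.empty, 0)) (fun s t => valStep s (ofNat _ t)) (n, D) s →
      e (s.1.eval x) = s.2 from hs _ hw
  intro s hs
  induction hs with
  | base => exact h.map_zero
  | @step t p q _ _ ih ih' =>
    obtain ⟨r, i⟩ := ofNat (ℕ × ℕ) t
    rcases Nat.lt_or_ge r 5 with hr | hr
    · interval_cases r
      · exact hx i
      · exact (h.map_add _ _).trans (congrArg₂ D.add ih ih')
      · exact (h.map_mul _ _).trans (congrArg₂ D.mul ih ih')
      · exact (h.map_neg _).trans (congrArg D.neg ih)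
      · exact (h.map_inv _).trans (congrArg D.inv ih)
    · rw [valStep, List.getD_eq_default _ _ hr]
      exact h.map_zero

theorem val_map_eval (h : D.Represents Q e) (hx : ∀ i, e (x i) = D.elem n i) :
    Val (n, D) w (e (w.eval x)) := by
  have val_empty : Val (n, D) .empty 0 := StepClosure.base
  induction w with
  | empty => rw [BWord.eval, h.map_zero]; exact val_empty
  | of i => rw [BWord.eval, hx]; exact .rule (0, i) val_empty val_empty
  | add v w hv hw => rw [BWord.eval, h.map_add]; exact .rule (1, 0) hv hw
  | mul v w hv hw => rw [BWord.eval, h.map_mul]; exact .rule (2, 0) hv hw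
  | neg w hw => rw [BWord.eval, h.map_neg]; exact .rule (3, 0) hw val_empty
  | inv w hw => rw [BWord.eval, h.map_inv]; exact .rule (4, 0) hw val_empty

theorem val_iff (h : D.Represents Q e) (hx : ∀ i, e (x i) = D.elem n i) :
    Val (n, D) w a ↔ e (w.eval x) = a :=
  ⟨h.map_eval_of_val hx, fun ha => ha ▸ h.val_map_eval hx⟩

end Val

theorem isObstruction_iff (h : D.Represents Q e) {P : ℕ × List (BWord ℕ)} {x : ℕ → Q}
    (hx : ∀ i, e (x i) = D.elem P.1 i) :
    D.IsObstruction P ↔ Nontrivial Q ∧ (∀ w ∈ P.2, w.eval x = 0) ∧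
      (∀ y, ∃ w : BWord ℕ, w.eval x = y) ∧ ¬ HasIdealOfPrimeOrder Q := by
  have := h.finite
  have map_eq_zero (y : Q) : e y = 0 ↔ y = 0 := by rw [← h.map_zero, h.inj.eq_iff]
  rw [IsObstruction, not_hasIdealOfPrimeOrder_iff h.card_eq.le]
  refine and_congr ?_ (and_congr ?_ (and_congr ?_ ?_))
  · rw [← Finite.one_lt_card_iff_nontrivial, h.card_eq, Nat.lt_add_left_iff_pos]
  · simp only [h.val_iff hx, map_eq_zero]
    rw [List.forall_mem_iff_getElem]
    refine forall₂_congr fun i hi => ?_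
    rw [List.getD_eq_getElem _ _ hi]
  · simp only [h.forall_lt, h.val_iff hx, h.inj.eq_iff]
  · rw [h.forall_lt]
    simp only [h.exists_lt, ← h.map_nsmul, ← h.map_lam, ← h.map_neg, ← h.map_add, ne_eq,
      map_eq_zero, h.inj.eq_iff]

end Represents

/-- The set of numbers on which the tables operate: a type of its own, because `Fin (D.1 + 1)`
carries modular arithmetic. -/
def Carrier : Type := {a : ℕ // a < D.1 + 1}

namespace Carrier

variable {D}

/-- The residue of a number. -/
def ofMod (D : Table) (a : ℕ) : D.Carrier := ⟨a % (D.1 + 1), Nat.mod_lt _ (Nat.succ_pos _)⟩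

instance : Add D.Carrier := ⟨fun a b => ofMod D (D.2.1.getD (Nat.pair a.1 b.1) 0)⟩
instance : Mul D.Carrier := ⟨fun a b => ofMod D (D.2.2.1.getD (Nat.pair a.1 b.1) 0)⟩
instance : Neg D.Carrier := ⟨fun a => ofMod D (D.2.2.2.1.getD a.1 0)⟩
instance : Inv D.Carrier := ⟨fun a => ofMod D (D.2.2.2.2.1.getD a.1 0)⟩
instance : Zero D.Carrier := ⟨⟨0, Nat.succ_pos _⟩⟩
instance : One D.Carrier := ⟨⟨0, Nat.succ_pos _⟩⟩

/-- The skew brace defined by tables. -/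
@[reducible]
def skewBrace (h : D.IsBrace) : SkewBrace D.Carrier where
  toAddGroup := AddGroup.ofLeftAxioms
    (fun a b c => Subtype.ext (h _ a.2 _ b.2 _ c.2).1)
    (fun a => Subtype.ext (h _ a.2 _ a.2 _ a.2).2.1)
    (fun a => Subtype.ext (h _ a.2 _ a.2 _ a.2).2.2.1)
  toGroup := Group.ofLeftAxioms
    (fun a b c => Subtype.ext (h _ a.2 _ b.2 _ c.2).2.2.2.1)
    (fun a => Subtype.ext (h _ a.2 _ a.2 _ a.2).2.2.2.2.1)
    (fun a => Subtype.ext (h _ a.2 _ a.2 _ a.2).2.2.2.2.2.1)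
  mul_add_eq a b c := Subtype.ext (h _ a.2 _ b.2 _ c.2).2.2.2.2.2.2

theorem represents (h : D.IsBrace) :
    letI := skewBrace h
    D.Represents D.Carrier Subtype.val :=
  letI := skewBrace h
  { inj := Subtype.val_injective
    lt := Subtype.property
    surj := fun a ha => ⟨⟨a, ha⟩, rfl⟩
    map_zero := rfl
    map_add := fun _ _ => rfl
    map_mul := fun _ _ => rfl
    map_neg := fun _ => rfl
    map_inv := fun _ => rfl }

end Carrier

theorem elem_of_le {n i : ℕ} (h : n ≤ i) : D.elem n i = 0 := by
  rw [elem, List.getD_eq_default _ _ ((List.length_take_le _ _).trans h), Nat.zero_mod]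

theorem exists_list_getD {ι : Type*} [Finite ι] {c : ι → ℕ} (hc : Function.Injective c)
    (f : ι → ℕ) : ∃ l : List ℕ, ∀ i, l.getD (c i) 0 = f i := by
  obtain ⟨M, hM⟩ := (Set.finite_range c).bddAbove
  refine ⟨(List.range (M + 1)).map (Function.extend c f 0), fun i => ?_⟩
  have hi : c i < M + 1 := Nat.lt_succ_of_le (hM ⟨i, rfl⟩)
  simp [List.getD_eq_getElem?_getD, hi, hc.extend_apply]

theorem exists_equiv_fin_map_zero (Q : Type*) [Zero Q] [Finite Q] :
    ∃ (N : ℕ) (e : Q ≃ Fin (N + 1)), e 0 = 0 := by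
  obtain ⟨N, hN⟩ : ∃ N, Nat.card Q = N + 1 := Nat.exists_eq_succ_of_ne_zero Nat.card_pos.ne'
  let e : Q ≃ Fin (N + 1) := Finite.equivFinOfCardEq hN
  exact ⟨N, e.trans (Equiv.swap (e 0) 0), by simp⟩

theorem exists_represents (Q : Type u) [SkewBrace Q] [Finite Q] (n : ℕ) (x : ℕ → Q)
    (hx : ∀ i, n ≤ i → x i = 0) :
    ∃ (D : Table) (e : Q → ℕ), D.Represents Q e ∧ ∀ i, e (x i) = D.elem n i := by
  obtain ⟨N, φ, hφ⟩ := exists_equiv_fin_map_zero Q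
  let e (y : Q) : ℕ := φ y
  have inj : Function.Injective e := Fin.val_injective.comp φ.injective
  have pair_inj : Function.Injective fun y : Q × Q => Nat.pair (e y.1) (e y.2) := fun y z h =>
    Prod.ext (inj (Nat.pair_eq_pair.1 h).1) (inj (Nat.pair_eq_pair.1 h).2)
  have map_zero : e 0 = 0 := congrArg Fin.val hφ
  have mod_eq {l : List ℕ} {i : ℕ} {y : Q} (h : l.getD i 0 = e y) :
      e y = l.getD i 0 % (N + 1) := by
    rw [h, Nat.mod_eq_of_lt (φ y).2]
  obtain ⟨sums, hsums⟩ := exists_list_getD pair_inj fun y => e (y.1 + y.2)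
  obtain ⟨prods, hprods⟩ := exists_list_getD pair_inj fun y => e (y.1 * y.2)
  obtain ⟨negs, hnegs⟩ := exists_list_getD inj fun y => e (-y)
  obtain ⟨invs, hinvs⟩ := exists_list_getD inj fun y => e y⁻¹
  obtain ⟨elems, helems⟩ := exists_list_getD (Fin.val_injective (n := n)) fun i => e (x i)
  let D : Table := (N, sums, prods, negs, invs, elems)
  refine ⟨D, e, ⟨inj, fun y => (φ y).2, fun a ha => ⟨φ.symm ⟨a, ha⟩, by simp [e]⟩, map_zero,
    fun y z => mod_eq (hsums (y, z)), fun y z => mod_eq (hprods (y, z)),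
    fun y => mod_eq (hnegs y), fun y => mod_eq (hinvs y)⟩, fun i => ?_⟩
  rcases lt_or_ge i n with hi | hi
  · refine mod_eq ?_
    rw [List.getD_eq_getElem?_getD, List.getElem?_take_of_lt hi, ← List.getD_eq_getElem?_getD]
    exact helems ⟨i, hi⟩
  · rw [hx i hi, map_zero, D.elem_of_le hi]

section Presentation

open FiniteBracePresentation

variable {P : FiniteBracePresentation} {B : Type u} [SkewBrace B]
  {θ : BraceHom (FreeBrace (Fin P.n)) B}

theorem not_isSupersoluble_of_isObstruction (hθ : P.IsPresentation θ) {D : Table}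
    (hD : D.IsBrace) (hP : D.IsObstruction P.code) : ¬ SkewBrace.IsSupersoluble B := by
  let := Carrier.skewBrace hD
  have hrep : D.Represents D.Carrier Subtype.val := Carrier.represents hD
  have := hrep.finite
  obtain ⟨_, hrel, hsurj, hprime⟩ :=
    (hrep.isObstruction_iff (x := fun i => Carrier.ofMod D _) fun i => rfl).1 hP
  obtain ⟨f, hf⟩ := hθ.exists_hom hrel fun i hi => Subtype.ext (D.elem_of_le hi)
  refine not_isSupersoluble_of_not_hasIdealOfPrimeOrder f (fun y => ?_) hprime
  obtain ⟨w, hw⟩ := hsurj y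
  exact ⟨_, (hf w).trans hw⟩

theorem exists_isObstruction (hθ : P.IsPresentation θ) (hB : SkewBrace.IsAlmostPolycyclic B)
    (h : ¬ SkewBrace.IsSupersoluble B) : ∃ D : Table, D.IsBrace ∧ D.IsObstruction P.code := by
  obtain ⟨J, _, hJ, hprime⟩ := exists_finite_quot_not_hasIdealOfPrimeOrder hB h
  let x (i : ℕ) : J.Quot := J.projHom.toFun (genOf θ i)
  have eval_x (w : BWord ℕ) : w.eval x = J.projHom.toFun (w.eval (genOf θ)) :=
    (J.projHom.map_eval _ w).symm
  obtain ⟨D, e, hD, he⟩ := exists_represents J.Quot P.n x fun i hi =>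
    (congrArg J.projHom.toFun (genOf_of_le hi)).trans J.projHom.map_zero
  refine ⟨D, hD.isBrace, (hD.isObstruction_iff he).2 ⟨hJ, fun w hw => ?_, fun y => ?_, hprime⟩⟩
  · rw [eval_x, hθ.eval_relator hw, J.projHom.map_zero]
  · obtain ⟨b, rfl⟩ := J.proj_surjective y
    obtain ⟨w, rfl⟩ := hθ.exists_eval b
    exact ⟨w, eval_x w⟩

end Presentation

end Table

theorem theorem3p46 :
    ∃ alg : ℕ × List (BWord ℕ) →. Bool, Partrec alg ∧
      ∀ (B : Type u) [SkewBrace B] (P : FiniteBracePresentation)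
        (θ : BraceHom (FreeBrace (Fin P.n)) B), P.IsPresentation θ →
        SkewBrace.IsAlmostPolycyclic B →
        ∃ answer : Bool, answer ∈ alg P.code ∧
          (answer = true ↔ SkewBrace.IsSupersoluble B) := by
  obtain ⟨alg, halg, of_true, of_false, halts⟩ :=
    BWord.semidecidable_supersolubilityCertificate.exists_partrec
      Table.semidecidable_exists_isObstruction
  refine ⟨alg, halg, fun B _ P θ hθ hB => ?_⟩
  have exists_certificate_iff := BWord.exists_supersolubilityCertificate_iff hθ
  obtain ⟨answer, hanswer⟩ := halts P.code <| by
    by_cases h : SkewBrace.IsSupersoluble B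
    · exact Or.inl (exists_certificate_iff.2 h)
    · exact Or.inr (Table.exists_isObstruction hθ hB h)
  refine ⟨answer, hanswer, ?_⟩
  cases answer with
  | true => exact iff_of_true rfl (exists_certificate_iff.1 (of_true _ hanswer))
  | false =>
    obtain ⟨D, hD, hP⟩ := of_false _ hanswer
    exact iff_of_false Bool.false_ne_true (Table.not_isSupersoluble_of_isObstruction hθ hD hP)
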